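/- Let $N\ge 4$. Let $P_k(N)$ be the partition algebra over $\mathbb C$ with basis the diagrams $d_\pi$, $\pi$ a set partition of $\{1,\dots,k,1',\dots,k'\}$ (unprimed vertices at the bottom), with $d_\pi d_{\pi'}=N^c d_{\pi''}$ ($d_\pi$ placed above $d_{\pi'}$, $c$ the number of removed middle components). Let $P_{k+\frac12}(N)\subset P_{k+1}(N)$ be the span of the diagrams in which $k+1$ and $(k+1)'$ are in the same block; $P_k(N)\subset P_{k+\frac12}(N)$ by adding a vertical strand on the right. $P_k(N)$ acts on $V_N^{\otimes k}$ (with $V_N=\mathbb C^N$) by $d_\pi\mapsto D_\pi$, where $(D_\pi)^{i_{1'}\cdots i_{k'}}_{i_1\cdots i_k}$ is $1$ if $i_a=i_b$ whenever $a,b$ are in the same block of $\pi$ and $0$ otherwise; $P_{k+\frac12}(N)$ acts on $V_N^{\otimes k}$ by $(\Delta_\pi)^{i_{1'}\cdots i_{k'}}_{i_1\cdots i_k}=(D_\pi)^{i_{1'}\cdots i_{k'}N}_{i_1\cdots i_kN}$. These actions commute with $S_N$ and with $S_{N-1}$ (the stabilizer of $N$), respectively. Let $\Lambda_{k,N}$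 (resp. $\Lambda_{k+\frac12,N}$) be the set of partitions of $N$ (resp. $N-1$) with at most $k$ boxes below the first row. For $\lambda$ in it let $V_\lambda$ be the Specht module and $Z_\lambda=\mathrm{Hom}_{S_N}(V_\lambda,V_N^{\otimes k})$ (resp. $\mathrm{Hom}_{S_{N-1}}(V_\lambda,V_N^{\otimes k})$), a representation of $P_k(N)$ (resp. $P_{k+\frac12}(N)$); let $\hat\chi^\lambda(x)$ be the trace of $x$ on $Z_\lambda$ divided by $\dim Z_\lambda$. For $l\in\{1,\frac32,2\}$ and $\lambda\in\Lambda_{l,N}$ let $p_\lambda\in P_l(N)$ be the element acting as $1$ on $Z_\lambda$ and as $0$ on $Z_\rho$ for $\rho\in\Lambda_{l,N}$, $\rho\ne\lambda$. A vacillating tableau of length two is a sequence $\mathfrak v=(\lambda^{(0)}=[N],\lambda^{(\frac12)}=[N-1],\lambda^{(1)},\lambda^{(\frac32)},\lambda^{(2)})$ with $\lambda^{(l)}\in\Lambda_{l,N}$ in which boxes are alternately removed and added, one at a time; its shape is $\lambda^{(2)}$, and $p_{\mathfrak v}=p_{\lambda^{(1)}}p_{\lambda^{(3/2)}}p_{\lambda^{(2)}}\in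 P_2(N)$. Writing $[\cdots]$ for the diagram with the given blocks, put $Z_1=[1|1']\in P_1(N)$ and, in $P_2(N)$, $$Z_{1\frac12}=[11'|22']+[22'|1|1']-[122'|1']-[1'2'2|1]+N[121'2'],$$ $$Z_2=[11'|22']+[11'|2|2']+[22'|1|1']-[1'2'2|1]-[1'2'1|2]-[121'|2']-[122'|1']+[12'|21']+[12|1'2']+N[121'2'].$$ Then the following hold. (a) $Z_1$, $Z_{1\frac12}\in P_{1+\frac12}(N)$ and $Z_2$ act on $V_N$, $V_N$ and $V_N^{\otimes2}$ as $\sum_{1\le i<j\le N}(ij)-\binom N2+N$, $\sum_{1\le i<j\le N-1}(ij)-\binom N2+2N-1$ and $\sum_{1\le i<j\le N}(ij)-\binom N2+2N$, respectively. On $Z_\rho$, with $\rho\in\Lambda_{1,N}$, $\Lambda_{1+\frac12,N}$, $\Lambda_{2,N}$, they act as the scalars $\hat\chi^\rho(Z_1)=c(\rho)-\binom N2+N$, $\hat\chi^\rho(Z_{1\frac12})=c(\rho)-\binom N2+2N-1$, $\hat\chi^\rho(Z_2)=c(\rho)-\binom N2+2N$, where $c(\rho)=\sum_{(i,j)\in\rho}(j-i)$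 is the sum of the contents. In each of the three cases these scalars are distinct for distinct $\rho$. (b) For $l\in\{1,\frac32,2\}$ and $\lambda\in\Lambda_{l,N}$ the projector $p_\lambda\in P_l(N)$ exists and is unique. (c) For every vacillating tableau $\mathfrak v$ of length two, $$p_{\mathfrak v}=\prod_{\substack{\rho\in\Lambda_{1,N}\\ \rho\ne\lambda^{(1)}}}\frac{Z_1-\hat\chi^{\rho}(Z_1)}{\hat\chi^{\lambda^{(1)}}(Z_1)-\hat\chi^{\rho}(Z_1)}\prod_{\substack{\rho\in\Lambda_{1+\frac12,N}\\ \rho\ne\lambda^{(3/2)}}}\frac{Z_{1\frac12}-\hat\chi^{\rho}(Z_{1\frac12})}{\hat\chi^{\lambda^{(3/2)}}(Z_{1\frac12})-\hat\chi^{\rho}(Z_{1\frac12})}\prod_{\substack{\rho\in\Lambda_{2,N}\\ \rho\ne\lambda^{(2)}}}\frac{Z_2-\hat\chi^{\rho}(Z_2)}{\hat\chi^{\lambda^{(2)}}(Z_2)-\hat\chi^{\rho}(Z_2)},$$ where $Z_1$ in the first product denotes its image $[22'|1|1']$ in $P_2(N)$. (d) The image of $p_{\mathfrak v}$ on $Z_\lambda$,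 $\lambda$ the shape of $\mathfrak v$, is one-dimensional. (e) There is a basis of $P_2(N)$ consisting of matrix units $Q_{\mathfrak v\mathfrak v'}$, indexed by the pairs of vacillating tableaux of length two of the same shape, i.e. $Q_{\mathfrak v\mathfrak v'}Q_{\mathfrak w\mathfrak w'}=\delta_{\mathfrak v'\mathfrak w}Q_{\mathfrak v\mathfrak w'}$, such that for all such pairs the image of $P_2(N)\to P_2(N)$, $d\mapsto p_{\mathfrak v}\,d\,p_{\mathfrak v'}$, is one-dimensional and spanned by $Q_{\mathfrak v\mathfrak v'}$. -/

import Mathlib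

namespace PartAlg

/-! ### Partition diagrams and their concatenation -/

/-- Partition diagrams with two rows of `k` vertices, i.e. set partitions of
`{1, …, k, 1', …, k'}`.  The vertex `inl a` is the bottom vertex `a`, and `inr a` is the top
vertex `a'`. -/
abbrev Diagram (k : ℕ) : Type := Setoid (Fin k ⊕ Fin k)

/-- Three rows of vertices: bottom, top, middle (in this order). -/
abbrev ThreeRows (k : ℕ) : Type := (Fin k ⊕ Fin k) ⊕ Fin k

/-- The vertices of the upper diagram (its bottom row is the middle row). -/
def upperRows (k : ℕ) : Fin k ⊕ Fin k → ThreeRows k :=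
  Sum.elim (fun a => .inr a) (fun a => .inl (.inr a))

/-- The vertices of the lower diagram (its top row is the middle row). -/
def lowerRows (k : ℕ) : Fin k ⊕ Fin k → ThreeRows k :=
  Sum.elim (fun a => .inl (.inl a)) (fun a => .inr a)

/-- The connected components after placing `π` above `π'` and identifying the bottom row of `π`
with the top row of `π'`. -/
def stack {k : ℕ} (π π' : Diagram k) : Setoid (ThreeRows k) :=
  π.map (upperRows k) ⊔ π'.map (lowerRows k)

/-- The diagram obtained from the stacked diagrams by forgetting the middle row. -/
abbrev concat {k : ℕ} (π π' : Diagram k) : Diagram k :=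
  (stack π π').comap Sum.inl

/-- The number of connected components of the stacked diagrams contained in the middle row. -/
noncomputable def loops {k : ℕ} (π π' : Diagram k) : ℕ :=
  Nat.card {c : Quotient (stack π π') // ∀ x : Fin k ⊕ Fin k, Quotient.mk _ (Sum.inl x) ≠ c}

/-- The identity diagram, with blocks `{a, a'}`. -/
abbrev idDiagram (k : ℕ) : Diagram k := Setoid.ker (Sum.elim id id)

/-- The diagram whose blocks are the level sets of a labelling of the bottom row by `b` and of the
top row by `t`. -/
abbrev ofLabels {k : ℕ} (b t : Fin k → ℕ) : Diagram k := Setoid.ker (Sum.elim b t)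

/-! ### The operators attached to diagrams -/

open Classical in
/-- The matrix entry `(D_π)^j_i`, with `i` the indices at the bottom and `j` those at the top. -/
noncomputable def entry {k N : ℕ} (π : Diagram k) (i j : Fin k → Fin N) : ℂ :=
  if π ≤ Setoid.ker (Sum.elim i j) then 1 else 0

lemma stack_le_ker {k N : ℕ} (π π' : Diagram k) (i j m : Fin k → Fin N) :
    stack π π' ≤ Setoid.ker (Sum.elim (Sum.elim i j) m) ↔
      π ≤ Setoid.ker (Sum.elim m j) ∧ π' ≤ Setoid.ker (Sum.elim i m) := by
  have h : ∀ (ρ : Diagram k) (f : Fin k ⊕ Fin k → ThreeRows k) (g : ThreeRows k → Fin N),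
      ρ.map f ≤ Setoid.ker g ↔ ρ ≤ Setoid.ker (g ∘ f) := by
    intro ρ f g
    constructor
    · intro hle x y hxy
      exact hle (Relation.EqvGen.rel _ _ ⟨x, y, hxy, rfl, rfl⟩)
    · intro hle
      refine Setoid.eqvGen_le ?_
      rintro _ _ ⟨x, y, hxy, rfl, rfl⟩
      exact hle hxy
  have h1 : Sum.elim (Sum.elim i j) m ∘ upperRows k = Sum.elim m j := by
    funext x; rcases x with x | x <;> rfl
  have h2 : Sum.elim (Sum.elim i j) m ∘ lowerRows k = Sum.elim i m := by
    funext x; rcases x with x | x <;> rfl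
  rw [stack, sup_le_iff, h, h, h1, h2]

/-- Functions on a quotient with prescribed values on a part of it. -/
noncomputable def extEquiv {B Q X : Type*} (q : B → Q) (e : B → X)
    (he : ∀ x y, q x = q y → e x = e y) :
    {h : Q → X // ∀ b, h (q b) = e b} ≃ ({c : Q // ∀ b, q b ≠ c} → X) where
  toFun h := fun c => h.1 c.1
  invFun g := by
    classical
    exact ⟨fun c => if hc : ∃ b, q b = c then e hc.choose else g ⟨c, fun b hb => hc ⟨b, hb⟩⟩, by
      intro b
      have hc : ∃ b', q b' = q b := ⟨b, rfl⟩
      simp only [hc, dif_pos]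
      exact he _ _ hc.choose_spec⟩
  left_inv h := by
    apply Subtype.ext
    funext c
    by_cases hc : ∃ b, q b = c
    · simp only [hc, dif_pos]
      rw [← h.2, hc.choose_spec]
    · simp only [hc, dif_neg, not_false_eq_true]
  right_inv g := by
    funext c
    have hc : ¬ ∃ b, q b = c.1 := fun ⟨b, hb⟩ => c.2 b hb
    simp only [hc, dif_neg, not_false_eq_true]

/-- Labellings of the three rows with given outer labels that are constant on components. -/
noncomputable def middleEquiv {k N : ℕ} (π π' : Diagram k) (i j : Fin k → Fin N) :
    {m : Fin k → Fin N // stack π π' ≤ Setoid.ker (Sum.elim (Sum.elim i j) m)} ≃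
      {h : Quotient (stack π π') → Fin N //
        ∀ b : Fin k ⊕ Fin k, h (Quotient.mk _ (Sum.inl b)) = Sum.elim i j b} where
  toFun m := ⟨fun c => Quotient.lift (Sum.elim (Sum.elim i j) m.1) (fun _ _ hab => m.2 hab) c,
    fun _ => rfl⟩
  invFun h := ⟨fun a => h.1 (Quotient.mk _ (Sum.inr a)), by
    have : Sum.elim (Sum.elim i j) (fun a => h.1 (Quotient.mk _ (Sum.inr a))) =
        fun x => h.1 (Quotient.mk _ x) := by
      funext x
      rcases x with x | x
      · exact (h.2 x).symm
      · rfl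
    rw [this]
    intro x y hxy
    exact congrArg h.1 (Quotient.sound hxy)⟩
  left_inv m := by
    apply Subtype.ext
    rfl
  right_inv h := by
    apply Subtype.ext
    funext c
    induction c using Quotient.inductionOn with
    | h x =>
      rcases x with x | x
      · exact (h.2 x).symm
      · rfl

lemma sum_entry_mul {k N : ℕ} (π π' : Diagram k) (i j : Fin k → Fin N) :
    ∑ m : Fin k → Fin N, entry π m j * entry π' i m =
      (N : ℂ) ^ loops π π' * entry (concat π π') i j := by
  classical
  have h1 : ∀ m : Fin k → Fin N, entry π m j * entry π' i m =
      if stack π π' ≤ Setoid.ker (Sum.elim (Sum.elim i j) m) then 1 else 0 := by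
    intro m
    simp only [entry, stack_le_ker]
    by_cases ha : π ≤ Setoid.ker (Sum.elim m j) <;>
      by_cases hb : π' ≤ Setoid.ker (Sum.elim i m) <;> simp [ha, hb]
  simp_rw [h1]
  rw [Finset.sum_boole, ← Fintype.card_subtype, ← Nat.card_eq_fintype_card,
    Nat.card_congr (middleEquiv π π' i j)]
  by_cases hc : concat π π' ≤ Setoid.ker (Sum.elim i j)
  · have he : ∀ x y : Fin k ⊕ Fin k,
        Quotient.mk (stack π π') (Sum.inl x) = Quotient.mk (stack π π') (Sum.inl y) →
          Sum.elim i j x = Sum.elim i j y := by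
      intro x y hxy
      have h2 : stack π π' (Sum.inl x) (Sum.inl y) := Quotient.exact hxy
      exact hc h2
    rw [Nat.card_congr (extEquiv (fun b : Fin k ⊕ Fin k =>
      Quotient.mk (stack π π') (Sum.inl b)) (Sum.elim i j) he)]
    simp [entry, hc, loops]
  · have : IsEmpty {h : Quotient (stack π π') → Fin N //
        ∀ b : Fin k ⊕ Fin k, h (Quotient.mk _ (Sum.inl b)) = Sum.elim i j b} := by
      constructor
      rintro ⟨h, hh⟩
      apply hc
      intro x y hxy
      change Sum.elim i j x = Sum.elim i j y
      rw [← hh x, ← hh y]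
      exact congrArg h (Quotient.sound hxy)
    rw [Nat.card_of_isEmpty, entry, if_neg hc]
    simp

lemma eq_of_smul_entry {k : ℕ} {π ρ : Diagram k} {a b : ℕ}
    (h : ∀ N : ℕ, ∀ i j : Fin k → Fin N, (N : ℂ) ^ a * entry π i j = (N : ℂ) ^ b * entry ρ i j) :
    π = ρ ∧ a = b := by
  classical
  have key : ∀ {π ρ : Diagram k} {a b : ℕ},
      (∀ N : ℕ, ∀ i j : Fin k → Fin N,
        (N : ℂ) ^ a * entry π i j = (N : ℂ) ^ b * entry ρ i j) → ρ ≤ π := by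
    intro π ρ a b h
    let N := Fintype.card (Quotient π)
    let g : Fin k ⊕ Fin k → Fin (N + 1) :=
      fun x => Fin.castSucc (Fintype.equivFin (Quotient π) (Quotient.mk _ x))
    have hg : Setoid.ker g = π := by
      ext x y
      simp only [g, Setoid.ker_def, Fin.castSucc_inj, EmbeddingLike.apply_eq_iff_eq]
      exact Quotient.eq
    have hs : Sum.elim (fun x => g (.inl x)) (fun x => g (.inr x)) = g := by
      funext x; rcases x with x | x <;> rfl
    have h2 := h (N + 1) (fun x => g (.inl x)) (fun x => g (.inr x))
    rw [entry, entry, hs, hg, if_pos le_rfl] at h2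
    by_contra hle
    rw [if_neg hle, mul_one, mul_zero] at h2
    exact pow_ne_zero _ (by exact_mod_cast Nat.succ_ne_zero N) h2
  have e : π = ρ := le_antisymm (key fun N i j => (h N i j).symm) (key h)
  refine ⟨e, ?_⟩
  subst e
  have h2 := h 2 (fun _ => 0) (fun _ => 0)
  have h3 : entry π (fun _ : Fin k => (0 : Fin 2)) (fun _ => 0) = 1 := by
    rw [entry, if_pos]
    intro x y _
    rcases x with x | x <;> rcases y with y | y <;> rfl
  rw [h3, mul_one, mul_one] at h2
  have h4 : (2 : ℕ) ^ a = 2 ^ b := by exact_mod_cast h2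
  exact Nat.pow_right_injective le_rfl h4

lemma entry_idDiagram {k N : ℕ} (i j : Fin k → Fin N) :
    entry (idDiagram k) i j = if i = j then 1 else 0 := by
  have : idDiagram k ≤ Setoid.ker (Sum.elim i j) ↔ i = j := by
    constructor
    · intro h
      funext a
      exact h (show (idDiagram k) (.inl a) (.inr a) from rfl)
    · rintro rfl x y hxy
      have hxy' : Sum.elim id id x = (Sum.elim id id y : Fin k) := hxy
      change Sum.elim i i x = Sum.elim i i y
      have h : ∀ z : Fin k ⊕ Fin k, Sum.elim i i z = i (Sum.elim id id z) := by
        rintro (z | z) <;> rfl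
      rw [h, h, hxy']
  simp only [entry, this]

lemma concat_assoc {k : ℕ} (π ρ τ : Diagram k) :
    concat (concat π ρ) τ = concat π (concat ρ τ) ∧
      loops π ρ + loops (concat π ρ) τ = loops ρ τ + loops π (concat ρ τ) := by
  apply eq_of_smul_entry
  intro N i j
  rw [pow_add, pow_add, mul_assoc, mul_assoc, ← sum_entry_mul, ← sum_entry_mul, Finset.mul_sum,
    Finset.mul_sum]
  have h1 : ∀ m : Fin k → Fin N, (N : ℂ) ^ loops π ρ * (entry (concat π ρ) m j * entry τ i m) =
      ∑ l : Fin k → Fin N, entry π l j * entry ρ m l * entry τ i m := by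
    intro m
    rw [← mul_assoc, ← sum_entry_mul, Finset.sum_mul]
  have h2 : ∀ l : Fin k → Fin N, (N : ℂ) ^ loops ρ τ * (entry π l j * entry (concat ρ τ) i l) =
      ∑ m : Fin k → Fin N, entry π l j * entry ρ m l * entry τ i m := by
    intro l
    rw [mul_left_comm, ← sum_entry_mul, Finset.mul_sum]
    exact Finset.sum_congr rfl fun m _ => (mul_assoc _ _ _).symm
  simp_rw [h1, h2]
  exact Finset.sum_comm

lemma id_concat {k : ℕ} (π : Diagram k) :
    concat (idDiagram k) π = π ∧ loops (idDiagram k) π = 0 := by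
  apply eq_of_smul_entry
  intro N i j
  rw [← sum_entry_mul]
  simp [entry_idDiagram]

lemma concat_id {k : ℕ} (π : Diagram k) :
    concat π (idDiagram k) = π ∧ loops π (idDiagram k) = 0 := by
  apply eq_of_smul_entry
  intro N i j
  rw [← sum_entry_mul]
  simp [entry_idDiagram]

/-! ### The partition algebra -/

/-- The partition algebra `P_k(N)` over `ℂ`: the vector space with basis the partition diagrams. -/
def PartitionAlgebra (k _N : ℕ) : Type := Diagram k →₀ ℂ

noncomputable instance (k N : ℕ) : AddCommGroup (PartitionAlgebra k N) :=
  inferInstanceAs (AddCommGroup (Diagram k →₀ ℂ))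

noncomputable instance (k N : ℕ) : Module ℂ (PartitionAlgebra k N) :=
  inferInstanceAs (Module ℂ (Diagram k →₀ ℂ))

/-- The diagram `d_π` as an element of `P_k(N)`. -/
noncomputable def diag {k N : ℕ} (π : Diagram k) : PartitionAlgebra k N := Finsupp.single π 1

/-- The linear map on `P_k(N)` with prescribed values on the diagrams. -/
noncomputable def linExt {k N : ℕ} {M : Type*} [AddCommGroup M] [Module ℂ M]
    (f : Diagram k → M) : PartitionAlgebra k N →ₗ[ℂ] M :=
  Finsupp.linearCombination ℂ f

lemma linExt_diag {k N : ℕ} {M : Type*} [AddCommGroup M] [Module ℂ M] (f : Diagram k → M)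
    (π : Diagram k) : linExt f (diag π : PartitionAlgebra k N) = f π := by
  unfold linExt diag
  exact (Finsupp.linearCombination_single ℂ 1 π).trans (one_smul _ _)

lemma hom_ext {k N : ℕ} {M : Type*} [AddCommGroup M] [Module ℂ M]
    {f g : PartitionAlgebra k N →ₗ[ℂ] M} (h : ∀ π, f (diag π) = g (diag π)) : f = g :=
  Finsupp.lhom_ext' fun π => LinearMap.ext_ring (h π)

/-- Multiplication in `P_k(N)`: `d_π d_π' = N ^ c d_π''`, where `d_π''` is the concatenation of
`d_π` (above) and `d_π'` (below) and `c` is the number of removed components. -/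
noncomputable def mulMap (k N : ℕ) :
    PartitionAlgebra k N →ₗ[ℂ] PartitionAlgebra k N →ₗ[ℂ] PartitionAlgebra k N :=
  linExt fun π => linExt fun π' => (N : ℂ) ^ loops π π' • diag (concat π π')

lemma mulMap_diag {k N : ℕ} (π π' : Diagram k) :
    mulMap k N (diag π) (diag π') = (N : ℂ) ^ loops π π' • diag (concat π π') := by
  rw [mulMap, linExt_diag, linExt_diag]

@[elab_as_elim]
lemma induct {k N : ℕ} {p : PartitionAlgebra k N → Prop} (x : PartitionAlgebra k N)
    (zero : p 0) (add : ∀ x y, p x → p y → p (x + y))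
    (smul_diag : ∀ (c : ℂ) (π : Diagram k), p (c • diag π)) : p x := by
  refine Finsupp.induction_linear (motive := p) x zero add fun π c => ?_
  have h : (Finsupp.single π c : Diagram k →₀ ℂ) = c • Finsupp.single π 1 := by simp
  rw [h]
  exact smul_diag c π

lemma mulMap_assoc {k N : ℕ} (x y z : PartitionAlgebra k N) :
    mulMap k N (mulMap k N x y) z = mulMap k N x (mulMap k N y z) := by
  induction x using induct with
  | zero => simp
  | add x x' hx hx' => simp only [map_add, LinearMap.add_apply, hx, hx']
  | smul_diag c π =>
    induction y using induct with
    | zero => simp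
    | add y y' hy hy' => simp only [map_add, LinearMap.add_apply, hy, hy']
    | smul_diag c' ρ =>
      induction z using induct with
      | zero => simp
      | add z z' hz hz' => simp only [map_add, hz, hz']
      | smul_diag c'' τ =>
        obtain ⟨h1, h2⟩ := concat_assoc π ρ τ
        simp only [map_smul, LinearMap.smul_apply, mulMap_diag, smul_smul, h1]
        congr 1
        have h3 := congrArg (fun e => (N : ℂ) ^ e) h2
        simp only [pow_add] at h3
        linear_combination c * c' * c'' * h3

lemma mulMap_one_left {k N : ℕ} (x : PartitionAlgebra k N) :
    mulMap k N (diag (idDiagram k)) x = x := by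
  induction x using induct with
  | zero => simp
  | add x y hx hy => simp only [map_add, hx, hy]
  | smul_diag c π => simp [mulMap_diag, id_concat]

lemma mulMap_one_right {k N : ℕ} (x : PartitionAlgebra k N) :
    mulMap k N x (diag (idDiagram k)) = x := by
  induction x using induct with
  | zero => simp
  | add x y hx hy => simp only [map_add, LinearMap.add_apply, hx, hy]
  | smul_diag c π => simp [mulMap_diag, concat_id]

noncomputable instance (k N : ℕ) : Ring (PartitionAlgebra k N) where
  mul x y := mulMap k N x y
  one := diag (idDiagram k)
  left_distrib x y z := map_add (mulMap k N x) y z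
  right_distrib x y z := by
    change mulMap k N (x + y) z = mulMap k N x z + mulMap k N y z
    rw [map_add, LinearMap.add_apply]
  zero_mul x := by
    change mulMap k N 0 x = 0
    simp
  mul_zero x := map_zero (mulMap k N x)
  mul_assoc := mulMap_assoc
  one_mul := mulMap_one_left
  mul_one := mulMap_one_right
  neg_add_cancel := neg_add_cancel
  zsmul := fun n x => n • x
  zsmul_zero' := SubNegMonoid.zsmul_zero'
  zsmul_succ' := SubNegMonoid.zsmul_succ'
  zsmul_neg' := SubNegMonoid.zsmul_neg'
  nsmul := fun n x => n • x
  nsmul_zero := AddMonoid.nsmul_zero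
  nsmul_succ := AddMonoid.nsmul_succ
  sub_eq_add_neg := sub_eq_add_neg

lemma mul_eq_mulMap {k N : ℕ} (x y : PartitionAlgebra k N) : x * y = mulMap k N x y := rfl

lemma one_eq_diag {k N : ℕ} : (1 : PartitionAlgebra k N) = diag (idDiagram k) := rfl

lemma diag_mul_diag {k N : ℕ} (π π' : Diagram k) :
    (diag π * diag π' : PartitionAlgebra k N) = (N : ℂ) ^ loops π π' • diag (concat π π') :=
  mulMap_diag π π'

noncomputable instance (k N : ℕ) : Algebra ℂ (PartitionAlgebra k N) :=
  Algebra.ofModule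
    (fun c x y => by simp only [mul_eq_mulMap, map_smul, LinearMap.smul_apply])
    (fun c x y => by simp only [mul_eq_mulMap, map_smul])

/-- The half-integer partition algebra `P_{k+1/2}(N)`, spanned by the diagrams in `P_{k+1}(N)` for
which `k+1` and `(k+1)'` lie in the same block. -/
noncomputable def halfAlgebra (k N : ℕ) : Subalgebra ℂ (PartitionAlgebra (k + 1) N) :=
  Submodule.toSubalgebra
    (Submodule.span ℂ {x | ∃ π : Diagram (k + 1),
      π (.inl (Fin.last k)) (.inr (Fin.last k)) ∧ x = diag π})
    (Submodule.subset_span ⟨idDiagram (k + 1), rfl, rfl⟩)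
    (by
      intro x y hx hy
      induction hx, hy using Submodule.span_induction₂ with
      | mem_mem x y hx hy =>
        obtain ⟨π, hπ, rfl⟩ := hx
        obtain ⟨ρ, hρ, rfl⟩ := hy
        rw [diag_mul_diag]
        refine Submodule.smul_mem _ _ (Submodule.subset_span ⟨_, ?_, rfl⟩)
        have h1 : stack π ρ (.inr (Fin.last k)) (.inl (.inr (Fin.last k))) :=
          (le_sup_left : π.map (upperRows (k + 1)) ≤ stack π ρ)
            (Relation.EqvGen.rel _ _ ⟨_, _, hπ, rfl, rfl⟩)
        have h2 : stack π ρ (.inl (.inl (Fin.last k))) (.inr (Fin.last k)) :=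
          (le_sup_right : ρ.map (lowerRows (k + 1)) ≤ stack π ρ)
            (Relation.EqvGen.rel _ _ ⟨_, _, hρ, rfl, rfl⟩)
        exact (stack π ρ).trans' h2 h1
      | zero_left y hy => rw [zero_mul]; exact Submodule.zero_mem _
      | zero_right x hx => rw [mul_zero]; exact Submodule.zero_mem _
      | add_left x y z _ _ _ h1 h2 => rw [add_mul]; exact Submodule.add_mem _ h1 h2
      | add_right x y z _ _ _ h1 h2 => rw [mul_add]; exact Submodule.add_mem _ h1 h2
      | smul_left r x y _ _ h => rw [smul_mul_assoc]; exact Submodule.smul_mem _ _ h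
      | smul_right r x y _ _ h => rw [mul_smul_comm]; exact Submodule.smul_mem _ _ h)

/-- Adding a vertical strand (the block `{k+1, (k+1)'}`) to the right of a diagram. -/
abbrev strand {k : ℕ} (π : Diagram k) : Diagram (k + 1) :=
  Setoid.ker (Sum.elim
    (Fin.snoc (α := fun _ => Option (Quotient π)) (fun a => some (Quotient.mk π (.inl a))) none)
    (Fin.snoc (α := fun _ => Option (Quotient π)) (fun a => some (Quotient.mk π (.inr a))) none))

/-- The inclusion of `P_k(N)` in `P_{k+1}(N)` (with image in `P_{k+1/2}(N)`). -/
noncomputable def addStrand (k N : ℕ) :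
    PartitionAlgebra k N →ₗ[ℂ] PartitionAlgebra (k + 1) N :=
  linExt fun π => diag (strand π)

/-! ### The actions on tensor powers of the defining representation -/

/-- The tensor power `V_N^{⊗k}` of the defining representation, as the space of tensors with `k`
indices; `e_{i_1} ⊗ ⋯ ⊗ e_{i_k}` is `Pi.single i 1`. -/
abbrev Tensor (N k : ℕ) : Type := (Fin k → Fin N) → ℂ

/-- The diagonal action of `S_N` on `V_N^{⊗k}`:
`σ (e_{i_1} ⊗ ⋯ ⊗ e_{i_k}) = e_{σ i_1} ⊗ ⋯ ⊗ e_{σ i_k}`. -/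
def tensorRep (N k : ℕ) : Representation ℂ (Equiv.Perm (Fin N)) (Tensor N k) where
  toFun σ := LinearMap.funLeft ℂ ℂ fun i : Fin k → Fin N => ⇑σ⁻¹ ∘ i
  map_one' := rfl
  map_mul' σ τ := by
    refine LinearMap.ext fun f => funext fun i => ?_
    change f (⇑(σ * τ)⁻¹ ∘ i) = f (⇑τ⁻¹ ∘ ⇑σ⁻¹ ∘ i)
    rw [mul_inv_rev]
    rfl

lemma tensorRep_single {N k : ℕ} (σ : Equiv.Perm (Fin N)) (i : Fin k → Fin N) :
    tensorRep N k σ (Pi.single i 1) = Pi.single (σ ∘ i) 1 := by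
  funext j
  change (Pi.single i 1 : Tensor N k) (⇑σ⁻¹ ∘ j) = _
  have h : (⇑σ⁻¹ ∘ j = i) = (j = σ ∘ i) := propext (Equiv.symm_comp_eq σ _ _)
  rw [Pi.single_apply, Pi.single_apply]
  simp only [h]

/-- The embedding `S_n ⊂ S_{n+1}` as the stabilizer of the last point. -/
noncomputable def permIncl (n : ℕ) : Equiv.Perm (Fin n) →* Equiv.Perm (Fin (n + 1)) :=
  Equiv.Perm.viaEmbeddingHom Fin.castSuccEmb

/-- The action of `S_n` on `V_{n+1}^{⊗k}`. -/
noncomputable def tensorRepHalf (n k : ℕ) :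
    Representation ℂ (Equiv.Perm (Fin n)) (Tensor (n + 1) k) :=
  (tensorRep (n + 1) k).comp (permIncl n)

/-- The operator `e_i ↦ ∑ j, A i j • e_j` on `V_N^{⊗k}`. -/
noncomputable def opOf {N k : ℕ} (A : (Fin k → Fin N) → (Fin k → Fin N) → ℂ) :
    Tensor N k →ₗ[ℂ] Tensor N k :=
  Matrix.mulVecLin (Matrix.of fun j i => A i j)

lemma entry_comp {k N : ℕ} (π : Diagram k) (σ : Equiv.Perm (Fin N)) (i j : Fin k → Fin N) :
    entry π (σ ∘ i) (σ ∘ j) = entry π i j := by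
  have h : π ≤ Setoid.ker (Sum.elim (σ ∘ i) (σ ∘ j)) ↔ π ≤ Setoid.ker (Sum.elim i j) := by
    have h1 : Sum.elim (σ ∘ i) (σ ∘ j) = σ ∘ Sum.elim i j := by
      funext x; rcases x with x | x <;> rfl
    rw [h1]
    constructor <;> intro hle x y hxy
    · exact σ.injective (hle hxy)
    · exact congrArg σ (hle hxy)
  unfold entry
  by_cases hc : π ≤ Setoid.ker (Sum.elim i j)
  · rw [if_pos hc, if_pos (h.2 hc)]
  · rw [if_neg hc, if_neg (fun h' => hc (h.1 h'))]

lemma opOf_apply {N k : ℕ} (A : (Fin k → Fin N) → (Fin k → Fin N) → ℂ) (f : Tensor N k)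
    (j : Fin k → Fin N) : opOf A f j = ∑ i, A i j * f i := rfl

lemma opOf_comm {N k : ℕ} (A : (Fin k → Fin N) → (Fin k → Fin N) → ℂ)
    (σ : Equiv.Perm (Fin N)) (hA : ∀ i j, A (σ ∘ i) (σ ∘ j) = A i j) :
    opOf A ∘ₗ tensorRep N k σ = tensorRep N k σ ∘ₗ opOf A := by
  refine LinearMap.ext fun f => funext fun j => ?_
  change ∑ i, A i j * f (⇑σ⁻¹ ∘ i) = ∑ i, A i (⇑σ⁻¹ ∘ j) * f i
  refine (Fintype.sum_equiv (Equiv.arrowCongr (Equiv.refl (Fin k)) σ) _ _ fun i => ?_).symm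
  have h1 : Equiv.arrowCongr (Equiv.refl (Fin k)) σ i = σ ∘ i := rfl
  have h2 : ⇑σ⁻¹ ∘ ⇑σ ∘ i = i := by funext a; simp
  have h3 : ⇑σ ∘ ⇑σ⁻¹ ∘ j = j := by funext a; simp
  rw [h1, h2, ← hA i, h3]

/-- The operator `D_π` on `V_N^{⊗k}`, as an `S_N`-equivariant map. -/
noncomputable def diagramMap {k : ℕ} (N : ℕ) (π : Diagram k) :
    Representation.IntertwiningMap (tensorRep N k) (tensorRep N k) where
  toLinearMap := opOf (entry π)
  isIntertwining' σ := opOf_comm _ σ (entry_comp π σ)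

/-- The action of `P_k(N)` on `V_N^{⊗k}`, `d_π ↦ D_π`. -/
noncomputable def schurWeyl (k N : ℕ) : PartitionAlgebra k N →ₐ[ℂ]
    Representation.IntertwiningMap (tensorRep N k) (tensorRep N k) :=
  AlgHom.ofLinearMap (linExt (diagramMap N))
    (by
      rw [one_eq_diag, linExt_diag]
      refine Representation.IntertwiningMap.ext (LinearMap.ext fun f => funext fun j => ?_)
      change opOf (entry (idDiagram k)) f j = f j
      simp [opOf_apply, entry_idDiagram])
    (by
      have hd : ∀ π ρ : Diagram k, diagramMap N π * diagramMap N ρ =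
          (N : ℂ) ^ loops π ρ • diagramMap N (concat π ρ) := by
        intro π ρ
        refine Representation.IntertwiningMap.ext (LinearMap.ext fun f => funext fun j => ?_)
        change ∑ m, entry π m j * ∑ i, entry ρ i m * f i =
          (N : ℂ) ^ loops π ρ * ∑ i, entry (concat π ρ) i j * f i
        simp_rw [Finset.mul_sum, ← mul_assoc, ← sum_entry_mul, Finset.sum_mul]
        exact Finset.sum_comm
      intro x y
      induction x using induct with
      | zero => simp
      | add x x' hx hx' => rw [add_mul, map_add, map_add, add_mul, hx, hx']
      | smul_diag c π =>
        induction y using induct with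
        | zero => simp
        | add y y' hy hy' => rw [mul_add, map_add, map_add, mul_add, hy, hy']
        | smul_diag c' ρ =>
          simp only [smul_mul_assoc, mul_smul_comm, map_smul, diag_mul_diag, linExt_diag, hd])

lemma permIncl_castSucc {n : ℕ} (σ : Equiv.Perm (Fin n)) (a : Fin n) :
    permIncl n σ a.castSucc = (σ a).castSucc :=
  Equiv.Perm.viaEmbedding_apply σ Fin.castSuccEmb a

lemma permIncl_last {n : ℕ} (σ : Equiv.Perm (Fin n)) : permIncl n σ (Fin.last n) = Fin.last n := by
  refine Equiv.Perm.viaEmbedding_apply_of_notMem σ Fin.castSuccEmb (Fin.last n) ?_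
  rintro ⟨a, ha⟩
  exact (Fin.castSucc_lt_last a).ne ha

/-- The operator `Δ_π` on `V_{n+1}^{⊗k}`, as an `S_n`-equivariant map.  Its matrix entries are those
of `D_π` on `V_{n+1}^{⊗(k+1)}` with the last upper and the last lower index equal to `n+1`. -/
noncomputable def diagramMapHalf {k : ℕ} (n : ℕ) (π : Diagram (k + 1)) :
    Representation.IntertwiningMap (tensorRepHalf n k) (tensorRepHalf n k) where
  toLinearMap := opOf fun i j =>
    entry π (Fin.snoc (α := fun _ => Fin (n + 1)) i (Fin.last n))
      (Fin.snoc (α := fun _ => Fin (n + 1)) j (Fin.last n))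
  isIntertwining' σ := opOf_comm _ (permIncl n σ) fun i j => by
    have h : ∀ i : Fin k → Fin (n + 1),
        Fin.snoc (α := fun _ => Fin (n + 1)) (permIncl n σ ∘ i) (Fin.last n) =
          permIncl n σ ∘ Fin.snoc (α := fun _ => Fin (n + 1)) i (Fin.last n) := by
      intro i
      funext a
      refine Fin.lastCases ?_ (fun a => ?_) a
      · simp [permIncl_last]
      · simp
    rw [h, h, entry_comp]

/-- The action of (elements of) `P_{k+1/2}(n+1)` on `V_{n+1}^{⊗k}`, `d_π ↦ Δ_π`. -/
noncomputable def schurWeylHalf (k n : ℕ) : PartitionAlgebra (k + 1) (n + 1) →ₗ[ℂ]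
    Representation.IntertwiningMap (tensorRepHalf n k) (tensorRepHalf n k) :=
  linExt (diagramMapHalf n)

/-! ### Specht modules -/

/-- The Specht polynomial of a bijective filling `T` of a Young diagram: the product, over the
columns, of the Vandermonde products of the variables in that column. -/
noncomputable def spechtPoly {n : ℕ} (μ : YoungDiagram) (T : μ.cells ≃ Fin n) :
    MvPolynomial (Fin n) ℂ :=
  ∏ p : μ.cells × μ.cells with p.1.1.2 = p.2.1.2 ∧ p.1.1.1 < p.2.1.1,
    (MvPolynomial.X (T p.1) - MvPolynomial.X (T p.2))

/-- The vector space of the Specht module `V_μ` of `S_n`, `μ ⊢ n`: the span of the Specht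
polynomials of all fillings of `μ`. -/
noncomputable def specht (n : ℕ) (μ : YoungDiagram) : Submodule ℂ (MvPolynomial (Fin n) ℂ) :=
  Submodule.span ℂ (Set.range fun T : μ.cells ≃ Fin n => spechtPoly μ T)

lemma rename_spechtPoly {n : ℕ} (μ : YoungDiagram) (T : μ.cells ≃ Fin n)
    (σ : Equiv.Perm (Fin n)) :
    MvPolynomial.rename σ (spechtPoly μ T) = spechtPoly μ (T.trans σ) := by
  simp [spechtPoly, map_prod]

lemma rename_mem_specht {n : ℕ} (μ : YoungDiagram) (σ : Equiv.Perm (Fin n))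
    (x : MvPolynomial (Fin n) ℂ) (hx : x ∈ specht n μ) :
    (MvPolynomial.rename σ).toLinearMap x ∈ specht n μ := by
  induction hx using Submodule.span_induction with
  | mem x hx =>
    obtain ⟨T, rfl⟩ := hx
    exact Submodule.subset_span ⟨T.trans σ, (rename_spechtPoly μ T σ).symm⟩
  | zero => rw [map_zero]; exact Submodule.zero_mem _
  | add x y _ _ hx hy => rw [map_add]; exact Submodule.add_mem _ hx hy
  | smul c x _ hx => rw [map_smul]; exact Submodule.smul_mem _ _ hx

/-- The irreducible representation `V_μ` of `S_n` (Specht module), where `S_n` permutes the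
variables. -/
noncomputable def spechtRep (n : ℕ) (μ : YoungDiagram) :
    Representation ℂ (Equiv.Perm (Fin n)) (specht n μ) where
  toFun σ := (MvPolynomial.rename σ).toLinearMap.restrict (rename_mem_specht μ σ)
  map_one' := by
    ext1 x
    apply Subtype.ext
    exact MvPolynomial.rename_id_apply x.1
  map_mul' σ τ := by
    ext1 x
    apply Subtype.ext
    exact (MvPolynomial.rename_rename τ σ x.1).symm

/-! ### Irreducible representations, normalized characters and projectors -/

/-- The set of Young diagrams with `n` boxes, at most `k` of which lie below the first row.  The
labelling set `Λ_{k,N}` is `labels N k`, and `Λ_{k+1/2,N}` is `labels (N-1) k`. -/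
noncomputable def labels (n k : ℕ) : Finset YoungDiagram :=
  Set.Finite.toFinset (s := {μ : YoungDiagram | μ.card = n ∧ μ.card - μ.rowLen 0 ≤ k}) (by
    refine Set.Finite.subset (Set.Finite.preimage (f := YoungDiagram.cells) (s :=
      ((Finset.range n ×ˢ Finset.range n).powerset : Set (Finset (ℕ × ℕ)))) ?_
      (Finset.finite_toSet _)) ?_
    · intro a _ b _ hab
      exact YoungDiagram.ext hab
    · rintro μ ⟨rfl, -⟩
      simp only [Set.mem_preimage, Finset.mem_coe, Finset.mem_powerset]
      rintro ⟨i, j⟩ hij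
      rw [YoungDiagram.mem_cells] at hij
      rw [Finset.mem_product, Finset.mem_range, Finset.mem_range]
      constructor
      · have h1 : i < μ.colLen j := YoungDiagram.mem_iff_lt_colLen.1 hij
        rw [YoungDiagram.colLen_eq_card] at h1
        exact h1.trans_le (Finset.card_le_card (Finset.filter_subset _ _))
      · have h1 : j < μ.rowLen i := YoungDiagram.mem_iff_lt_rowLen.1 hij
        rw [YoungDiagram.rowLen_eq_card] at h1
        exact h1.trans_le (Finset.card_le_card (Finset.filter_subset _ _)))

lemma mem_labels {n k : ℕ} {μ : YoungDiagram} :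
    μ ∈ labels n k ↔ μ.card = n ∧ μ.card - μ.rowLen 0 ≤ k := by
  simp [labels]

/-- The representation space `Z_μ` of `P_k(N)`: the multiplicity space
`Hom_{S_N}(V_μ, V_N^{⊗k})`. -/
abbrev Irrep (k N : ℕ) (μ : YoungDiagram) : Type :=
  Representation.IntertwiningMap (spechtRep N μ) (tensorRep N k)

/-- The representation `D^μ` of `P_k(N)` on `Z_μ`, by composition. -/
noncomputable def irrep (k N : ℕ) (μ : YoungDiagram) :
    PartitionAlgebra k N →ₗ[ℂ] Module.End ℂ (Irrep k N μ) :=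
  Representation.IntertwiningMap.llcomp _ _ _ ∘ₗ (schurWeyl k N).toLinearMap

/-- The representation space `Z_μ^{1/2}` of `P_{k+1/2}(n+1)`: the multiplicity space
`Hom_{S_n}(V_μ, V_{n+1}^{⊗k})`. -/
abbrev IrrepHalf (k n : ℕ) (μ : YoungDiagram) : Type :=
  Representation.IntertwiningMap (spechtRep n μ) (tensorRepHalf n k)

/-- The representation `D^μ` of (elements of) `P_{k+1/2}(n+1)` on `Z_μ^{1/2}`, by composition. -/
noncomputable def irrepHalf (k n : ℕ) (μ : YoungDiagram) :
    PartitionAlgebra (k + 1) (n + 1) →ₗ[ℂ] Module.End ℂ (IrrepHalf k n μ) :=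
  Representation.IntertwiningMap.llcomp _ _ _ ∘ₗ schurWeylHalf k n

/-- The normalized character of `x ∈ P_k(N)` in the representation `Z_μ`. -/
noncomputable def nchar {k N : ℕ} (x : PartitionAlgebra k N) (μ : YoungDiagram) : ℂ :=
  LinearMap.trace ℂ _ (irrep k N μ x) / Module.finrank ℂ (Irrep k N μ)

/-- The normalized character of `x ∈ P_{k+1/2}(n+1)` in the representation `Z_μ^{1/2}`. -/
noncomputable def ncharHalf {k n : ℕ} (x : PartitionAlgebra (k + 1) (n + 1)) (μ : YoungDiagram) :
    ℂ :=
  LinearMap.trace ℂ _ (irrepHalf k n μ x) / Module.finrank ℂ (IrrepHalf k n μ)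

open Classical in
/-- `p ∈ P_k(N)` is the projector `p_μ` to the irreducible representation labelled by `μ`: it acts
as the identity on `Z_μ` and as zero on the other irreducible representations. -/
def IsProj (k N : ℕ) (μ : YoungDiagram) (p : PartitionAlgebra k N) : Prop :=
  ∀ ρ ∈ labels N k, irrep k N ρ p = if ρ = μ then 1 else 0

open Classical in
/-- `p ∈ P_{k+1/2}(n+1)` is the projector `p_μ` to the irreducible representation labelled by
`μ`. -/
def IsProjHalf (k n : ℕ) (μ : YoungDiagram) (p : PartitionAlgebra (k + 1) (n + 1)) : Prop :=
  p ∈ halfAlgebra k (n + 1) ∧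
    ∀ ρ ∈ labels n k, irrepHalf k n ρ p = if ρ = μ then 1 else 0

/-- The projector `p_μ ∈ P_k(N)` (see `IsProj`). -/
noncomputable def proj (k N : ℕ) (μ : YoungDiagram) : PartitionAlgebra k N :=
  Classical.epsilon (IsProj k N μ)

/-- The projector `p_μ ∈ P_{k+1/2}(n+1)` (see `IsProjHalf`). -/
noncomputable def projHalf (k n : ℕ) (μ : YoungDiagram) : PartitionAlgebra (k + 1) (n + 1) :=
  Classical.epsilon (IsProjHalf k n μ)

/-! ### Vacillating tableaux -/

/-- Vacillating tableaux `(λ^(0), λ^(1/2), λ^(1), …, λ^(k))` of length `k` for `N = n + 1`: here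
`whole i` is `λ^(i)` and `half i` is `λ^(i+1/2)`, which is obtained from both `λ^(i)` and
`λ^(i+1)` by removing one box.  (The conditions force `λ^(0) = [n+1]` and `λ^(1/2) = [n]`.) -/
@[ext]
structure VacTab (n k : ℕ) where
  whole : Fin (k + 1) → YoungDiagram
  half : Fin k → YoungDiagram
  whole_mem : ∀ i : Fin (k + 1), whole i ∈ labels (n + 1) i.val
  half_mem : ∀ i : Fin k, half i ∈ labels n i.val
  remove_box : ∀ i, half i ≤ whole i.castSucc
  add_box : ∀ i, half i ≤ whole i.succ

/-- The shape `λ^(k)` of a vacillating tableau. -/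
def VacTab.shape {n k : ℕ} (v : VacTab n k) : YoungDiagram := v.whole (Fin.last k)

/-- The projector `p_v ∈ P_2(n+1)` of a vacillating tableau of length two: the product of the
projectors to `λ^(1)`, `λ^(3/2)` and `λ^(2)`. -/
noncomputable def VacTab.proj {n : ℕ} (v : VacTab n 2) : PartitionAlgebra 2 (n + 1) :=
  addStrand 1 (n + 1) (PartAlg.proj 1 (n + 1) (v.whole 1)) * projHalf 1 n (v.half 1) *
    PartAlg.proj 2 (n + 1) (v.whole 2)

/-! ### The elements `Z_1`, `Z_{3/2}`, `Z_2` -/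

/-- `Z_1 ∈ P_1(N)`. -/
noncomputable def Z₁ (N : ℕ) : PartitionAlgebra 1 N := diag (ofLabels ![0] ![1])

/-- `Z_{1+1/2} ∈ P_{1+1/2}(N)`. -/
noncomputable def Z₃₂ (N : ℕ) : PartitionAlgebra 2 N :=
  diag (ofLabels ![0, 1] ![0, 1]) + diag (ofLabels ![0, 1] ![2, 1])
    - diag (ofLabels ![0, 0] ![1, 0]) - diag (ofLabels ![0, 1] ![1, 1])
    + (N : ℂ) • diag (ofLabels ![0, 0] ![0, 0])

/-- `Z_2 ∈ P_2(N)`. -/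
noncomputable def Z₂ (N : ℕ) : PartitionAlgebra 2 N :=
  diag (ofLabels ![0, 1] ![0, 1]) + diag (ofLabels ![0, 1] ![0, 2])
    + diag (ofLabels ![0, 1] ![2, 1])
    - diag (ofLabels ![0, 1] ![1, 1]) - diag (ofLabels ![0, 1] ![0, 0])
    - diag (ofLabels ![0, 0] ![0, 1]) - diag (ofLabels ![0, 0] ![1, 0])
    + diag (ofLabels ![0, 1] ![1, 0]) + diag (ofLabels ![0, 0] ![1, 1])
    + (N : ℂ) • diag (ofLabels ![0, 0] ![0, 0])

/-- The action of `∑_{i<j} (i j)` in a representation of `S_n`. -/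
noncomputable def transpositionSum {n : ℕ} {V : Type*} [AddCommGroup V] [Module ℂ V]
    (ρ : Representation ℂ (Equiv.Perm (Fin n)) V) : V →ₗ[ℂ] V :=
  ∑ p : Fin n × Fin n with p.1 < p.2, ρ (Equiv.swap p.1 p.2)

/-- The sum of the contents `j - i` of the boxes of a Young diagram. -/
def contentSum (μ : YoungDiagram) : ℤ := ∑ c ∈ μ.cells, ((c.2 : ℤ) - (c.1 : ℤ))

open Classical in
/-- The Lagrange interpolation product `∏_{ρ ∈ s, ρ ≠ μ} (z - χ ρ) / (χ μ - χ ρ)`. -/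
noncomputable def lagrangeProd {A : Type*} [Ring A] [Algebra ℂ A] (s : Finset YoungDiagram)
    (χ : YoungDiagram → ℂ) (μ : YoungDiagram) (z : A) : A :=
  Polynomial.aeval z (∏ ρ ∈ s.erase μ,
    Polynomial.C (χ μ - χ ρ)⁻¹ * (Polynomial.X - Polynomial.C (χ ρ)))

/-- The linear map `d ↦ p * d * q`. -/
def sandwich {A : Type*} [Ring A] [Algebra ℂ A] (p q : A) : A →ₗ[ℂ] A :=
  LinearMap.mulLeft ℂ p ∘ₗ LinearMap.mulRight ℂ q

end PartAlg

open PartAlg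

namespace PartAlg

/-! Write N = n + 1. Up to an explicit multiple of the identity, each Z element acts on tensors as
the sum of all transpositions of S_N (of S_{N-1} for `Z₃₂`): `act_Z₁_eq`, `schurWeylHalf_Z₃₂_eq`,
`act_Z₂_eq`. Such a sum passes through intertwiners, so on a multiplicity space it acts by its
eigenvalue on the Specht module, which is the content sum. Only [N], [N-1,1], [N-2,2], [N-2,1,1] and
their analogues for N - 1 occur; their Specht modules are spanned by 1, by differences of variables,
by products of two such differences and by Vandermonde products of three variables, and everything
is computed on these polynomials.

The content sums are distinct, so Lagrange polynomials in the Z elements are projectors. They are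
unique because an element that vanishes on all multiplicity spaces is zero: diagrams act faithfully
on tensors (`act_injective`, `schurWeylHalf_injOn`), and tensors are spanned by the images of the
Specht modules (`eq_zero_of_irrep_one`, `eq_zero_of_irrepHalf`, `eq_zero_of_irrep_two`).

For the one-dimensional images and the matrix units, each tableau v gets an explicit vector in the
multiplicity space of its shape, a common eigenvector of Z₁, Z_{3/2} and Z₂ with the eigenvalues
that v prescribes (`tabVec_Z₁`, `tabVec_Z₃₂`). As p_v is a product of Lagrange polynomials in these
elements, and v is determined by its labels, p_v fixes the vector of v and kills the others
(`irrep_proj_tabVec`). A direct classification of the intertwiners into V_N^{⊗2} shows that the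
vectors span (`span_tabVec`). In the resulting bases P_2(N) embeds into block diagonal matrices with
blocks of sizes 2, 3, 1, 1, and p_v becomes a diagonal matrix unit. Since 4 + 9 + 1 + 1 = 15 is the
number of set partitions of four points, the embedding is onto, and all matrix units pull back
(`exists_matrixUnits`). No branching rule or general semisimplicity theorem is needed. -/

/-- The action of `P_k(N)` on `V_N^{⊗k}`, as an algebra homomorphism to the endomorphisms. -/
noncomputable def act (k N : ℕ) : PartitionAlgebra k N →ₐ[ℂ] Module.End ℂ (Tensor N k) :=
  AlgHom.ofLinearMap
    (Representation.IntertwiningMap.toLinearMapl _ _ ∘ₗ (schurWeyl k N).toLinearMap)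
    (by
      change (schurWeyl k N 1).toLinearMap = 1
      rw [map_one]; rfl)
    (fun x y => by
      change (schurWeyl k N (x * y)).toLinearMap = _
      rw [map_mul]; rfl)

lemma act_eq {k N : ℕ} (x : PartitionAlgebra k N) :
    act k N x = (schurWeyl k N x).toLinearMap := rfl

lemma schurWeyl_diag {k N : ℕ} (π : Diagram k) :
    schurWeyl k N (diag π) = diagramMap N π := linExt_diag _ _

lemma act_diag {k N : ℕ} (π : Diagram k) (f : Tensor N k) (j : Fin k → Fin N) :
    act k N (diag π) f j = ∑ i, entry π i j * f i := by
  rw [act_eq, schurWeyl_diag]; rfl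

lemma schurWeylHalf_diag {k n : ℕ} (π : Diagram (k + 1)) (f : Tensor (n + 1) k)
    (j : Fin k → Fin (n + 1)) :
    (schurWeylHalf k n (diag π)).toLinearMap f j =
      ∑ i, entry π (Fin.snoc (α := fun _ => Fin (n + 1)) i (Fin.last n))
        (Fin.snoc (α := fun _ => Fin (n + 1)) j (Fin.last n)) * f i := by
  rw [schurWeylHalf, linExt_diag]; rfl

lemma act_comm {k N : ℕ} (x : PartitionAlgebra k N) (σ : Equiv.Perm (Fin N)) (w : Tensor N k) :
    act k N x (tensorRep N k σ w) = tensorRep N k σ (act k N x w) :=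
  (schurWeyl k N x).isIntertwining _ _ σ w

lemma tensorRep_apply {k N : ℕ} (σ : Equiv.Perm (Fin N)) (w : Tensor N k) (i : Fin k → Fin N) :
    tensorRep N k σ w i = w (⇑σ⁻¹ ∘ i) := rfl

/-! ### Explicit formulas for the operators of the Z elements and of added strands. -/

lemma sum_fin_one {N : ℕ} {M : Type*} [AddCommMonoid M] (f : (Fin 1 → Fin N) → M) :
    ∑ i, f i = ∑ a, f ![a] :=
  Fintype.sum_equiv (Equiv.funUnique (Fin 1) (Fin N)) _ _ fun i => by
    congr 1; funext x; fin_cases x; rfl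

lemma sum_fin_two {N : ℕ} {M : Type*} [AddCommMonoid M] (f : (Fin 2 → Fin N) → M) :
    ∑ i, f i = ∑ a, ∑ b, f ![a, b] := by
  rw [← Fintype.sum_prod_type']
  exact Fintype.sum_equiv (finTwoArrowEquiv (Fin N)) _ _ fun i => by
    congr 1; funext x; fin_cases x <;> rfl

open Classical in
lemma entry_ofLabels {k N : ℕ} (b t : Fin k → ℕ) (i j : Fin k → Fin N) :
    entry (ofLabels b t) i j = if ∀ x y : Fin k ⊕ Fin k, Sum.elim b t x = Sum.elim b t y →
      Sum.elim i j x = Sum.elim i j y then 1 else 0 := by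
  unfold entry
  exact if_congr Iff.rfl rfl rfl

lemma snoc_one {N : ℕ} (a b : Fin N) :
    Fin.snoc (α := fun _ => Fin N) (n := 1) ![a] b = ![a, b] := by
  funext x; fin_cases x <;> rfl

/-- `P` stays arbitrary here and in the next two lemmas, so that the condition a diagram imposes on
the summation indices may be used in whatever form simplification leaves it. -/
lemma sum_sum_ite_eq {N : ℕ} {M : Type*} [AddCommMonoid M] (p q : Fin N) (P : Fin N → Fin N → Prop)
    [∀ a b, Decidable (P a b)] (hP : ∀ a b, P a b ↔ a = p ∧ b = q) (f : Fin N → Fin N → M) :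
    (∑ a, ∑ b, if P a b then f a b else 0) = f p q := by
  simp [hP, ite_and]

lemma sum_sum_ite_left {N : ℕ} {M : Type*} [AddCommMonoid M] (q : Fin N) (P : Fin N → Fin N → Prop)
    [∀ a b, Decidable (P a b)] (hP : ∀ a b, P a b ↔ b = q) (f : Fin N → Fin N → M) :
    (∑ a, ∑ b, if P a b then f a b else 0) = ∑ a, f a q := by
  simp [hP]

lemma sum_sum_ite_diag {N : ℕ} {M : Type*} [AddCommMonoid M] (P : Fin N → Fin N → Prop)
    [∀ a b, Decidable (P a b)] (hP : ∀ a b, P a b ↔ a = b) (f : Fin N → Fin N → M) :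
    (∑ a, ∑ b, if P a b then f a b else 0) = ∑ a, f a a := by
  simp [hP]

lemma act_Z₁ {N : ℕ} (w : Tensor N 1) (p : Fin N) : act 1 N (Z₁ N) w ![p] = ∑ a, w ![a] := by
  simp [Z₁, act_diag, sum_fin_one, entry_ofLabels]

/-- The second index `q` is a spectator, because 2 and 2' share a block in every diagram of `Z₃₂`.
-/
lemma act_Z₃₂ {N : ℕ} (w : Tensor N 2) (p q : Fin N) :
    act 2 N (Z₃₂ N) w ![p, q] =
      if p = q then (N : ℂ) * w ![q, q] else w ![p, q] + (∑ a, w ![a, q]) - w ![q, q] := by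
  simp only [Z₃₂, map_add, map_sub, map_smul, LinearMap.add_apply, LinearMap.sub_apply,
    LinearMap.smul_apply, Pi.add_apply, Pi.sub_apply, Pi.smul_apply, act_diag, sum_fin_two,
    entry_ofLabels]
  simp [Sum.forall, Fin.forall_fin_two]
  by_cases h : p = q
  · subst h
    simp
    rw [sum_sum_ite_eq p p _ (fun a b => by grind), sum_sum_ite_left p _ (fun a b => by grind),
      sum_sum_ite_eq p p _ (fun a b => by grind)]
    ring
  · simp [h]
    rw [sum_sum_ite_eq p q _ (fun a b => by grind), sum_sum_ite_left q _ (fun a b => by grind),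
      sum_sum_ite_eq q q _ (fun a b => by grind)]

lemma act_Z₂ {N : ℕ} (w : Tensor N 2) (p q : Fin N) :
    act 2 N (Z₂ N) w ![p, q] =
      if p = q then (N : ℂ) * w ![p, p] + ∑ a, w ![a, a]
      else w ![p, q] + (∑ b, w ![p, b]) + (∑ a, w ![a, q]) - w ![p, p] - w ![q, q] + w ![q, p] := by
  simp only [Z₂, map_add, map_sub, map_smul, LinearMap.add_apply, LinearMap.sub_apply,
    LinearMap.smul_apply, Pi.add_apply, Pi.sub_apply, Pi.smul_apply, act_diag, sum_fin_two,
    entry_ofLabels]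
  simp [Sum.forall, Fin.forall_fin_two]
  -- Diagrams joining 1' and 2' contribute only for `p = q`, where they cancel the row and column
  -- sums coming from the other diagrams.
  by_cases h : p = q
  · subst h
    simp
    rw [sum_sum_ite_eq p p _ (fun a b => by grind), sum_sum_ite_eq p p _ (fun a b => by grind),
      sum_sum_ite_eq p p _ (fun a b => by grind), sum_sum_ite_diag _ (fun a b => by grind)]
    ring
  · simp [h]
    rw [sum_sum_ite_eq p q _ (fun a b => by grind), sum_sum_ite_left q _ (fun a b => by grind),
      sum_sum_ite_eq p p _ (fun a b => by grind), sum_sum_ite_eq q q _ (fun a b => by grind),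
      sum_sum_ite_eq q p _ (fun a b => by grind)]
    simp [ite_and]

lemma schurWeylHalf_Z₃₂ {n : ℕ} (w : Tensor (n + 1) 1) (p : Fin (n + 1)) :
    (schurWeylHalf 1 n (Z₃₂ (n + 1))).toLinearMap w ![p] =
      if p = Fin.last n then ((n : ℂ) + 1) * w ![Fin.last n]
      else w ![p] + (∑ a, w ![a]) - w ![Fin.last n] := by
  simp only [Z₃₂, map_add, map_sub, map_smul, Representation.IntertwiningMap.add_toLinearMap,
    Representation.IntertwiningMap.sub_toLinearMap,
    Representation.IntertwiningMap.toLinearMap_smul, LinearMap.add_apply, LinearMap.sub_apply,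
    LinearMap.smul_apply, Pi.add_apply, Pi.sub_apply, Pi.smul_apply, schurWeylHalf_diag,
    sum_fin_one, snoc_one, entry_ofLabels]
  simp [Sum.forall, Fin.forall_fin_two]
  by_cases h : p = Fin.last n
  · subst h
    simp [ite_and]
  · simp [h, ite_and]

-- The strand forces the last upper and lower indices to agree and ties them to no other index, so
-- adding a strand amounts to tensoring with the identity of V_N.
open Classical in
lemma entry_strand {k N : ℕ} (π : Diagram k) (i j : Fin (k + 1) → Fin N) :
    entry (strand π) i j = if i (Fin.last k) = j (Fin.last k) then
      entry π (fun a => i a.castSucc) (fun a => j a.castSucc) else 0 := by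
  have key : strand π ≤ Setoid.ker (Sum.elim i j) ↔ i (Fin.last k) = j (Fin.last k) ∧
      π ≤ Setoid.ker (Sum.elim (fun a => i a.castSucc) (fun a => j a.castSucc)) := by
    constructor
    · intro h
      refine ⟨h (show strand π (.inl (Fin.last k)) (.inr (Fin.last k)) by simp [Setoid.ker_def]), ?_⟩
      intro x y hxy
      have hq : Quotient.mk π x = Quotient.mk π y := Quotient.sound hxy
      have h2 : strand π (x.map Fin.castSucc Fin.castSucc) (y.map Fin.castSucc Fin.castSucc) := by
        rcases x with x | x <;> rcases y with y | y <;> simpa [Setoid.ker_def] using hq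
      have h3 := h h2
      rcases x with x | x <;> rcases y with y | y <;> exact h3
    · rintro ⟨h0, h⟩
      have hx : ∀ x : Fin (k + 1) ⊕ Fin (k + 1),
          (x = .inl (Fin.last k) ∨ x = .inr (Fin.last k)) ∨
            ∃ y : Fin k ⊕ Fin k, x = y.map Fin.castSucc Fin.castSucc := by
        rintro (x | x) <;> induction x using Fin.lastCases with
        | last => simp
        | cast a => first | exact .inr ⟨.inl a, rfl⟩ | exact .inr ⟨.inr a, rfl⟩
      intro x y hxy
      rcases hx x with (rfl | rfl) | ⟨x', rfl⟩ <;> rcases hx y with (rfl | rfl) | ⟨y', rfl⟩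
      · rfl
      · exact h0
      -- The strand carries the label `none`, which no vertex of `π` has, so the mixed cases cannot
      -- occur.
      · exfalso; rcases y' with y' | y' <;> simp [Setoid.ker_def] at hxy
      · exact h0.symm
      · rfl
      · exfalso; rcases y' with y' | y' <;> simp [Setoid.ker_def] at hxy
      · exfalso; rcases x' with x' | x' <;> simp [Setoid.ker_def] at hxy
      · exfalso; rcases x' with x' | x' <;> simp [Setoid.ker_def] at hxy
      · have h2 : π x' y' := by
          apply Quotient.exact (s := π)
          rcases x' with x' | x' <;> rcases y' with y' | y' <;> simpa [Setoid.ker_def] using hxy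
        have h3 := h h2
        rcases x' with x' | x' <;> rcases y' with y' | y' <;> exact h3
  simp only [entry, key, ite_and]

lemma cast_choose_two' (m : ℕ) : ((m.choose 2 : ℕ) : ℂ) = ((m : ℂ) ^ 2 - m) / 2 := by
  rw [Nat.cast_choose_two]; ring

/-! ### Sums over all transpositions of functions of one or two moved points. -/

section SwapSums

variable {m : ℕ} {M : Type*} [AddCommGroup M] [Module ℂ M]

/-- Sums over all ordered pairs are easier to evaluate: each transposition is counted twice, and the
diagonal, where `swap i i` is the identity, is removed. -/
lemma sum_lt_of_symm (F : Fin m → Fin m → M) (hF : ∀ i j, F i j = F j i) :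
    ∑ p : Fin m × Fin m with p.1 < p.2, F p.1 p.2 =
      (2⁻¹ : ℂ) • (∑ i, ∑ j, F i j - ∑ i, F i i) := by
  have h1 : ∑ p : Fin m × Fin m with p.1 < p.2, F p.1 p.2 =
      ∑ p : Fin m × Fin m with p.2 < p.1, F p.1 p.2 := by
    refine Finset.sum_bij' (fun p _ => p.swap) (fun p _ => p.swap) ?_ ?_ ?_ ?_ ?_ <;>
      simp +contextual [hF]
  have h2 : ∑ i, F i i = ∑ p : Fin m × Fin m with p.1 = p.2, F p.1 p.2 := by
    rw [Finset.sum_filter, Fintype.sum_prod_type]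
    simp
  have h3 : ∑ i, ∑ j, F i j = ∑ p : Fin m × Fin m with p.1 < p.2, F p.1 p.2 +
      ∑ p : Fin m × Fin m with p.2 < p.1, F p.1 p.2 +
      ∑ p : Fin m × Fin m with p.1 = p.2, F p.1 p.2 := by
    rw [Finset.sum_filter, Finset.sum_filter, Finset.sum_filter, ← Finset.sum_add_distrib,
      ← Finset.sum_add_distrib, Fintype.sum_prod_type]
    refine Finset.sum_congr rfl fun i _ => Finset.sum_congr rfl fun j _ => ?_
    rcases lt_trichotomy i j with h | rfl | h
    · simp [h, h.not_gt, h.ne]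
    · simp
    · simp [h, h.not_gt, h.ne']
  rw [h3, h2, ← h1]
  module

/-- Exactly m - 1 transpositions move `a`, once to each other point; completing their contribution
to the full sum of `g` costs one more `g a`. -/
lemma sum_swap_one (g : Fin m → M) (a : Fin m) :
    ∑ p : Fin m × Fin m with p.1 < p.2, g (Equiv.swap p.1 p.2 a) =
      ∑ b, g b + ((m.choose 2 : ℂ) - m) • g a := by
  rw [sum_lt_of_symm (fun i j => g (Equiv.swap i j a)) fun i j => by rw [Equiv.swap_comm]]
  have h : ∀ i j, g (Equiv.swap i j a) =
      g a + (if i = a then g j - g a else 0) + (if j = a then g i - g a else 0) := by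
    intro i j
    rw [Equiv.swap_apply_def]
    by_cases hi : i = a <;> by_cases hj : j = a <;> simp_all [eq_comm]
  simp only [h, Finset.sum_add_distrib, Finset.sum_ite_eq', Finset.sum_ite_irrel,
    Finset.sum_sub_distrib, Finset.sum_const, Finset.card_univ, Fintype.card_fin, Finset.mem_univ,
    if_true, sub_self, smul_zero, cast_choose_two', ← Nat.cast_smul_eq_nsmul ℂ]
  module

/-- The transpositions split into those moving only `a`, those moving only `b`, the single one
exchanging them, and those fixing both. Completing the first two families to full sums accounts for
the subtracted diagonal terms and for the coefficient of `h a b`. -/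
lemma sum_swap_two (h : Fin m → Fin m → M) {a b : Fin m} (hab : a ≠ b) :
    ∑ p : Fin m × Fin m with p.1 < p.2, h (Equiv.swap p.1 p.2 a) (Equiv.swap p.1 p.2 b) =
      ∑ c, h a c + ∑ c, h c b - h a a - h b b + h b a
        + ((m.choose 2 : ℂ) - 2 * m + 1) • h a b := by
  rw [sum_lt_of_symm (fun i j => h (Equiv.swap i j a) (Equiv.swap i j b))
    fun i j => by rw [Equiv.swap_comm]]
  have e : ∀ i j, h (Equiv.swap i j a) (Equiv.swap i j b) =
      h a b + (if i = a then h j b - h a b else 0) + (if j = a then h i b - h a b else 0)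
       + (if i = b then h a j - h a b else 0) + (if j = b then h a i - h a b else 0)
       -- The last two terms correct the transposition (a b), which the preceding ones count as
       -- moving `a` and `b` separately.
       + (if i = a then if j = b then h b a - h b b - h a a + h a b else 0 else 0)
       + (if i = b then if j = a then h b a - h b b - h a a + h a b else 0 else 0) := by
    intro i j
    rw [Equiv.swap_apply_def, Equiv.swap_apply_def]
    have hba := hab.symm
    by_cases hi : i = a
    · subst hi
      by_cases hj : j = b
      · subst hj; simp [hab, hba]; abel
      · by_cases hj' : j = i
        · subst hj'; simp [hab, hba]
        · simp [hab, hba, Ne.symm hj, hj', hj]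
    · by_cases hi' : i = b
      · subst hi'
        by_cases hj : j = a
        · subst hj; simp [hab, hba]; abel
        · by_cases hj' : j = i
          · subst hj'; simp [hab, hba]
          · simp [hab, hba, Ne.symm hj, hj', hj]
      · by_cases hj : j = a
        · subst hj; simp [hab, hba, hi, hi', Ne.symm hi, Ne.symm hi']
        · by_cases hj' : j = b
          · subst hj'; simp [hab, hba, hi, hi', Ne.symm hi, Ne.symm hi']
          · simp [hi, hi', hj, hj', Ne.symm hi, Ne.symm hi', Ne.symm hj, Ne.symm hj']
  simp only [e, Finset.sum_add_distrib, Finset.sum_ite_eq', Finset.sum_ite_irrel,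
    Finset.sum_sub_distrib, Finset.sum_const, Finset.card_univ, Fintype.card_fin, Finset.mem_univ,
    if_true, sub_self, smul_zero, cast_choose_two', ← Nat.cast_smul_eq_nsmul ℂ,
    hab, hab.symm, if_false]
  module

end SwapSums

/-! ### Comparison of the Z elements with sums of transpositions. -/

lemma tensor_ext_one {N : ℕ} {u w : Tensor N 1} (h : ∀ p, u ![p] = w ![p]) : u = w := by
  funext i
  have : i = ![i 0] := by funext x; fin_cases x; rfl
  rw [this, h]

lemma tensor_ext_two {N : ℕ} {u w : Tensor N 2} (h : ∀ p q, u ![p, q] = w ![p, q]) : u = w := by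
  funext i
  have : i = ![i 0, i 1] := by funext x; fin_cases x <;> rfl
  rw [this, h]

lemma tensorRep_one {N : ℕ} (σ : Equiv.Perm (Fin N)) (w : Tensor N 1) (p : Fin N) :
    tensorRep N 1 σ w ![p] = w ![σ⁻¹ p] := by
  rw [tensorRep_apply]
  congr 1; funext x; fin_cases x; rfl

lemma tensorRep_two {N : ℕ} (σ : Equiv.Perm (Fin N)) (w : Tensor N 2) (p q : Fin N) :
    tensorRep N 2 σ w ![p, q] = w ![σ⁻¹ p, σ⁻¹ q] := by
  rw [tensorRep_apply]
  congr 1; funext x; fin_cases x <;> rfl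

lemma tensorRepHalf_one {n : ℕ} (σ : Equiv.Perm (Fin n)) (w : Tensor (n + 1) 1) (p : Fin (n + 1)) :
    tensorRepHalf n 1 σ w ![p] = w ![permIncl n σ⁻¹ p] := by
  rw [map_inv]
  exact tensorRep_one (permIncl n σ) w p

lemma transpositionSum_apply {n : ℕ} {V : Type*} [AddCommGroup V] [Module ℂ V]
    (ρ : Representation ℂ (Equiv.Perm (Fin n)) V) (v : V) :
    transpositionSum ρ v = ∑ p : Fin n × Fin n with p.1 < p.2, ρ (Equiv.swap p.1 p.2) v := by
  simp [transpositionSum]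

lemma act_Z₁_eq (N : ℕ) : act 1 N (Z₁ N) =
    transpositionSum (tensorRep N 1) - ((N.choose 2 : ℂ) - N) • 1 := by
  refine LinearMap.ext fun w => tensor_ext_one fun p => ?_
  simp only [act_Z₁, LinearMap.sub_apply, transpositionSum_apply, Pi.sub_apply, Finset.sum_apply,
    tensorRep_one, Equiv.swap_inv, LinearMap.smul_apply, Module.End.one_apply, Pi.smul_apply]
  rw [sum_swap_one (fun p => w ![p]) p]
  module

lemma act_Z₂_eq (N : ℕ) : act 2 N (Z₂ N) =
    transpositionSum (tensorRep N 2) - ((N.choose 2 : ℂ) - 2 * N) • 1 := by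
  refine LinearMap.ext fun w => tensor_ext_two fun p q => ?_
  simp only [act_Z₂, LinearMap.sub_apply, transpositionSum_apply, Pi.sub_apply, Finset.sum_apply,
    tensorRep_two, Equiv.swap_inv, LinearMap.smul_apply, Module.End.one_apply, Pi.smul_apply]
  split_ifs with h
  · subst h
    rw [sum_swap_one (fun p => w ![p, p]) p]
    simp only [smul_eq_mul]; ring
  · rw [sum_swap_two (fun p q => w ![p, q]) h]
    simp only [smul_eq_mul]; ring

lemma permIncl_swap {n : ℕ} (i j p : Fin n) :
    permIncl n (Equiv.swap i j) p.castSucc = (Equiv.swap i j p).castSucc := permIncl_castSucc _ _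

lemma schurWeylHalf_Z₃₂_eq (n : ℕ) : (schurWeylHalf 1 n (Z₃₂ (n + 1))).toLinearMap =
    transpositionSum (tensorRepHalf n 1) - (((n + 1).choose 2 : ℂ) - 2 * (n + 1) + 1) • 1 := by
  refine LinearMap.ext fun w => tensor_ext_one fun p => ?_
  simp only [schurWeylHalf_Z₃₂, LinearMap.sub_apply, transpositionSum_apply, Pi.sub_apply,
    Finset.sum_apply, tensorRepHalf_one, Equiv.swap_inv, LinearMap.smul_apply,
    Module.End.one_apply, Pi.smul_apply]
  induction p using Fin.lastCases with
  | last =>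
    -- The stabilizer fixes the last point, so the entry there is only multiplied by the number of
    -- transpositions; `(n+1).choose 2 = n.choose 2 + n` then leaves the factor n + 1.
    have h2 : (∑ p : Fin n × Fin n with p.1 < p.2, (1 : ℂ)) = n.choose 2 := by
      rw [sum_lt_of_symm (fun _ _ => (1 : ℂ)) fun _ _ => rfl, cast_choose_two']
      simp; ring
    simp only [permIncl_last, if_true]
    rw [← one_mul (w ![Fin.last n]), ← Finset.sum_mul, h2, cast_choose_two', cast_choose_two']
    push_cast
    simp only [smul_eq_mul]; ring
  | cast p =>
    simp only [permIncl_swap, (Fin.castSucc_lt_last p).ne, if_false]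
    rw [sum_swap_one (fun p => w ![p.castSucc]) p, Fin.sum_univ_castSucc, cast_choose_two',
      cast_choose_two']
    push_cast
    simp only [smul_eq_mul]; ring

lemma Z₃₂_mem (N : ℕ) : Z₃₂ N ∈ halfAlgebra 1 N := by
  have h : ∀ b t : Fin 2 → ℕ, b 1 = t 1 →
      (diag (ofLabels b t) : PartitionAlgebra 2 N) ∈ halfAlgebra 1 N :=
    fun b t hbt => Submodule.subset_span ⟨_, hbt, rfl⟩
  unfold Z₃₂
  refine add_mem (sub_mem (sub_mem (add_mem ?_ ?_) ?_) ?_) (Subalgebra.smul_mem _ ?_ _) <;>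
    exact h _ _ rfl

/-! ### Faithfulness of the actions -/

lemma exists_ker_eq {α : Type*} [Finite α] {N : ℕ} (hN : Nat.card α ≤ N) (σ : Setoid α) :
    ∃ g : α → Fin N, Setoid.ker g = σ := by
  have := Fintype.ofFinite α
  have h1 : Nat.card (Quotient σ) ≤ N :=
    (Nat.card_le_card_of_surjective _ Quotient.mk_surjective).trans hN
  let e : Quotient σ ↪ Fin N := (Finite.equivFin (Quotient σ)).toEmbedding.trans (Fin.castLEEmb h1)
  refine ⟨fun x => e (Quotient.mk σ x), ?_⟩
  ext x y
  rw [Setoid.ker_def, EmbeddingLike.apply_eq_iff_eq]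
  exact Quotient.eq

instance (k : ℕ) : Finite (Diagram k) :=
  Finite.of_injective (fun π : Diagram k => fun x : (Fin k ⊕ Fin k) × (Fin k ⊕ Fin k) => π x.1 x.2)
    fun π ρ h => by
      ext x y
      exact iff_of_eq (congrFun h (x, y))

/-- The coefficient of a diagram. -/
def diagCoeff {k N : ℕ} (x : PartitionAlgebra k N) (π : Diagram k) : ℂ := (show Diagram k →₀ ℂ from x) π

noncomputable instance (k : ℕ) : Fintype (Diagram k) := Fintype.ofFinite _

lemma eq_sum_diagCoeff {k N : ℕ} (x : PartitionAlgebra k N) : x = ∑ π, diagCoeff x π • diag π := by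
  have h : ∀ y : Diagram k →₀ ℂ, y = ∑ π, y π • Finsupp.single π 1 := by
    intro y
    classical
    ext π
    simp
  exact h x

open Classical in
lemma act_single {k N : ℕ} (x : PartitionAlgebra k N) (i j : Fin k → Fin N) :
    act k N x (Pi.single i 1) j = ∑ π, diagCoeff x π * entry π i j := by
  conv_lhs => rw [eq_sum_diagCoeff x]
  simp [map_sum, LinearMap.sum_apply, Finset.sum_apply, act_diag, Pi.single_apply]

/-- With at least 2k values available, every set partition `σ` of the vertices is the kernel of some
labelling. The matrix entry at that labelling is the sum of the coefficients of all diagrams finer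
than or equal to `σ`, so induction on refinement isolates the coefficient of `σ`. For k = 2 this is
where N ≥ 4 enters. -/
lemma act_injective {k N : ℕ} (hN : 2 * k ≤ N) : Function.Injective (act k N) := by
  classical
  rw [injective_iff_map_eq_zero]
  intro x hx
  have h0 : ∀ π, diagCoeff x π = 0 := by
    intro σ
    induction σ using WellFoundedLT.induction with
    | ind σ ih =>
      obtain ⟨g, hg⟩ := exists_ker_eq (α := Fin k ⊕ Fin k) (N := N) (by simpa [two_mul] using hN) σ
      have h1 := act_single x (fun a => g (.inl a)) (fun a => g (.inr a))
      have h2 : Sum.elim (fun a => g (.inl a)) (fun a => g (.inr a)) = g := by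
        funext a; rcases a with a | a <;> rfl
      rw [hx, Finset.sum_eq_single σ] at h1
      · simpa [entry, h2, hg] using h1.symm
      · intro π _ hπ
        by_cases hle : π ≤ σ
        · rw [ih π (lt_of_le_of_ne hle hπ), zero_mul]
        · simp [entry, h2, hg, hle]
      · simp
  rw [eq_sum_diagCoeff x]
  simp [h0]

/-- The part `w ↦ w(·, n+1)` of a tensor. -/
def lastSlice (n : ℕ) : Tensor (n + 1) 2 →ₗ[ℂ] Tensor (n + 1) 1 :=
  LinearMap.funLeft ℂ ℂ fun i => ![i 0, Fin.last n]

lemma lastSlice_apply {n : ℕ} (w : Tensor (n + 1) 2) (p : Fin (n + 1)) :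
    lastSlice n w ![p] = w ![p, Fin.last n] := rfl

lemma lastSlice_surjective (n : ℕ) : Function.Surjective (lastSlice n) := by
  refine LinearMap.funLeft_surjective_of_injective ℂ ℂ _ fun i j h => ?_
  funext a
  fin_cases a
  exact congrFun h 0

/-- When 2 and 2' share a block, an upper second index equal to the last point forces the lower one
to be the same. The half-integer action is therefore the ordinary action restricted to the last
slice, and its properties can be read off from those of `act`. -/
lemma schurWeylHalf_lastSlice {n : ℕ} {x : PartitionAlgebra 2 (n + 1)}
    (hx : x ∈ halfAlgebra 1 (n + 1)) (w : Tensor (n + 1) 2) :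
    (schurWeylHalf 1 n x).toLinearMap (lastSlice n w) = lastSlice n (act 2 (n + 1) x w) := by
  refine Submodule.span_induction (p := fun x _ =>
    (schurWeylHalf 1 n x).toLinearMap (lastSlice n w) = lastSlice n (act 2 (n + 1) x w))
    ?_ ?_ ?_ ?_ hx
  · rintro _ ⟨π, hπ, rfl⟩
    refine tensor_ext_one fun p => ?_
    rw [schurWeylHalf_diag, lastSlice_apply, act_diag, sum_fin_one, sum_fin_two]
    refine Finset.sum_congr rfl fun a _ => ?_
    rw [Finset.sum_eq_single (Fin.last n)]
    · rw [snoc_one, snoc_one, lastSlice_apply]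
    · intro b _ hb
      rw [entry, if_neg, zero_mul]
      intro hle
      exact hb (hle hπ)
    · simp
  · simp
  · intro x y _ _ h1 h2
    simp [map_add, h1, h2]
  · intro c x _ h
    simp [map_smul, h]

/-- Multiplicativity descends from `act` along the surjection `lastSlice`. -/
lemma schurWeylHalf_mul {n : ℕ} {x y : PartitionAlgebra 2 (n + 1)}
    (hx : x ∈ halfAlgebra 1 (n + 1)) (hy : y ∈ halfAlgebra 1 (n + 1)) :
    (schurWeylHalf 1 n (x * y)).toLinearMap =
      (schurWeylHalf 1 n x).toLinearMap ∘ₗ (schurWeylHalf 1 n y).toLinearMap := by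
  refine LinearMap.ext fun u => ?_
  obtain ⟨w, rfl⟩ := lastSlice_surjective n u
  rw [LinearMap.comp_apply, schurWeylHalf_lastSlice (mul_mem hx hy), schurWeylHalf_lastSlice hy,
    schurWeylHalf_lastSlice hx, map_mul]
  rfl

lemma schurWeylHalf_one (n : ℕ) : (schurWeylHalf 1 n 1).toLinearMap = LinearMap.id := by
  refine LinearMap.ext fun u => ?_
  obtain ⟨w, rfl⟩ := lastSlice_surjective n u
  rw [schurWeylHalf_lastSlice (one_mem _), map_one]
  rfl

/-- `act x` commutes with S_N, so a transposition brings any second index to the last point.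
Vanishing on the last slice thus gives vanishing of the whole operator on V_N^{⊗2}, and
`act_injective` applies. -/
lemma schurWeylHalf_injOn {n : ℕ} (hn : 3 ≤ n) {x : PartitionAlgebra 2 (n + 1)}
    (hx : x ∈ halfAlgebra 1 (n + 1)) (h : (schurWeylHalf 1 n x).toLinearMap = 0) : x = 0 := by
  apply act_injective (k := 2) (N := n + 1) (by omega)
  rw [map_zero]
  refine LinearMap.ext fun w => tensor_ext_two fun p q => ?_
  have h1 := schurWeylHalf_lastSlice hx (tensorRep (n + 1) 2 (Equiv.swap q (Fin.last n)) w)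
  rw [h, act_comm] at h1
  have h2 := congrFun h1 ![Equiv.swap q (Fin.last n) p]
  rw [lastSlice_apply, tensorRep_two] at h2
  simpa using h2.symm

/-! ### Adding a strand -/

lemma act_addStrand {k N : ℕ} (x : PartitionAlgebra k N) (w : Tensor N (k + 1))
    (j : Fin k → Fin N) (q : Fin N) :
    act (k + 1) N (addStrand k N x) w (Fin.snoc (α := fun _ => Fin N) j q) =
      act k N x (fun i => w (Fin.snoc (α := fun _ => Fin N) i q)) j := by
  induction x using induct with
  | zero => simp
  | add x y hx hy => simp only [map_add, LinearMap.add_apply, Pi.add_apply, hx, hy]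
  | smul_diag c π =>
    simp only [map_smul, LinearMap.smul_apply, Pi.smul_apply, addStrand, linExt_diag, act_diag]
    congr 1
    rw [← (Fin.snocEquiv fun _ : Fin (k + 1) => Fin N).sum_comp, Fintype.sum_prod_type,
      Finset.sum_eq_single q]
    · refine Finset.sum_congr rfl fun i _ => ?_
      simp [Fin.snocEquiv, entry_strand]
    · intro b _ hb
      refine Finset.sum_eq_zero fun i _ => ?_
      simp [Fin.snocEquiv, entry_strand, hb]
    · simp

lemma act_addStrand_one {N : ℕ} (x : PartitionAlgebra 1 N) (w : Tensor N 2) (p q : Fin N) :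
    act 2 N (addStrand 1 N x) w ![p, q] = act 1 N x (fun i => w ![i 0, q]) ![p] := by
  have h : ∀ i : Fin 1 → Fin N, Fin.snoc (α := fun _ => Fin N) i q = ![i 0, q] := by
    intro i; funext a; fin_cases a <;> rfl
  have h1 := act_addStrand x w ![p] q
  simp only [h] at h1
  exact h1

/-- Adding a strand to the diagrams of `P_1(N)`, as an algebra homomorphism. -/
noncomputable def addStrandHom {N : ℕ} (hN : 4 ≤ N) : PartitionAlgebra 1 N →ₐ[ℂ] PartitionAlgebra 2 N :=
  AlgHom.ofLinearMap (addStrand 1 N)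
    -- Unit and product are compared as operators, where adding a strand acts slice by slice; the
    -- bound on `N` serves the faithfulness of `act`.
    (act_injective (by omega) (LinearMap.ext fun w => tensor_ext_two fun p q => by
      rw [act_addStrand_one, map_one, map_one]; rfl))
    (fun x y => act_injective (by omega) (LinearMap.ext fun w => tensor_ext_two fun p q => by
      rw [act_addStrand_one, map_mul, map_mul, Module.End.mul_apply, Module.End.mul_apply,
        act_addStrand_one]
      have h : act 1 N y (fun i => w ![i 0, q]) =
          fun i => act 2 N (addStrand 1 N y) w ![i 0, q] :=
        tensor_ext_one fun a => (act_addStrand_one y w a q).symm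
      rw [h]))

lemma act_addStrand_Z₁ {N : ℕ} (w : Tensor N 2) (p q : Fin N) :
    act 2 N (addStrand 1 N (Z₁ N)) w ![p, q] = ∑ a, w ![a, q] := by
  rw [act_addStrand_one, act_Z₁]
  rfl

/-! ### Young diagrams with at most three rows -/

/-- The Young diagram with row lengths `p`, `q`, `r`. -/
def threeRows (p q r : ℕ) (hqp : q ≤ p) (hrq : r ≤ q) : YoungDiagram where
  cells := (Finset.range p).image (Prod.mk 0) ∪ (Finset.range q).image (Prod.mk 1) ∪
    (Finset.range r).image (Prod.mk 2)
  isLowerSet := by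
    rintro ⟨i, j⟩ ⟨i', j'⟩ ⟨h1, h2⟩ h
    simp only [Finset.coe_union, Finset.coe_image, Set.mem_union, Set.mem_image, Finset.mem_coe,
      Finset.mem_range, Prod.mk.injEq] at h ⊢
    simp only at h1 h2
    have hi : i' = 0 ∨ i' = 1 ∨ i' = 2 := by omega
    rcases hi with rfl | rfl | rfl <;> simp <;> omega

section threeRows

variable {p q r : ℕ} {hqp : q ≤ p} {hrq : r ≤ q}

lemma mem_threeRows {i j : ℕ} : (i, j) ∈ threeRows p q r hqp hrq ↔
    (i = 0 ∧ j < p) ∨ (i = 1 ∧ j < q) ∨ (i = 2 ∧ j < r) := by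
  rw [← YoungDiagram.mem_cells]
  simp only [threeRows, Finset.mem_union, Finset.mem_image, Finset.mem_range, Prod.mk.injEq]
  constructor
  · rintro ((⟨a, h1, rfl, rfl⟩ | ⟨a, h1, rfl, rfl⟩) | ⟨a, h1, rfl, rfl⟩) <;> simp [h1]
  · rintro (⟨rfl, h⟩ | ⟨rfl, h⟩ | ⟨rfl, h⟩) <;> simp [h]

lemma sum_threeRows {M : Type*} [AddCommMonoid M] (f : ℕ × ℕ → M) :
    ∑ c ∈ (threeRows p q r hqp hrq).cells, f c =
      ∑ j ∈ Finset.range p, f (0, j) + ∑ j ∈ Finset.range q, f (1, j)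
        + ∑ j ∈ Finset.range r, f (2, j) := by
  have inj : ∀ (a : ℕ) (s : Set ℕ), Set.InjOn (Prod.mk a : ℕ → ℕ × ℕ) s :=
    fun a s x _ y _ h => (Prod.mk.inj h).2
  simp only [threeRows]
  rw [Finset.sum_union, Finset.sum_union, Finset.sum_image (inj _ _), Finset.sum_image (inj _ _),
    Finset.sum_image (inj _ _)]
  all_goals
    rw [Finset.disjoint_left]
    rintro ⟨a, b⟩ h1 h2
    simp at h1 h2
    omega

lemma card_threeRows : (threeRows p q r hqp hrq).card = p + q + r := by
  rw [YoungDiagram.card, Finset.card_eq_sum_ones, sum_threeRows]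
  simp

lemma rowLen_threeRows (i : ℕ) : (threeRows p q r hqp hrq).rowLen i =
    if i = 0 then p else if i = 1 then q else if i = 2 then r else 0 := by
  have h : ∀ j, j < (threeRows p q r hqp hrq).rowLen i ↔
      j < if i = 0 then p else if i = 1 then q else if i = 2 then r else 0 := by
    intro j
    rw [← YoungDiagram.mem_iff_lt_rowLen, mem_threeRows]
    split_ifs <;> omega
  exact le_antisymm (le_of_not_gt fun hlt => lt_irrefl _ ((h _).1 hlt))
    (le_of_not_gt fun hlt => lt_irrefl _ ((h _).2 hlt))

lemma threeRows_le_iff {p' q' r' : ℕ} {hqp' : q' ≤ p'} {hrq' : r' ≤ q'} :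
    threeRows p q r hqp hrq ≤ threeRows p' q' r' hqp' hrq' ↔ p ≤ p' ∧ q ≤ q' ∧ r ≤ r' := by
  constructor
  · intro h
    have h1 : ∀ i j, (i, j) ∈ threeRows p q r hqp hrq → (i, j) ∈ threeRows p' q' r' hqp' hrq' :=
      fun i j hij => h hij
    simp only [mem_threeRows] at h1
    refine ⟨le_of_not_gt fun hlt => ?_, le_of_not_gt fun hlt => ?_, le_of_not_gt fun hlt => ?_⟩
    · have := h1 0 p' (by omega); omega
    · have := h1 1 q' (by omega); omega
    · have := h1 2 r' (by omega); omega
  · rintro ⟨h1, h2, h3⟩ ⟨i, j⟩ hij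
    change (i, j) ∈ threeRows p q r hqp hrq at hij
    rw [mem_threeRows] at hij ⊢
    omega

lemma threeRows_inj {p' q' r' : ℕ} {hqp' : q' ≤ p'} {hrq' : r' ≤ q'} :
    threeRows p q r hqp hrq = threeRows p' q' r' hqp' hrq' ↔ p = p' ∧ q = q' ∧ r = r' := by
  rw [le_antisymm_iff, threeRows_le_iff, threeRows_le_iff]
  omega

lemma sum_range_cast (p : ℕ) : ∑ j ∈ Finset.range p, (j : ℂ) = ((p : ℂ) ^ 2 - p) / 2 := by
  induction p with
  | zero => simp
  | succ p ih => rw [Finset.sum_range_succ, ih]; push_cast; ring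

lemma contentSum_threeRows : (contentSum (threeRows p q r hqp hrq) : ℂ) =
    ((p : ℂ) ^ 2 - p) / 2 + (((q : ℂ) ^ 2 - q) / 2 - q) + (((r : ℂ) ^ 2 - r) / 2 - 2 * r) := by
  rw [contentSum, sum_threeRows]
  push_cast
  simp only [Finset.sum_sub_distrib, sum_range_cast]
  simp
  ring

end threeRows

lemma exists_eq_threeRows {μ : YoungDiagram} (h : μ.card - μ.rowLen 0 ≤ 2) :
    ∃ (p q r : ℕ) (hqp : q ≤ p) (hrq : r ≤ q), μ = threeRows p q r hqp hrq := by
  have h3 : μ.rowLen 3 = 0 := by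
    by_contra hne
    have hm : ((3, 0) : ℕ × ℕ) ∈ μ := YoungDiagram.mem_iff_lt_rowLen.2 (Nat.pos_of_ne_zero hne)
    -- A fourth row would force three boxes (1,0), (2,0), (3,0) below the first row.
    have hsub : insert (1, 0) (insert (2, 0) (insert (3, 0) (μ.row 0))) ⊆ μ.cells := by
      simp only [Finset.insert_subset_iff, YoungDiagram.mem_cells]
      exact ⟨μ.up_left_mem (by norm_num) le_rfl hm, μ.up_left_mem (by norm_num) le_rfl hm, hm,
        Finset.filter_subset _ _⟩
    have hcard := Finset.card_le_card hsub
    rw [Finset.card_insert_of_notMem (by simp [YoungDiagram.mem_row_iff]),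
      Finset.card_insert_of_notMem (by simp [YoungDiagram.mem_row_iff]),
      Finset.card_insert_of_notMem (by simp [YoungDiagram.mem_row_iff]),
      ← YoungDiagram.rowLen_eq_card] at hcard
    have : μ.card = μ.cells.card := rfl
    omega
  refine ⟨μ.rowLen 0, μ.rowLen 1, μ.rowLen 2, μ.rowLen_anti _ _ (by norm_num),
    μ.rowLen_anti _ _ (by norm_num), ?_⟩
  apply SetLike.ext
  rintro ⟨i, j⟩
  rw [mem_threeRows, YoungDiagram.mem_iff_lt_rowLen]
  have h4 : 3 ≤ i → μ.rowLen i = 0 := fun hi => by have := μ.rowLen_anti 3 i hi; omega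
  rcases i with _ | _ | _ | i <;> simp
  rw [h4 (by omega)]; simp

/-- The partition `[m]`. -/
abbrev rowShape (m : ℕ) : YoungDiagram := threeRows m 0 0 (Nat.zero_le _) le_rfl

/-- The partition `[m + 1, 1]`. -/
abbrev hookShape (m : ℕ) : YoungDiagram := threeRows (m + 1) 1 0 (Nat.le_add_left _ _) zero_le_one

/-- The partition `[m + 2, 2]`. -/
abbrev twoTwoShape (m : ℕ) : YoungDiagram :=
  threeRows (m + 2) 2 0 (Nat.le_add_left _ _) (Nat.zero_le _)

/-- The partition `[m + 1, 1, 1]`. -/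
abbrev longHookShape (m : ℕ) : YoungDiagram := threeRows (m + 1) 1 1 (Nat.le_add_left _ _) le_rfl

lemma mem_labels_threeRows {m k p q r : ℕ} {hqp : q ≤ p} {hrq : r ≤ q} :
    threeRows p q r hqp hrq ∈ labels m k ↔ p + q + r = m ∧ q + r ≤ k := by
  rw [mem_labels, card_threeRows, rowLen_threeRows, if_pos rfl]
  omega

lemma mem_labels_zero {m : ℕ} {μ : YoungDiagram} : μ ∈ labels m 0 ↔ μ = rowShape m := by
  constructor
  · intro h
    obtain ⟨p, q, r, hqp, hrq, rfl⟩ := exists_eq_threeRows (μ := μ) (by have := (mem_labels.1 h).2; omega)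
    rw [mem_labels_threeRows] at h
    rw [threeRows_inj]; omega
  · rintro rfl
    rw [mem_labels_threeRows]; omega

lemma mem_labels_one {m : ℕ} {μ : YoungDiagram} :
    μ ∈ labels (m + 2) 1 ↔ μ = rowShape (m + 2) ∨ μ = hookShape m := by
  constructor
  · intro h
    obtain ⟨p, q, r, hqp, hrq, rfl⟩ := exists_eq_threeRows (μ := μ) (by have := (mem_labels.1 h).2; omega)
    rw [mem_labels_threeRows] at h
    rw [threeRows_inj, threeRows_inj]; omega
  · rintro (rfl | rfl) <;> rw [mem_labels_threeRows] <;> omega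

lemma mem_labels_two {m : ℕ} {μ : YoungDiagram} :
    μ ∈ labels (m + 4) 2 ↔ μ = rowShape (m + 4) ∨ μ = hookShape (m + 2) ∨ μ = twoTwoShape m ∨
      μ = longHookShape (m + 1) := by
  constructor
  · intro h
    obtain ⟨p, q, r, hqp, hrq, rfl⟩ := exists_eq_threeRows (μ := μ) (by have := (mem_labels.1 h).2; omega)
    rw [mem_labels_threeRows] at h
    simp only [threeRows_inj]; omega
  · rintro (rfl | rfl | rfl | rfl) <;> rw [mem_labels_threeRows] <;> omega

/-! ### Specht modules -/

/-- A Specht polynomial depends only on the entries in columns with several boxes. Since those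
entries can be prescribed freely, the spanning sets below are indexed by tuples of distinct
variables rather than by fillings. -/
lemma exists_filling {μ : YoungDiagram} {n : ℕ} (hμ : μ.card = n) {ι : Type*} [Finite ι]
    (c : ι → μ.cells) (hc : Function.Injective c) (a : ι → Fin n) (ha : Function.Injective a) :
    ∃ T : μ.cells ≃ Fin n, ∀ i, T (c i) = a i := by
  let T₀ : μ.cells ≃ Fin n := Fintype.equivFinOfCardEq (by simpa using hμ)
  obtain ⟨σ, hσ⟩ := Equiv.Perm.exists_extending_pair (fun i => T₀ (c i)) a
    (T₀.injective.comp hc) ha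
  exact ⟨T₀.trans σ, hσ⟩

open MvPolynomial in
lemma specht_rowShape (m : ℕ) : specht m (rowShape m) = Submodule.span ℂ {1} := by
  have h : ∀ T : (rowShape m).cells ≃ Fin m, spechtPoly (rowShape m) T = 1 := by
    intro T
    rw [spechtPoly, Finset.filter_eq_empty_iff.2, Finset.prod_empty]
    rintro ⟨⟨⟨i, j⟩, hc⟩, ⟨⟨i', j'⟩, hc'⟩⟩ -
    rw [YoungDiagram.mem_cells, mem_threeRows] at hc hc'
    simp only
    omega
  rw [specht]
  congr 1
  ext f
  simp only [Set.mem_range, h, Set.mem_singleton_iff]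
  constructor
  · rintro ⟨_, rfl⟩; rfl
  · rintro rfl
    -- Nothing is prescribed here: only the existence of some filling is needed, so that the
    -- spanning set is nonempty.
    obtain ⟨T, -⟩ := exists_filling (μ := rowShape m) (n := m) (by simp [card_threeRows])
      (Fin.elim0 : Fin 0 → _) (fun i => i.elim0) Fin.elim0 (fun i => i.elim0)
    exact ⟨T, rfl⟩

open MvPolynomial in
lemma specht_hookShape (m : ℕ) : specht (m + 2) (hookShape m) =
    Submodule.span ℂ {f | ∃ a b, a ≠ b ∧ f = X a - X b} := by
  have m00 : ((0, 0) : ℕ × ℕ) ∈ (hookShape m).cells := by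
    rw [YoungDiagram.mem_cells, mem_threeRows]; omega
  have m10 : ((1, 0) : ℕ × ℕ) ∈ (hookShape m).cells := by
    rw [YoungDiagram.mem_cells, mem_threeRows]; omega
  have h : ∀ T : (hookShape m).cells ≃ Fin (m + 2),
      spechtPoly (hookShape m) T = X (T ⟨_, m00⟩) - X (T ⟨_, m10⟩) := by
    intro T
    have hs : (Finset.univ.filter fun p : (hookShape m).cells × (hookShape m).cells =>
        p.1.1.2 = p.2.1.2 ∧ p.1.1.1 < p.2.1.1) = {(⟨_, m00⟩, ⟨_, m10⟩)} := by
      ext ⟨⟨⟨i, j⟩, hc⟩, ⟨⟨i', j'⟩, hc'⟩⟩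
      simp only [Finset.mem_filter, Finset.mem_univ, true_and, Finset.mem_singleton, Prod.mk.injEq,
        Subtype.mk.injEq]
      rw [YoungDiagram.mem_cells, mem_threeRows] at hc hc'
      omega
    rw [spechtPoly, hs, Finset.prod_singleton]
  rw [specht]
  congr 1
  ext f
  simp only [Set.mem_range, h, Set.mem_ofPred_eq]
  constructor
  · rintro ⟨T, rfl⟩
    exact ⟨_, _, T.injective.ne (by simp), rfl⟩
  · rintro ⟨a, b, hab, rfl⟩
    obtain ⟨T, hT⟩ := exists_filling (μ := hookShape m) (n := m + 2) (by simp [card_threeRows])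
      ![⟨_, m00⟩, ⟨_, m10⟩] (by intro i j; fin_cases i <;> fin_cases j <;> simp)
      ![a, b] (by intro i j; fin_cases i <;> fin_cases j <;> simp [hab, hab.symm])
    exact ⟨T, by rw [show T ⟨_, m00⟩ = a from hT 0, show T ⟨_, m10⟩ = b from hT 1]⟩

open MvPolynomial in
lemma specht_twoTwoShape (m : ℕ) : specht (m + 4) (twoTwoShape m) =
    Submodule.span ℂ {f | ∃ a b c d, ![a, b, c, d].Injective ∧
      f = (X a - X b) * (X c - X d)} := by
  have m00 : ((0, 0) : ℕ × ℕ) ∈ (twoTwoShape m).cells := by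
    rw [YoungDiagram.mem_cells, mem_threeRows]; omega
  have m10 : ((1, 0) : ℕ × ℕ) ∈ (twoTwoShape m).cells := by
    rw [YoungDiagram.mem_cells, mem_threeRows]; omega
  have m01 : ((0, 1) : ℕ × ℕ) ∈ (twoTwoShape m).cells := by
    rw [YoungDiagram.mem_cells, mem_threeRows]; omega
  have m11 : ((1, 1) : ℕ × ℕ) ∈ (twoTwoShape m).cells := by
    rw [YoungDiagram.mem_cells, mem_threeRows]; omega
  have hinj : Function.Injective (![⟨_, m00⟩, ⟨_, m10⟩, ⟨_, m01⟩, ⟨_, m11⟩] :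
      Fin 4 → (twoTwoShape m).cells) := by
    intro i j; fin_cases i <;> fin_cases j <;> simp
  have h : ∀ T : (twoTwoShape m).cells ≃ Fin (m + 4), spechtPoly (twoTwoShape m) T =
      (X (T ⟨_, m00⟩) - X (T ⟨_, m10⟩)) * (X (T ⟨_, m01⟩) - X (T ⟨_, m11⟩)) := by
    intro T
    have hs : (Finset.univ.filter fun p : (twoTwoShape m).cells × (twoTwoShape m).cells =>
        p.1.1.2 = p.2.1.2 ∧ p.1.1.1 < p.2.1.1) =
          {(⟨_, m00⟩, ⟨_, m10⟩), (⟨_, m01⟩, ⟨_, m11⟩)} := by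
      ext ⟨⟨⟨i, j⟩, hc⟩, ⟨⟨i', j'⟩, hc'⟩⟩
      simp only [Finset.mem_filter, Finset.mem_univ, true_and, Finset.mem_singleton, Prod.mk.injEq,
        Subtype.mk.injEq, Finset.mem_insert]
      rw [YoungDiagram.mem_cells, mem_threeRows] at hc hc'
      omega
    rw [spechtPoly, hs, Finset.prod_insert (by simp), Finset.prod_singleton]
  rw [specht]
  congr 1
  ext f
  simp only [Set.mem_range, h, Set.mem_ofPred_eq]
  constructor
  · rintro ⟨T, rfl⟩
    refine ⟨_, _, _, _, ?_, rfl⟩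
    have := T.injective.comp hinj
    convert this using 1
    funext i; fin_cases i <;> rfl
  · rintro ⟨a, b, c, d, hi, rfl⟩
    obtain ⟨T, hT⟩ := exists_filling (μ := twoTwoShape m) (n := m + 4)
      (by simp only [card_threeRows]) _ hinj _ hi
    exact ⟨T, by rw [show T ⟨_, m00⟩ = a from hT 0, show T ⟨_, m10⟩ = b from hT 1,
      show T ⟨_, m01⟩ = c from hT 2, show T ⟨_, m11⟩ = d from hT 3]⟩

open MvPolynomial in
lemma specht_longHookShape (m : ℕ) : specht (m + 3) (longHookShape m) =
    Submodule.span ℂ {f | ∃ a b c, ![a, b, c].Injective ∧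
      f = (X a - X b) * (X a - X c) * (X b - X c)} := by
  have m0 : ((0, 0) : ℕ × ℕ) ∈ (longHookShape m).cells := by
    rw [YoungDiagram.mem_cells, mem_threeRows]; omega
  have m1 : ((1, 0) : ℕ × ℕ) ∈ (longHookShape m).cells := by
    rw [YoungDiagram.mem_cells, mem_threeRows]; omega
  have m2 : ((2, 0) : ℕ × ℕ) ∈ (longHookShape m).cells := by
    rw [YoungDiagram.mem_cells, mem_threeRows]; omega
  have hinj : Function.Injective (![⟨_, m0⟩, ⟨_, m1⟩, ⟨_, m2⟩] :
      Fin 3 → (longHookShape m).cells) := by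
    intro i j; fin_cases i <;> fin_cases j <;> simp
  have h : ∀ T : (longHookShape m).cells ≃ Fin (m + 3), spechtPoly (longHookShape m) T =
      (X (T ⟨_, m0⟩) - X (T ⟨_, m1⟩)) * (X (T ⟨_, m0⟩) - X (T ⟨_, m2⟩)) *
        (X (T ⟨_, m1⟩) - X (T ⟨_, m2⟩)) := by
    intro T
    have hs : (Finset.univ.filter fun p : (longHookShape m).cells × (longHookShape m).cells =>
        p.1.1.2 = p.2.1.2 ∧ p.1.1.1 < p.2.1.1) =
          {(⟨_, m0⟩, ⟨_, m1⟩), (⟨_, m0⟩, ⟨_, m2⟩), (⟨_, m1⟩, ⟨_, m2⟩)} := by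
      ext ⟨⟨⟨i, j⟩, hc⟩, ⟨⟨i', j'⟩, hc'⟩⟩
      simp only [Finset.mem_filter, Finset.mem_univ, true_and, Finset.mem_singleton, Prod.mk.injEq,
        Subtype.mk.injEq, Finset.mem_insert]
      rw [YoungDiagram.mem_cells, mem_threeRows] at hc hc'
      omega
    rw [spechtPoly, hs, Finset.prod_insert (by simp), Finset.prod_insert (by simp),
      Finset.prod_singleton, mul_assoc]
  rw [specht]
  congr 1
  ext f
  simp only [Set.mem_range, h, Set.mem_ofPred_eq]
  constructor
  · rintro ⟨T, rfl⟩
    refine ⟨_, _, _, ?_, rfl⟩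
    have := T.injective.comp hinj
    convert this using 1
    funext i; fin_cases i <;> rfl
  · rintro ⟨a, b, c, hi, rfl⟩
    obtain ⟨T, hT⟩ := exists_filling (μ := longHookShape m) (n := m + 3)
      (by simp only [card_threeRows]) _ hinj _ hi
    exact ⟨T, by rw [show T ⟨_, m0⟩ = a from hT 0, show T ⟨_, m1⟩ = b from hT 1,
      show T ⟨_, m2⟩ = c from hT 2]⟩

/-! ### Sums of transpositions on Specht modules -/

open MvPolynomial

lemma coe_spechtRep {n : ℕ} {μ : YoungDiagram} (σ : Equiv.Perm (Fin n)) (v : specht n μ) :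
    (spechtRep n μ σ v : MvPolynomial (Fin n) ℂ) = rename σ v.1 := rfl

lemma transpositionSum_specht {n : ℕ} {μ : YoungDiagram} {s : Set (MvPolynomial (Fin n) ℂ)}
    (hs : specht n μ = Submodule.span ℂ s) (c : ℂ)
    (h : ∀ f ∈ s, ∑ p : Fin n × Fin n with p.1 < p.2, rename (Equiv.swap p.1 p.2) f = c • f) :
    transpositionSum (spechtRep n μ) = c • 1 := by
  refine LinearMap.ext fun ⟨v, hv⟩ => Subtype.ext ?_
  rw [transpositionSum_apply]
  simp only [AddSubmonoidClass.coe_finsetSum, coe_spechtRep, LinearMap.smul_apply,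
    Module.End.one_apply, Submodule.coe_smul]
  rw [hs] at hv
  induction hv using Submodule.span_induction with
  | mem f hf => exact h f hf
  | zero => simp
  | add f g _ _ hf hg => simp [Finset.sum_add_distrib, hf, hg]
  | smul a f _ hf => simp [← Finset.smul_sum, hf, smul_comm a c]

lemma transpositionSum_rowShape (m : ℕ) : transpositionSum (spechtRep m (rowShape m)) =
    (contentSum (rowShape m) : ℂ) • 1 := by
  refine transpositionSum_specht (specht_rowShape m) _ ?_
  rintro _ rfl
  simp only [map_one]
  rw [sum_lt_of_symm (fun _ _ => (1 : MvPolynomial (Fin m) ℂ)) fun _ _ => rfl,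
    contentSum_threeRows]
  simp only [Finset.sum_const, Finset.card_univ, Fintype.card_fin, ← Nat.cast_smul_eq_nsmul ℂ]
  module

/-- The sum of all variables arising from `X a` and from `X b` is the same and cancels in the
difference. -/
lemma transpositionSum_hookShape (m : ℕ) : transpositionSum (spechtRep (m + 2) (hookShape m)) =
    (contentSum (hookShape m) : ℂ) • 1 := by
  refine transpositionSum_specht (specht_hookShape m) _ ?_
  rintro _ ⟨a, b, hab, rfl⟩
  simp only [map_sub, rename_X, Finset.sum_sub_distrib]
  rw [sum_swap_one (fun a => (X a : MvPolynomial (Fin (m + 2)) ℂ)),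
    sum_swap_one (fun a => (X a : MvPolynomial (Fin (m + 2)) ℂ)), contentSum_threeRows,
    cast_choose_two']
  push_cast
  module

/-- Expanding the product gives four values of a symmetric function of two points. In their
alternating combination the row sums and the diagonal terms of `sum_swap_two` cancel, and a multiple
of the original remains. -/
lemma transpositionSum_twoTwoShape (m : ℕ) :
    transpositionSum (spechtRep (m + 4) (twoTwoShape m)) = (contentSum (twoTwoShape m) : ℂ) • 1 := by
  refine transpositionSum_specht (specht_twoTwoShape m) _ ?_
  rintro _ ⟨a, b, c, d, hi, rfl⟩
  have hac : a ≠ c := hi.ne (show (0 : Fin 4) ≠ 2 by decide)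
  have had : a ≠ d := hi.ne (show (0 : Fin 4) ≠ 3 by decide)
  have hbc : b ≠ c := hi.ne (show (1 : Fin 4) ≠ 2 by decide)
  have hbd : b ≠ d := hi.ne (show (1 : Fin 4) ≠ 3 by decide)
  let g : Fin (m + 4) → Fin (m + 4) → MvPolynomial (Fin (m + 4)) ℂ := fun i j => X i * X j
  have e : ∀ σ : Equiv.Perm (Fin (m + 4)), rename σ ((X a - X b) * (X c - X d)) =
      g (σ a) (σ c) - g (σ a) (σ d) - g (σ b) (σ c) + g (σ b) (σ d) := by
    intro σ
    simp only [map_mul, map_sub, rename_X, g]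
    ring
  simp only [e, Finset.sum_add_distrib, Finset.sum_sub_distrib]
  have hg : ∀ i j, g i j = g j i := fun i j => mul_comm _ _
  have hs : ∀ i, ∑ k, g k i = ∑ k, g i k := fun i => Finset.sum_congr rfl fun k _ => hg k i
  have e1 : (X a - X b) * (X c - X d) = g a c - g a d - g b c + g b d := by
    simp only [g]; ring
  rw [sum_swap_two g hac, sum_swap_two g had, sum_swap_two g hbc, sum_swap_two g hbd, hs c, hs d,
    hg c a, hg d a, hg c b, hg d b, e1, contentSum_threeRows, cast_choose_two']
  push_cast
  module

/-- The Vandermonde product is the alternating sum of the monomials `X i ^ 2 * X j`, so it involves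
functions of only two points even though three variables occur, and `sum_swap_two` suffices. -/
lemma transpositionSum_longHookShape (m : ℕ) :
    transpositionSum (spechtRep (m + 3) (longHookShape m)) =
      (contentSum (longHookShape m) : ℂ) • 1 := by
  refine transpositionSum_specht (specht_longHookShape m) _ ?_
  rintro _ ⟨a, b, c, hi, rfl⟩
  have hab : a ≠ b := hi.ne (show (0 : Fin 3) ≠ 1 by decide)
  have hac : a ≠ c := hi.ne (show (0 : Fin 3) ≠ 2 by decide)
  have hbc : b ≠ c := hi.ne (show (1 : Fin 3) ≠ 2 by decide)
  let g : Fin (m + 3) → Fin (m + 3) → MvPolynomial (Fin (m + 3)) ℂ := fun i j => X i ^ 2 * X j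
  have e : ∀ σ : Equiv.Perm (Fin (m + 3)),
      rename σ ((X a - X b) * (X a - X c) * (X b - X c)) =
      g (σ a) (σ b) - g (σ b) (σ a) + (g (σ b) (σ c) - g (σ c) (σ b))
        + (g (σ c) (σ a) - g (σ a) (σ c)) := by
    intro σ
    simp only [map_mul, map_sub, rename_X, g]
    ring
  have e1 : (X a - X b) * (X a - X c) * (X b - X c) =
      g a b - g b a + (g b c - g c b) + (g c a - g a c) := by
    simp only [g]; ring
  simp only [e, Finset.sum_add_distrib, Finset.sum_sub_distrib]
  rw [sum_swap_two g hab, sum_swap_two g hac, sum_swap_two g hbc, sum_swap_two g hab.symm,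
    sum_swap_two g hac.symm, sum_swap_two g hbc.symm, e1,
    contentSum_threeRows, cast_choose_two']
  push_cast
  module

lemma transpositionSum_eq_contentSum_one {m : ℕ} {μ : YoungDiagram} (hμ : μ ∈ labels (m + 2) 1) :
    transpositionSum (spechtRep (m + 2) μ) = (contentSum μ : ℂ) • 1 := by
  rcases mem_labels_one.1 hμ with rfl | rfl
  · exact transpositionSum_rowShape _
  · exact transpositionSum_hookShape _

lemma transpositionSum_eq_contentSum_two {m : ℕ} {μ : YoungDiagram} (hμ : μ ∈ labels (m + 4) 2) :
    transpositionSum (spechtRep (m + 4) μ) = (contentSum μ : ℂ) • 1 := by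
  rcases mem_labels_two.1 hμ with rfl | rfl | rfl | rfl
  · exact transpositionSum_rowShape _
  · exact transpositionSum_hookShape _
  · exact transpositionSum_twoTwoShape _
  · exact transpositionSum_longHookShape _

/-! ### Action of the elements `Z` on the multiplicity spaces -/

/-- This moves the action of a Z element from the tensor space to the Specht module, where it is a
scalar. -/
lemma comp_transpositionSum {n : ℕ} {V W : Type*} [AddCommGroup V] [Module ℂ V] [AddCommGroup W]
    [Module ℂ W] {ρ : Representation ℂ (Equiv.Perm (Fin n)) V}
    {τ : Representation ℂ (Equiv.Perm (Fin n)) W} (f : Representation.IntertwiningMap ρ τ) (v : V) :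
    transpositionSum τ (f v) = f (transpositionSum ρ v) := by
  rw [transpositionSum_apply, transpositionSum_apply, ← Representation.IntertwiningMap.toLinearMap_apply,
    map_sum]
  exact Finset.sum_congr rfl fun p _ => (f.isIntertwining _ _ _ _).symm

lemma irrep_apply {k N : ℕ} {μ : YoungDiagram} (x : PartitionAlgebra k N) (φ : Irrep k N μ)
    (v : specht N μ) : irrep k N μ x φ v = act k N x (φ v) := rfl

lemma irrepHalf_apply {k n : ℕ} {μ : YoungDiagram} (x : PartitionAlgebra (k + 1) (n + 1))
    (φ : IrrepHalf k n μ) (v : specht n μ) :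
    irrepHalf k n μ x φ v = (schurWeylHalf k n x).toLinearMap (φ v) := rfl

lemma irrep_mul {k N : ℕ} {μ : YoungDiagram} (x y : PartitionAlgebra k N) :
    irrep k N μ (x * y) = irrep k N μ x * irrep k N μ y := by
  refine LinearMap.ext fun φ => DFunLike.ext _ _ fun v => ?_
  rw [irrep_apply, map_mul]
  rfl

lemma irrep_one {k N : ℕ} {μ : YoungDiagram} : irrep k N μ 1 = 1 := by
  refine LinearMap.ext fun φ => DFunLike.ext _ _ fun v => ?_
  rw [irrep_apply, map_one]
  rfl

/-- The representation of `P_k(N)` on `Z_μ` as an algebra homomorphism. -/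
noncomputable def irrepHom (k N : ℕ) (μ : YoungDiagram) :
    PartitionAlgebra k N →ₐ[ℂ] Module.End ℂ (Irrep k N μ) :=
  AlgHom.ofLinearMap (irrep k N μ) irrep_one irrep_mul

lemma irrepHalf_one {n : ℕ} {μ : YoungDiagram} : irrepHalf 1 n μ 1 = 1 := by
  refine LinearMap.ext fun φ => DFunLike.ext _ _ fun v => ?_
  rw [irrepHalf_apply, schurWeylHalf_one]
  rfl

/-- The representation of `P_{3/2}(n+1)` on `Z_μ^{1/2}` as an algebra homomorphism. -/
noncomputable def irrepHalfHom (n : ℕ) (μ : YoungDiagram) :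
    halfAlgebra 1 (n + 1) →ₐ[ℂ] Module.End ℂ (IrrepHalf 1 n μ) :=
  AlgHom.ofLinearMap (irrepHalf 1 n μ ∘ₗ (halfAlgebra 1 (n + 1)).val.toLinearMap) irrepHalf_one
    fun x y => by
      refine LinearMap.ext fun φ => DFunLike.ext _ _ fun v => ?_
      change irrepHalf 1 n μ (x.1 * y.1) φ v = _
      rw [irrepHalf_apply, schurWeylHalf_mul x.2 y.2]
      rfl

lemma irrep_eq_smul_one {k N : ℕ} {μ : YoungDiagram} {x : PartitionAlgebra k N} {c d : ℂ}
    (hx : act k N x = transpositionSum (tensorRep N k) - d • 1)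
    (hμ : transpositionSum (spechtRep N μ) = c • 1) : irrep k N μ x = (c - d) • 1 := by
  refine LinearMap.ext fun φ => DFunLike.ext _ _ fun v => ?_
  rw [irrep_apply, hx, LinearMap.sub_apply, comp_transpositionSum, hμ]
  change φ (c • v) - d • φ v = (c - d) • φ v
  rw [map_smul, sub_smul]

lemma irrepHalf_eq_smul_one {k n : ℕ} {μ : YoungDiagram} {x : PartitionAlgebra (k + 1) (n + 1)}
    {c d : ℂ} (hx : (schurWeylHalf k n x).toLinearMap = transpositionSum (tensorRepHalf n k) - d • 1)
    (hμ : transpositionSum (spechtRep n μ) = c • 1) : irrepHalf k n μ x = (c - d) • 1 := by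
  refine LinearMap.ext fun φ => DFunLike.ext _ _ fun v => ?_
  rw [irrepHalf_apply, hx, LinearMap.sub_apply, comp_transpositionSum, hμ]
  change φ (c • v) - d • φ v = (c - d) • φ v
  rw [map_smul, sub_smul]

instance (n : ℕ) (μ : YoungDiagram) : Module.Finite ℂ (specht n μ) :=
  Module.Finite.span_of_finite ℂ (Set.finite_range _)

lemma nchar_eq {k N : ℕ} {μ : YoungDiagram} [Nontrivial (Irrep k N μ)] {x : PartitionAlgebra k N}
    {c : ℂ} (h : irrep k N μ x = c • 1) : nchar x μ = c := by
  have : (Module.finrank ℂ (Irrep k N μ) : ℂ) ≠ 0 := by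
    exact_mod_cast Module.finrank_pos.ne'
  rw [nchar, h, map_smul, LinearMap.trace_one, smul_eq_mul, mul_div_cancel_right₀ _ this]

lemma ncharHalf_eq {k n : ℕ} {μ : YoungDiagram} [Nontrivial (IrrepHalf k n μ)]
    {x : PartitionAlgebra (k + 1) (n + 1)} {c : ℂ} (h : irrepHalf k n μ x = c • 1) :
    ncharHalf x μ = c := by
  have : (Module.finrank ℂ (IrrepHalf k n μ) : ℂ) ≠ 0 := by
    exact_mod_cast Module.finrank_pos.ne'
  rw [ncharHalf, h, map_smul, LinearMap.trace_one, smul_eq_mul, mul_div_cancel_right₀ _ this]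

/-! ### Intertwiners from Specht modules to tensors -/

section Intertwiners

variable {n : ℕ} {W : Type*} [AddCommGroup W] [Module ℂ W]

/-- The restriction to a Specht module of an equivariant map on polynomials. -/
noncomputable def polyIntertwiner (τ : Representation ℂ (Equiv.Perm (Fin n)) W)
    (L : MvPolynomial (Fin n) ℂ →ₗ[ℂ] W) (hL : ∀ σ f, L (rename (σ : Equiv.Perm (Fin n)) f) = τ σ (L f))
    (μ : YoungDiagram) : Representation.IntertwiningMap (spechtRep n μ) τ where
  toLinearMap := L ∘ₗ (specht n μ).subtype
  isIntertwining' σ := LinearMap.ext fun v => hL σ v.1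

/-- The intertwiner determined by an invariant vector, through the constant coefficient. -/
noncomputable def constIntertwiner (τ : Representation ℂ (Equiv.Perm (Fin n)) W) (u : W)
    (hu : ∀ σ, τ σ u = u) (μ : YoungDiagram) :
    Representation.IntertwiningMap (spechtRep n μ) τ :=
  polyIntertwiner τ ((lcoeff ℂ 0).smulRight u) (fun σ f => by
    simp only [LinearMap.smulRight_apply, map_smul, hu]
    congr 1
    exact constantCoeff_rename σ f) μ

/-- The vector of the coefficients of the variables. -/
noncomputable def linearCoeffs (n : ℕ) : MvPolynomial (Fin n) ℂ →ₗ[ℂ] (Fin n → ℂ) :=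
  LinearMap.pi fun i => lcoeff ℂ (Finsupp.single i 1)

lemma linearCoeffs_apply (f : MvPolynomial (Fin n) ℂ) (i : Fin n) :
    linearCoeffs n f i = coeff (Finsupp.single i 1) f := rfl

lemma linearCoeffs_rename (σ : Equiv.Perm (Fin n)) (f : MvPolynomial (Fin n) ℂ) :
    linearCoeffs n (rename σ f) = linearCoeffs n f ∘ ⇑σ⁻¹ := by
  funext i
  rw [Function.comp_apply, linearCoeffs_apply, linearCoeffs_apply,
    ← coeff_rename_mapDomain σ σ.injective f, Finsupp.mapDomain_single]
  simp

lemma linearCoeffs_X_sub_X (a b : Fin n) :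
    linearCoeffs n (X a - X b) = Pi.single a 1 - Pi.single b 1 := by
  funext i
  rw [linearCoeffs_apply, coeff_sub, coeff_X, coeff_X]
  simp [Pi.single_apply, Finsupp.single_left_inj, eq_comm]

/-- The intertwiner determined by an equivariant map on vectors, through the coefficients of the
variables. -/
noncomputable def linearIntertwiner (τ : Representation ℂ (Equiv.Perm (Fin n)) W)
    (B : (Fin n → ℂ) →ₗ[ℂ] W) (hB : ∀ (σ : Equiv.Perm (Fin n)) x, B (x ∘ ⇑σ⁻¹) = τ σ (B x))
    (μ : YoungDiagram) : Representation.IntertwiningMap (spechtRep n μ) τ :=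
  polyIntertwiner τ (B ∘ₗ linearCoeffs n) (fun σ f => by
    rw [LinearMap.comp_apply, linearCoeffs_rename, hB]; rfl) μ

end Intertwiners

/-- The exponent of `X i ^ s * X j`. -/
noncomputable def quadExp {N : ℕ} (s : ℕ) (i j : Fin N) : Fin N →₀ ℕ :=
  Finsupp.single i s + Finsupp.single j 1

/-- The tensor of the coefficients of `X i ^ s * X j`. -/
noncomputable def quadCoeffs (N s : ℕ) : MvPolynomial (Fin N) ℂ →ₗ[ℂ] Tensor N 2 :=
  LinearMap.pi fun i => lcoeff ℂ (quadExp s (i 0) (i 1))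

lemma quadCoeffs_apply {N s : ℕ} (f : MvPolynomial (Fin N) ℂ) (p q : Fin N) :
    quadCoeffs N s f ![p, q] = coeff (quadExp s p q) f := rfl

lemma quadCoeffs_rename {N s : ℕ} (σ : Equiv.Perm (Fin N)) (f : MvPolynomial (Fin N) ℂ) :
    quadCoeffs N s (rename σ f) = tensorRep N 2 σ (quadCoeffs N s f) := by
  refine tensor_ext_two fun p q => ?_
  rw [tensorRep_two, quadCoeffs_apply, quadCoeffs_apply,
    ← coeff_rename_mapDomain σ σ.injective f, quadExp, quadExp, Finsupp.mapDomain_add,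
    Finsupp.mapDomain_single, Finsupp.mapDomain_single]
  simp

/-- The intertwiner given by the coefficients of `X i ^ s * X j`. -/
noncomputable def quadIntertwiner (N s : ℕ) (μ : YoungDiagram) : Irrep 2 N μ :=
  polyIntertwiner (tensorRep N 2) (quadCoeffs N s) quadCoeffs_rename μ

lemma quadExp_one_eq_iff {N : ℕ} {a b i j : Fin N} :
    quadExp 1 a b = quadExp 1 i j ↔ (i = a ∧ j = b) ∨ (i = b ∧ j = a) := by
  rw [quadExp, quadExp, Finsupp.single_add_single_eq_single_add_single one_ne_zero one_ne_zero]
  grind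

/-- With exponent 2 the monomial remembers the order of its variables, with exponent 1 it does not.
Hence `quadCoeffs` with s = 2 can produce antisymmetric tensors, while s = 1 produces symmetric
ones. -/
lemma quadExp_two_eq_iff {N : ℕ} {a b i j : Fin N} :
    quadExp 2 a b = quadExp 2 i j ↔ i = a ∧ j = b := by
  rw [quadExp, quadExp, Finsupp.single_add_single_eq_single_add_single two_ne_zero one_ne_zero]
  grind

lemma coeff_X_mul_X {N : ℕ} (a b i j : Fin N) :
    coeff (quadExp 1 i j) (X a * X b : MvPolynomial (Fin N) ℂ) =
      if (i = a ∧ j = b) ∨ (i = b ∧ j = a) then 1 else 0 := by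
  have h : (X a * X b : MvPolynomial (Fin N) ℂ) = monomial (quadExp 1 a b) 1 := by
    rw [X, X, monomial_mul, mul_one]; rfl
  rw [h, coeff_monomial]
  exact if_congr quadExp_one_eq_iff rfl rfl

lemma coeff_X_sq_mul_X {N : ℕ} (a b i j : Fin N) :
    coeff (quadExp 2 i j) (X a ^ 2 * X b : MvPolynomial (Fin N) ℂ) =
      if i = a ∧ j = b then 1 else 0 := by
  have h : (X a ^ 2 * X b : MvPolynomial (Fin N) ℂ) = monomial (quadExp 2 a b) 1 := by
    rw [X_pow_eq_monomial, X, monomial_mul, mul_one]; rfl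
  rw [h, coeff_monomial]
  exact if_congr quadExp_two_eq_iff rfl rfl

/-- The tensor with entries `α` on the diagonal and `β` off the diagonal. -/
def constTensor (N : ℕ) (α β : ℂ) : Tensor N 2 := fun i => if i 0 = i 1 then α else β

lemma constTensor_apply {N : ℕ} (α β : ℂ) (p q : Fin N) :
    constTensor N α β ![p, q] = if p = q then α else β := rfl

/-- The intertwiners from the trivial representation to `V_N^{⊗2}`. -/
noncomputable def rowIntertwiner (N : ℕ) (α β : ℂ) (μ : YoungDiagram) : Irrep 2 N μ :=
  constIntertwiner (tensorRep N 2) (constTensor N α β) (fun σ => tensor_ext_two fun p q => by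
    simp only [tensorRep_two, constTensor_apply, EmbeddingLike.apply_eq_iff_eq]) μ

/-- Equivariant maps from `V_N` to `V_N^{⊗2}`. -/
def linearTensor (N : ℕ) (α β γ : ℂ) : (Fin N → ℂ) →ₗ[ℂ] Tensor N 2 where
  toFun x i := if i 0 = i 1 then α * x (i 1) else β * x (i 0) + γ * x (i 1)
  map_add' x y := by
    funext i
    simp only [Pi.add_apply]
    split_ifs <;> ring
  map_smul' c x := by
    funext i
    simp only [Pi.smul_apply, smul_eq_mul, RingHom.id_apply]
    split_ifs <;> ring

lemma linearTensor_apply {N : ℕ} (α β γ : ℂ) (x : Fin N → ℂ) (p q : Fin N) :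
    linearTensor N α β γ x ![p, q] = if p = q then α * x q else β * x p + γ * x q := rfl

/-- The intertwiners from the standard representation to `V_N^{⊗2}`. -/
noncomputable def hookIntertwiner (N : ℕ) (α β γ : ℂ) (μ : YoungDiagram) : Irrep 2 N μ :=
  linearIntertwiner (tensorRep N 2) (linearTensor N α β γ) (fun σ x => tensor_ext_two fun p q => by
    simp only [tensorRep_two, linearTensor_apply, EmbeddingLike.apply_eq_iff_eq,
      Function.comp_apply]) μ

lemma rowIntertwiner_apply {N : ℕ} (α β : ℂ) (μ : YoungDiagram) (v : specht N μ) :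
    rowIntertwiner N α β μ v = coeff 0 v.1 • constTensor N α β := rfl

lemma hookIntertwiner_apply {N : ℕ} (α β γ : ℂ) (μ : YoungDiagram) (v : specht N μ) :
    hookIntertwiner N α β γ μ v = linearTensor N α β γ (linearCoeffs N v) := rfl

lemma quadIntertwiner_apply {N s : ℕ} (μ : YoungDiagram) (v : specht N μ) :
    quadIntertwiner N s μ v = quadCoeffs N s v := rfl

lemma one_mem_specht (m : ℕ) : (1 : MvPolynomial (Fin m) ℂ) ∈ specht m (rowShape m) := by
  rw [specht_rowShape]; exact Submodule.mem_span_singleton_self _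

lemma X_sub_X_mem_specht {m : ℕ} {a b : Fin (m + 2)} (hab : a ≠ b) :
    (X a - X b : MvPolynomial (Fin (m + 2)) ℂ) ∈ specht (m + 2) (hookShape m) := by
  rw [specht_hookShape]; exact Submodule.subset_span ⟨a, b, hab, rfl⟩

lemma twoTwo_mem_specht {m : ℕ} {a b c d : Fin (m + 4)} (h : ![a, b, c, d].Injective) :
    ((X a - X b) * (X c - X d) : MvPolynomial (Fin (m + 4)) ℂ) ∈
      specht (m + 4) (twoTwoShape m) := by
  rw [specht_twoTwoShape]; exact Submodule.subset_span ⟨a, b, c, d, h, rfl⟩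

lemma vandermonde_mem_specht {m : ℕ} {a b c : Fin (m + 3)} (h : ![a, b, c].Injective) :
    ((X a - X b) * (X a - X c) * (X b - X c) : MvPolynomial (Fin (m + 3)) ℂ) ∈
      specht (m + 3) (longHookShape m) := by
  rw [specht_longHookShape]; exact Submodule.subset_span ⟨a, b, c, h, rfl⟩

lemma quadCoeffs_twoTwo {N : ℕ} (a b c d p q : Fin N) :
    quadCoeffs N 1 ((X a - X b) * (X c - X d)) ![p, q] =
      (if (p = a ∧ q = c) ∨ (p = c ∧ q = a) then 1 else 0)
      - (if (p = a ∧ q = d) ∨ (p = d ∧ q = a) then 1 else 0)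
      - (if (p = b ∧ q = c) ∨ (p = c ∧ q = b) then 1 else 0)
      + (if (p = b ∧ q = d) ∨ (p = d ∧ q = b) then 1 else 0) := by
  have h : ((X a - X b) * (X c - X d) : MvPolynomial (Fin N) ℂ) =
    X a * X c - X a * X d - X b * X c + X b * X d := by ring
  rw [quadCoeffs_apply, h]
  simp only [coeff_add, coeff_sub, coeff_X_mul_X]

lemma quadCoeffs_vandermonde {N : ℕ} (a b c p q : Fin N) :
    quadCoeffs N 2 ((X a - X b) * (X a - X c) * (X b - X c)) ![p, q] =
      (if p = a ∧ q = b then 1 else 0) - (if p = b ∧ q = a then 1 else 0)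
      + ((if p = b ∧ q = c then 1 else 0) - (if p = c ∧ q = b then 1 else 0))
      + ((if p = c ∧ q = a then 1 else 0) - (if p = a ∧ q = c then 1 else 0)) := by
  have e : ((X a - X b) * (X a - X c) * (X b - X c) : MvPolynomial (Fin N) ℂ) =
    X a ^ 2 * X b - X b ^ 2 * X a + (X b ^ 2 * X c - X c ^ 2 * X b)
      + (X c ^ 2 * X a - X a ^ 2 * X c) := by ring
  rw [quadCoeffs_apply, e]
  simp only [coeff_add, coeff_sub, coeff_X_sq_mul_X]

/-! ### Tensors are spanned by images of Specht modules -/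

/-- All values are equal, so their vanishing sum is N times each of them. With `E` the images of
basis vectors, the hypotheses say that a linear map kills the invariant vector and the standard
representation. -/
lemma eq_zero_of_sum_single_one {N : ℕ} {M : Type*} [AddCommGroup M] [Module ℂ M]
    (hN : N ≠ 0) (E : Fin N → M) (h0 : ∑ a, E a = 0) (h1 : ∀ a b, a ≠ b → E a = E b) (a : Fin N) :
    E a = 0 := by
  have h2 : ∑ b, E b = (N : ℂ) • E a := by
    rw [Finset.sum_congr rfl fun b _ => show E b = E a from
      if h : b = a then h ▸ rfl else h1 b a h]
    simp [Nat.cast_smul_eq_nsmul]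
  rw [h0] at h2
  exact (smul_eq_zero.1 h2.symm).resolve_left (by exact_mod_cast hN)

lemma map_tensor_one {N : ℕ} {M : Type*} [AddCommGroup M] [Module ℂ M] (D : Tensor N 1 →ₗ[ℂ] M)
    (w : Tensor N 1) : D w = ∑ a, w ![a] • D (Pi.single ![a] 1) := by
  rw [LinearMap.pi_apply_eq_sum_univ D w, sum_fin_one]
  refine Finset.sum_congr rfl fun a _ => ?_
  congr 2
  funext j
  simp [Pi.single_apply, eq_comm]

lemma map_tensor_castSucc {n : ℕ} {M : Type*} [AddCommGroup M] [Module ℂ M]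
    (D : Tensor (n + 1) 1 →ₗ[ℂ] M) (w : Tensor (n + 1) 1) :
    D w = ∑ a : Fin n, w ![a.castSucc] • D (Pi.single ![a.castSucc] 1)
      + w ![Fin.last n] • D (Pi.single ![Fin.last n] 1) := by
  rw [map_tensor_one D w, Fin.sum_univ_castSucc]

lemma map_tensor_two {N : ℕ} {M : Type*} [AddCommGroup M] [Module ℂ M] (D : Tensor N 2 →ₗ[ℂ] M)
    (w : Tensor N 2) : D w = ∑ a, ∑ b, w ![a, b] • D (Pi.single ![a, b] 1) := by
  rw [LinearMap.pi_apply_eq_sum_univ D w, sum_fin_two]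
  refine Finset.sum_congr rfl fun a _ => Finset.sum_congr rfl fun b _ => ?_
  congr 2
  funext j
  simp [Pi.single_apply, eq_comm]

/-- The constant intertwiner to `V_N`. -/
noncomputable def rowIntertwinerOne (N : ℕ) (μ : YoungDiagram) : Irrep 1 N μ :=
  constIntertwiner (tensorRep N 1) (fun _ => 1) (fun _ => rfl) μ

/-- The intertwiner from the standard representation to `V_N`. -/
noncomputable def hookIntertwinerOne (N : ℕ) (μ : YoungDiagram) : Irrep 1 N μ :=
  linearIntertwiner (tensorRep N 1) (LinearMap.funLeft ℂ ℂ fun i => i 0) (fun _ _ => rfl) μ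

lemma rowIntertwinerOne_apply {N : ℕ} (μ : YoungDiagram) (v : specht N μ) :
    rowIntertwinerOne N μ v = MvPolynomial.coeff 0 v.1 • (fun _ => 1 : Tensor N 1) := rfl

lemma hookIntertwinerOne_apply {N : ℕ} (μ : YoungDiagram) (v : specht N μ) :
    hookIntertwinerOne N μ v = LinearMap.funLeft ℂ ℂ (fun i : Fin 1 → Fin N => i 0)
      (linearCoeffs N v) := rfl

/-- V_N is spanned by the all-ones vector and the differences of basis vectors, which are images of
the trivial and the standard Specht modules. -/
lemma eq_zero_of_irrep_one {m : ℕ} (x : PartitionAlgebra 1 (m + 2))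
    (h : ∀ ρ ∈ labels (m + 2) 1, irrep 1 (m + 2) ρ x = 0) : act 1 (m + 2) x = 0 := by
  have hv : ∀ ρ ∈ labels (m + 2) 1, ∀ (φ : Irrep 1 (m + 2) ρ) v, act 1 (m + 2) x (φ v) = 0 := by
    intro ρ hρ φ v
    rw [← irrep_apply, h ρ hρ]; rfl
  have h0 := hv _ (mem_labels_one.2 (.inl rfl)) (rowIntertwinerOne _ _) ⟨1, one_mem_specht _⟩
  have h1 := fun (a b : Fin (m + 2)) (hab : a ≠ b) => hv _ (mem_labels_one.2 (.inr rfl))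
    (hookIntertwinerOne _ _) ⟨_, X_sub_X_mem_specht hab⟩
  simp only [rowIntertwinerOne_apply, hookIntertwinerOne_apply, linearCoeffs_X_sub_X,
    coeff_zero_one, one_smul] at h0 h1
  generalize act 1 (m + 2) x = D at *
  refine LinearMap.ext fun w => ?_
  rw [map_tensor_one D] at h0 ⊢
  replace h1 := fun a b hab => (map_tensor_one D _).symm.trans (h1 a b hab)
  simp only [LinearMap.zero_apply]
  refine Finset.sum_eq_zero fun a _ => ?_
  rw [eq_zero_of_sum_single_one (by omega) (fun a => D (Pi.single ![a] 1)) ?_ ?_ a,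
    smul_zero]
  · simpa using h0
  · intro a b hab
    have := h1 a b hab
    simp only [LinearMap.funLeft_apply, Pi.sub_apply, sub_smul, Finset.sum_sub_distrib,
      Pi.single_apply, Matrix.cons_val_zero, ite_smul, one_smul, zero_smul,
      Finset.sum_ite_eq', Finset.mem_univ, if_true] at this
    exact sub_eq_zero.1 this

/-- The invariant vectors of `V_{n+1}` under `S_n`. -/
def lastTensor (n : ℕ) (α β : ℂ) : Tensor (n + 1) 1 := fun i =>
  Fin.snoc (α := fun _ => ℂ) (fun _ => α) β (i 0)

lemma snoc_permIncl {n : ℕ} (σ : Equiv.Perm (Fin n)) (x : Fin n → ℂ) (β : ℂ) (p : Fin (n + 1)) :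
    Fin.snoc (α := fun _ => ℂ) x β (permIncl n σ p) = Fin.snoc (α := fun _ => ℂ) (x ∘ σ) β p := by
  induction p using Fin.lastCases with
  | last => rw [permIncl_last]; simp
  | cast p => rw [permIncl_castSucc]; simp

/-- The constant intertwiners to the restriction of `V_{n+1}`. -/
noncomputable def rowIntertwinerHalf (n : ℕ) (α β : ℂ) (μ : YoungDiagram) : IrrepHalf 1 n μ :=
  constIntertwiner (tensorRepHalf n 1) (lastTensor n α β) (fun σ => tensor_ext_one fun p => by
    rw [tensorRepHalf_one]
    exact snoc_permIncl _ _ _ _) μ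

/-- Extension of a vector by zero. -/
def snocZero (n : ℕ) : (Fin n → ℂ) →ₗ[ℂ] Tensor (n + 1) 1 where
  toFun x i := Fin.snoc (α := fun _ => ℂ) x 0 (i 0)
  map_add' x y := funext fun i => by
    simp only [Pi.add_apply]
    induction i 0 using Fin.lastCases <;> simp
  map_smul' c x := funext fun i => by
    simp only [Pi.smul_apply, smul_eq_mul, RingHom.id_apply]
    induction i 0 using Fin.lastCases <;> simp

/-- The intertwiner from the standard representation to the restriction of `V_{n+1}`. -/
noncomputable def hookIntertwinerHalf (n : ℕ) (μ : YoungDiagram) : IrrepHalf 1 n μ :=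
  linearIntertwiner (tensorRepHalf n 1) (snocZero n) (fun σ x => tensor_ext_one fun p => by
    rw [tensorRepHalf_one]
    exact (snoc_permIncl _ _ _ _).symm) μ

lemma lastTensor_apply {n : ℕ} (α β : ℂ) (p : Fin (n + 1)) :
    lastTensor n α β ![p] = Fin.snoc (α := fun _ => ℂ) (fun _ => α) β p := rfl

lemma snocZero_apply {n : ℕ} (x : Fin n → ℂ) (p : Fin (n + 1)) :
    snocZero n x ![p] = Fin.snoc (α := fun _ => ℂ) x 0 p := rfl

lemma rowIntertwinerHalf_apply {n : ℕ} (α β : ℂ) (μ : YoungDiagram) (v : specht n μ) :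
    rowIntertwinerHalf n α β μ v = MvPolynomial.coeff 0 v.1 • lastTensor n α β := rfl

lemma hookIntertwinerHalf_apply {n : ℕ} (μ : YoungDiagram) (v : specht n μ) :
    hookIntertwinerHalf n μ v = snocZero n (linearCoeffs n v) := rfl

/-- Under S_{N-1} there are two invariant vectors, the last basis vector and the sum of the others;
together with the differences of the first N - 1 basis vectors they span V_N. -/
lemma eq_zero_of_irrepHalf {m : ℕ} (x : PartitionAlgebra 2 (m + 3))
    (h : ∀ ρ ∈ labels (m + 2) 1, irrepHalf 1 (m + 2) ρ x = 0) :
    (schurWeylHalf 1 (m + 2) x).toLinearMap = 0 := by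
  have hv : ∀ ρ ∈ labels (m + 2) 1, ∀ (φ : IrrepHalf 1 (m + 2) ρ) v,
      (schurWeylHalf 1 (m + 2) x).toLinearMap (φ v) = 0 := by
    intro ρ hρ φ v
    rw [← irrepHalf_apply, h ρ hρ]; rfl
  have h0 := fun α β => hv _ (mem_labels_one.2 (.inl rfl)) (rowIntertwinerHalf _ α β _)
    ⟨1, one_mem_specht _⟩
  have h1 := fun (a b : Fin (m + 2)) (hab : a ≠ b) => hv _ (mem_labels_one.2 (.inr rfl))
    (hookIntertwinerHalf _ _) ⟨_, X_sub_X_mem_specht hab⟩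
  simp only [rowIntertwinerHalf_apply, hookIntertwinerHalf_apply, linearCoeffs_X_sub_X,
    coeff_zero_one, one_smul] at h0 h1
  generalize (schurWeylHalf 1 (m + 2) x).toLinearMap = D at *
  refine LinearMap.ext fun w => ?_
  rw [map_tensor_castSucc D]
  replace h0 := fun α β => (map_tensor_castSucc D _).symm.trans (h0 α β)
  replace h1 := fun a b hab => (map_tensor_castSucc D _).symm.trans (h1 a b hab)
  simp only [lastTensor_apply, snocZero_apply, Fin.snoc_castSucc,
    Fin.snoc_last, zero_smul, add_zero] at h0 h1 ⊢
  have hl := h0 0 1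
  have hc := h0 1 0
  simp only [one_smul, zero_smul, add_zero, Finset.sum_const_zero, zero_add] at hl hc
  have hz : ∀ a : Fin (m + 2), D (Pi.single ![a.castSucc] 1) = 0 := by
    refine eq_zero_of_sum_single_one (by omega)
      (fun a : Fin (m + 2) => D (Pi.single ![a.castSucc] 1)) hc fun a b hab => ?_
    have := h1 a b hab
    simp only [Pi.sub_apply, sub_smul, Finset.sum_sub_distrib, Pi.single_apply, ite_smul, one_smul,
      zero_smul, Finset.sum_ite_eq', Finset.mem_univ, if_true] at this
    exact sub_eq_zero.1 this
  rw [hl, smul_zero, add_zero]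
  simp [hz]

lemma sum_sum_ite_and {N : ℕ} {M : Type*} [AddCommGroup M] [Module ℂ M] (E : Fin N → Fin N → M)
    (a b : Fin N) : ∑ p, ∑ q, (if p = a ∧ q = b then (1 : ℂ) else 0) • E p q = E a b := by
  simp [ite_and]

lemma sum_sum_ite_or {N : ℕ} {M : Type*} [AddCommGroup M] [Module ℂ M] (E : Fin N → Fin N → M)
    {a b : Fin N} (hab : a ≠ b) :
    ∑ p, ∑ q, (if (p = a ∧ q = b) ∨ (p = b ∧ q = a) then (1 : ℂ) else 0) • E p q =
      E a b + E b a := by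
  rw [← sum_sum_ite_and E a b, ← sum_sum_ite_and E b a, ← Finset.sum_add_distrib]
  simp only [← Finset.sum_add_distrib, ← add_smul]
  refine Finset.sum_congr rfl fun p _ => Finset.sum_congr rfl fun q _ => ?_
  congr 1
  by_cases h1 : p = a ∧ q = b <;> by_cases h2 : p = b ∧ q = a
  · exact absurd (h1.1.symm.trans h2.1) hab
  · rw [if_pos (Or.inl h1), if_pos h1, if_neg h2, add_zero]
  · rw [if_pos (Or.inr h2), if_neg h1, if_pos h2, zero_add]
  · rw [if_neg (not_or.2 ⟨h1, h2⟩), if_neg h1, if_neg h2, add_zero]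

/-- The relations between the images of the basis tensors under a map that vanishes on the images
of the Specht modules force the map to vanish. -/
lemma eq_zero_of_relations {N : ℕ} {M : Type*} [AddCommGroup M] [Module ℂ M] (hN : 4 ≤ N)
    (E : Fin N → Fin N → M) (h1 : ∑ a, E a a = 0) (h2 : ∑ a, ∑ b, E a b = 0)
    (h3 : ∀ a b, a ≠ b → E a a = E b b) (h4 : ∀ a b, a ≠ b → ∑ c, E a c = ∑ c, E b c)
    (h5 : ∀ a b, a ≠ b → ∑ c, E c a = ∑ c, E c b)
    (h6 : ∀ a b c, ![a, b, c].Injective →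
      E a b - E b a + (E b c - E c b) + (E c a - E a c) = 0)
    (h7 : ∀ a b c d, ![a, b, c, d].Injective →
      (E a c + E c a) - (E a d + E d a) - (E b c + E c b) + (E b d + E d b) = 0)
    (a b : Fin N) : E a b = 0 := by
  have hE : ∀ a, E a a = 0 := eq_zero_of_sum_single_one (by omega) _ h1 h3
  have hR : ∀ a, ∑ c, E a c = 0 := eq_zero_of_sum_single_one (by omega) _ h2 h4
  have hC : ∀ a, ∑ c, E c a = 0 :=
    eq_zero_of_sum_single_one (by omega) _ (by rw [Finset.sum_comm]; exact h2) h5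
  rcases eq_or_ne a b with rfl | hab
  · exact hE a
  have hN0 : (N : ℂ) ≠ 0 := by exact_mod_cast (by omega : N ≠ 0)
  have hA : E a b - E b a = 0 := by
    -- Averaging the cyclic relation over `c` removes all terms involving `c`, because row and
    -- column sums vanish; for `c = a` or `c = b` the relation holds trivially, the diagonal being
    -- zero.
    have h : ∑ c, (E a b - E b a + (E b c - E c b) + (E c a - E a c)) = 0 := by
      refine Finset.sum_eq_zero fun c _ => ?_
      rcases eq_or_ne c a with rfl | hca
      · simp [hE]
      rcases eq_or_ne c b with rfl | hcb
      · simp [hE]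
      · exact h6 a b c (by
          intro i j
          fin_cases i <;> fin_cases j <;> simp [hab, hab.symm, hca, hca.symm, hcb, hcb.symm])
    simp only [Finset.sum_add_distrib, Finset.sum_sub_distrib, hR, hC, Finset.sum_const,
      Finset.card_univ, Fintype.card_fin, ← Nat.cast_smul_eq_nsmul ℂ, sub_zero, add_zero] at h
    rw [← smul_sub] at h
    exact (smul_eq_zero.1 h).resolve_left hN0
  have hS : E a b + E b a = 0 := by
    let S : Fin N → Fin N → M := fun i j => E i j + E j i
    have hSs : ∀ i j, S i j = S j i := fun i j => add_comm _ _
    have hS0 : ∀ i, S i i = 0 := fun i => by simp [S, hE]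
    have hSR : ∀ i, ∑ j, S i j = 0 := fun i => by simp [S, Finset.sum_add_distrib, hR, hC]
    have hSC : ∀ i, ∑ j, S j i = 0 := fun i => by simp [S, Finset.sum_add_distrib, hR, hC]
    -- The relation for four distinct points is extended to all `c` and `d`; the right-hand side
    -- records the failures at `c = d`, `c = b`, `d = a`, with the overlap of the last two
    -- subtracted. The cases `c = a` and `d = b` are trivial.
    have key : ∀ c d, S a b - S a d - S c b + S c d =
        (if c = d then S a b - S a c - S c b else 0) + (if c = b then S a b - S a d + S b d else 0)
        + (if d = a then S a b - S c b + S c a else 0)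
        - (if c = b then if d = a then (2 : ℂ) • S a b else 0 else 0) := by
      intro c d
      by_cases hcd : c = d
      · subst hcd
        by_cases hcb : c = b
        · subst hcb; simp [hab.symm, hS0]
        · by_cases hca : c = a
          · subst hca; simp [hab, hS0]
          · simp [hcb, hca, hS0]
      · by_cases hcb : c = b
        · subst hcb
          by_cases hda : d = a
          · subst hda; simp [hab.symm, hS0, hSs c d]; module
          · simp [hcd, hda, hS0]
        · by_cases hda : d = a
          · subst hda; simp [hcd, hcb, hS0]
          · simp only [hcd, hcb, hda, if_false, add_zero, sub_zero]
            by_cases hca : c = a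
            · subst hca; simp
            · by_cases hdb : d = b
              · subst hdb; simp
              · exact h7 a c b d (by
                  intro i j
                  fin_cases i <;> fin_cases j <;>
                    simp [hab, hcd, hcb, hda, hca, hdb, Ne.symm hab, Ne.symm hcd, Ne.symm hcb,
                      Ne.symm hda, Ne.symm hca, Ne.symm hdb])
    have hsum := Finset.sum_congr (rfl : (Finset.univ : Finset (Fin N)) = Finset.univ) fun c _ =>
      Finset.sum_congr (rfl : (Finset.univ : Finset (Fin N)) = Finset.univ) fun d _ => key c d
    simp only [Finset.sum_add_distrib, Finset.sum_sub_distrib, hSR, hSC, Finset.sum_const,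
      Finset.card_univ, Fintype.card_fin, ← Nat.cast_smul_eq_nsmul ℂ, sub_zero, add_zero,
      Finset.sum_ite_eq, Finset.sum_ite_eq', Finset.mem_univ, if_true, Finset.sum_ite_irrel,
      ← Finset.smul_sum, smul_zero] at hsum
    -- Summing `key` over `c` and `d` gives N² S = 3N S - 2S for S = `S a b`, whence this factor.
    have hz : (((N : ℂ) - 1) * (N - 2)) • S a b = 0 := by
      have e : (((N : ℂ) - 1) * (N - 2)) • S a b = (N : ℂ) • (N : ℂ) • S a b -
        ((N : ℂ) • S a b + (N : ℂ) • S a b + (N : ℂ) • S a b - (2 : ℂ) • S a b) := by module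
      rw [e, hsum]
      simp
    refine (smul_eq_zero.1 hz).resolve_left (mul_ne_zero ?_ ?_)
    · rw [sub_ne_zero]; exact_mod_cast (by omega : N ≠ 1)
    · rw [sub_ne_zero]; exact_mod_cast (by omega : N ≠ 2)
  have e : E a b = (2⁻¹ : ℂ) • (E a b - E b a) + (2⁻¹ : ℂ) • (E a b + E b a) := by module
  rw [e, hA, hS]
  simp

lemma linearTensor_left {N : ℕ} (x : Fin N → ℂ) (p q : Fin N) :
    linearTensor N 1 1 0 x ![p, q] = x p := by
  rw [linearTensor_apply]
  split_ifs with h <;> simp [h]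

lemma linearTensor_right {N : ℕ} (x : Fin N → ℂ) (p q : Fin N) :
    linearTensor N 1 0 1 x ![p, q] = x q := by
  rw [linearTensor_apply]
  split_ifs with h <;> simp

/-- The seven relations for `eq_zero_of_relations` come from the two invariant tensors, the three
embeddings of the standard representation (diagonal, left factor, right factor), and one embedding
each of the Specht modules of [N-2,1,1] and [N-2,2]. -/
lemma eq_zero_of_irrep_two {m : ℕ} (x : PartitionAlgebra 2 (m + 4))
    (h : ∀ ρ ∈ labels (m + 4) 2, irrep 2 (m + 4) ρ x = 0) : act 2 (m + 4) x = 0 := by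
  have hv : ∀ ρ ∈ labels (m + 4) 2, ∀ (φ : Irrep 2 (m + 4) ρ) v, act 2 (m + 4) x (φ v) = 0 := by
    intro ρ hρ φ v
    rw [← irrep_apply, h ρ hρ]; rfl
  have h0 := fun α β => hv _ (mem_labels_two.2 (.inl rfl)) (rowIntertwiner _ α β _)
    ⟨1, one_mem_specht _⟩
  have h1 := fun α β γ a b hab => hv _ (mem_labels_two.2 (.inr (.inl rfl)))
    (hookIntertwiner _ α β γ _) ⟨_, X_sub_X_mem_specht (a := a) (b := b) hab⟩
  have h2 := fun a b c d hi => hv _ (mem_labels_two.2 (.inr (.inr (.inl rfl))))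
    (quadIntertwiner _ 1 _) ⟨_, twoTwo_mem_specht (a := a) (b := b) (c := c) (d := d) hi⟩
  have h3 := fun a b c hi => hv _ (mem_labels_two.2 (.inr (.inr (.inr rfl))))
    (quadIntertwiner _ 2 _) ⟨_, vandermonde_mem_specht (a := a) (b := b) (c := c) hi⟩
  simp only [rowIntertwiner_apply, hookIntertwiner_apply, quadIntertwiner_apply,
    linearCoeffs_X_sub_X, coeff_zero_one, one_smul] at h0 h1 h2 h3
  generalize act 2 (m + 4) x = D at *
  refine LinearMap.ext fun w => ?_
  rw [map_tensor_two D]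
  simp_rw [map_tensor_two D (constTensor _ _ _), constTensor_apply] at h0
  simp_rw [map_tensor_two D (linearTensor _ _ _ _ _)] at h1
  simp_rw [map_tensor_two D (quadCoeffs _ _ _), quadCoeffs_twoTwo] at h2
  simp_rw [map_tensor_two D (quadCoeffs _ _ _), quadCoeffs_vandermonde] at h3
  simp only [LinearMap.zero_apply]
  refine Finset.sum_eq_zero fun a _ => Finset.sum_eq_zero fun b _ => ?_
  rw [eq_zero_of_relations (by omega) (fun a b => D (Pi.single ![a, b] 1))
    ?_ ?_ ?_ ?_ ?_ ?_ ?_ a b, smul_zero]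
  · simpa using h0 1 0
  · simpa using h0 1 1
  · intro a b hab
    simpa [linearTensor_apply, Pi.single_apply, sub_smul, sub_eq_zero] using h1 1 0 0 a b hab
  · intro a b hab
    simpa [linearTensor_left, Pi.single_apply, sub_smul, sub_eq_zero] using h1 1 1 0 a b hab
  · intro a b hab
    simpa [linearTensor_right, Pi.single_apply, sub_smul, sub_eq_zero] using h1 1 0 1 a b hab
  · intro a b c hi
    have := h3 a b c hi
    simp only [add_smul, sub_smul, Finset.sum_add_distrib, Finset.sum_sub_distrib,
      sum_sum_ite_and] at this
    exact this
  · intro a b c d hi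
    have := h2 a b c d hi
    have hac : a ≠ c := hi.ne (show (0 : Fin 4) ≠ 2 by decide)
    have had : a ≠ d := hi.ne (show (0 : Fin 4) ≠ 3 by decide)
    have hbc : b ≠ c := hi.ne (show (1 : Fin 4) ≠ 2 by decide)
    have hbd : b ≠ d := hi.ne (show (1 : Fin 4) ≠ 3 by decide)
    simp only [add_smul, sub_smul, Finset.sum_add_distrib, Finset.sum_sub_distrib,
      sum_sum_ite_or _ hac, sum_sum_ite_or _ had, sum_sum_ite_or _ hbc, sum_sum_ite_or _ hbd]
      at this
    exact this

/-! ### Lagrange interpolation -/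

section Lagrange

variable {A : Type*} [Ring A] [Algebra ℂ A]

lemma map_lagrangeProd {B : Type*} [Ring B] [Algebra ℂ B] (f : A →ₐ[ℂ] B) (s : Finset YoungDiagram)
    (χ : YoungDiagram → ℂ) (μ : YoungDiagram) (z : A) :
    f (lagrangeProd s χ μ z) = lagrangeProd s χ μ (f z) :=
  (Polynomial.aeval_algHom_apply f z _).symm

lemma coe_lagrangeProd (S : Subalgebra ℂ A) (s : Finset YoungDiagram) (χ : YoungDiagram → ℂ)
    (μ : YoungDiagram) (z : S) :
    ((lagrangeProd s χ μ z : S) : A) = lagrangeProd s χ μ (z : A) :=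
  map_lagrangeProd S.val s χ μ z

variable {V : Type*} [AddCommMonoid V] [Module ℂ V]

/-- Stated for a single eigenvector, because in the modules of P_2(N) the elements Z₁ and Z_{3/2}
are diagonalizable but need not be scalars. -/
lemma map_aeval_apply (f : A →ₐ[ℂ] Module.End ℂ V) {z : A} {v : V} {c : ℂ} (h : f z v = c • v)
    (p : Polynomial ℂ) : f (Polynomial.aeval z p) v = p.eval c • v := by
  induction p using Polynomial.induction_on' with
  | add p q hp hq => simp only [map_add, LinearMap.add_apply, hp, hq, Polynomial.eval_add, add_smul]
  | monomial k a =>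
    have hk : ∀ k : ℕ, (f z ^ k) v = c ^ k • v := by
      intro k
      induction k with
      | zero => simp
      | succ k ih => rw [pow_succ, Module.End.mul_apply, h, map_smul, ih, smul_smul, pow_succ']
    rw [Polynomial.aeval_monomial, map_mul, map_pow, AlgHom.commutes, Module.End.mul_apply, hk,
      Module.algebraMap_end_apply, smul_smul, Polynomial.eval_monomial]

open Classical in
lemma map_lagrangeProd_apply (f : A →ₐ[ℂ] Module.End ℂ V) {z : A} {v : V} {s : Finset YoungDiagram}
    {χ : YoungDiagram → ℂ} (hχ : Set.InjOn χ s) {μ ρ : YoungDiagram}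
    (hμ : μ ∈ s) (hρ : ρ ∈ s) (h : f z v = χ ρ • v) :
    f (lagrangeProd s χ μ z) v = if ρ = μ then v else 0 := by
  rw [lagrangeProd, map_aeval_apply f h, Polynomial.eval_prod]
  simp only [Polynomial.eval_mul, Polynomial.eval_C, Polynomial.eval_sub, Polynomial.eval_X]
  split_ifs with hρμ
  · subst hρμ
    rw [Finset.prod_eq_one, one_smul]
    intro τ hτ
    have : χ ρ - χ τ ≠ 0 := by
      rw [sub_ne_zero]
      exact fun e => (Finset.ne_of_mem_erase hτ) (hχ hρ (Finset.mem_of_mem_erase hτ) e).symm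
    exact inv_mul_cancel₀ this
  · rw [Finset.prod_eq_zero (Finset.mem_erase.2 ⟨hρμ, hρ⟩) (by simp), zero_smul]

open Classical in
lemma map_lagrangeProd_eq (f : A →ₐ[ℂ] Module.End ℂ V) {z : A} {s : Finset YoungDiagram}
    {χ : YoungDiagram → ℂ} (hχ : Set.InjOn χ s) {μ ρ : YoungDiagram}
    (hμ : μ ∈ s) (hρ : ρ ∈ s) (h : f z = χ ρ • 1) :
    f (lagrangeProd s χ μ z) = if ρ = μ then 1 else 0 := by
  refine LinearMap.ext fun v => ?_
  rw [map_lagrangeProd_apply f hχ hμ hρ (v := v) (by rw [h]; rfl)]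
  split_ifs <;> rfl

end Lagrange

/-! ### Normalized characters -/

lemma nontrivial_of_apply_ne_zero {n : ℕ} {V W : Type*} [AddCommGroup V] [Module ℂ V]
    [AddCommGroup W] [Module ℂ W] {ρ : Representation ℂ (Equiv.Perm (Fin n)) V}
    {τ : Representation ℂ (Equiv.Perm (Fin n)) W} (f : Representation.IntertwiningMap ρ τ) (v : V)
    (h : f v ≠ 0) : Nontrivial (Representation.IntertwiningMap ρ τ) :=
  ⟨f, 0, fun e => h (by rw [e]; rfl)⟩

lemma nontrivial_irrep_one {N : ℕ} (hN : 2 ≤ N) {ρ : YoungDiagram} (hρ : ρ ∈ labels N 1) :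
    Nontrivial (Irrep 1 N ρ) := by
  obtain ⟨m, rfl⟩ := Nat.exists_eq_add_of_le' hN
  rcases mem_labels_one.1 hρ with rfl | rfl
  · refine nontrivial_of_apply_ne_zero (rowIntertwinerOne _ _) ⟨1, one_mem_specht _⟩ fun h => ?_
    have := congrFun h ![0]
    simp [rowIntertwinerOne_apply] at this
  · refine nontrivial_of_apply_ne_zero (hookIntertwinerOne _ _)
      ⟨_, X_sub_X_mem_specht (a := 0) (b := 1) (by simp)⟩ fun h => ?_
    have := congrFun h ![0]
    simp [hookIntertwinerOne_apply, linearCoeffs_X_sub_X, LinearMap.funLeft_apply] at this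

lemma nontrivial_irrepHalf {n : ℕ} (hn : 2 ≤ n) {ρ : YoungDiagram} (hρ : ρ ∈ labels n 1) :
    Nontrivial (IrrepHalf 1 n ρ) := by
  obtain ⟨m, rfl⟩ := Nat.exists_eq_add_of_le' hn
  rcases mem_labels_one.1 hρ with rfl | rfl
  · refine nontrivial_of_apply_ne_zero (rowIntertwinerHalf _ 1 1 _) ⟨1, one_mem_specht _⟩
      fun h => ?_
    have := congrFun h ![Fin.last _]
    simp [rowIntertwinerHalf_apply, lastTensor_apply] at this
  · refine nontrivial_of_apply_ne_zero (hookIntertwinerHalf _ _)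
      ⟨_, X_sub_X_mem_specht (a := 0) (b := 1) (by simp)⟩ fun h => ?_
    have := congrFun h ![Fin.castSucc 0]
    rw [hookIntertwinerHalf_apply, linearCoeffs_X_sub_X, snocZero_apply, Fin.snoc_castSucc] at this
    simp at this

lemma nontrivial_irrep_two {N : ℕ} (hN : 4 ≤ N) {ρ : YoungDiagram} (hρ : ρ ∈ labels N 2) :
    Nontrivial (Irrep 2 N ρ) := by
  obtain ⟨m, rfl⟩ := Nat.exists_eq_add_of_le' hN
  obtain ⟨c, hc⟩ : ∃ c : Fin 4 → Fin (m + 4), Function.Injective c := ⟨_, Fin.castLE_injective hN⟩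
  rcases mem_labels_two.1 hρ with rfl | rfl | rfl | rfl
  · refine nontrivial_of_apply_ne_zero (rowIntertwiner _ 1 1 _) ⟨1, one_mem_specht _⟩ fun h => ?_
    have := congrFun h ![0, 0]
    simp [rowIntertwiner_apply, constTensor_apply] at this
  · refine nontrivial_of_apply_ne_zero (hookIntertwiner _ 1 0 1 _)
      ⟨_, X_sub_X_mem_specht (a := 0) (b := 1) (by simp)⟩ fun h => ?_
    have := congrFun h ![0, 0]
    simp [hookIntertwiner_apply, linearCoeffs_X_sub_X, linearTensor_apply] at this
  · refine nontrivial_of_apply_ne_zero (quadIntertwiner _ 1 _)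
      ⟨_, twoTwo_mem_specht (a := c 0) (b := c 1) (c := c 2)
        (d := c 3) (by
          convert hc using 1
          funext i; fin_cases i <;> rfl)⟩ fun h => ?_
    have := congrFun h ![c 0, c 2]
    rw [quadIntertwiner_apply, quadCoeffs_twoTwo] at this
    simp [hc.eq_iff] at this
  · refine nontrivial_of_apply_ne_zero (quadIntertwiner _ 2 _)
      ⟨_, vandermonde_mem_specht (m := m + 1) (a := c 0) (b := c 1)
        (c := c 2) (by
          convert hc.comp (Fin.castSucc_injective 3) using 1
          funext i; fin_cases i <;> rfl)⟩ fun h => ?_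
    have := congrFun h ![c 0, c 1]
    rw [quadIntertwiner_apply, quadCoeffs_vandermonde] at this
    simp [hc.eq_iff] at this

section

variable {N : ℕ} {ρ : YoungDiagram}

lemma transpositionSum_one (hN : 2 ≤ N) (hρ : ρ ∈ labels N 1) :
    transpositionSum (spechtRep N ρ) = (contentSum ρ : ℂ) • 1 := by
  obtain ⟨m, rfl⟩ := Nat.exists_eq_add_of_le' hN
  exact transpositionSum_eq_contentSum_one hρ

lemma transpositionSum_two (hN : 4 ≤ N) (hρ : ρ ∈ labels N 2) :
    transpositionSum (spechtRep N ρ) = (contentSum ρ : ℂ) • 1 := by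
  obtain ⟨m, rfl⟩ := Nat.exists_eq_add_of_le' hN
  exact transpositionSum_eq_contentSum_two hρ

lemma nchar_Z₁ (hN : 2 ≤ N) (hρ : ρ ∈ labels N 1) :
    nchar (Z₁ N) ρ = contentSum ρ - ((N.choose 2 : ℂ) - N) :=
  have := nontrivial_irrep_one hN hρ
  nchar_eq (irrep_eq_smul_one (act_Z₁_eq N) (transpositionSum_one hN hρ))

lemma irrep_Z₁ (hN : 2 ≤ N) (hρ : ρ ∈ labels N 1) :
    irrep 1 N ρ (Z₁ N) = nchar (Z₁ N) ρ • 1 := by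
  rw [nchar_Z₁ hN hρ]
  exact irrep_eq_smul_one (act_Z₁_eq N) (transpositionSum_one hN hρ)

lemma nchar_Z₂ (hN : 4 ≤ N) (hρ : ρ ∈ labels N 2) :
    nchar (Z₂ N) ρ = contentSum ρ - ((N.choose 2 : ℂ) - 2 * N) :=
  have := nontrivial_irrep_two hN hρ
  nchar_eq (irrep_eq_smul_one (act_Z₂_eq N) (transpositionSum_two hN hρ))

lemma irrep_Z₂ (hN : 4 ≤ N) (hρ : ρ ∈ labels N 2) :
    irrep 2 N ρ (Z₂ N) = nchar (Z₂ N) ρ • 1 := by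
  rw [nchar_Z₂ hN hρ]
  exact irrep_eq_smul_one (act_Z₂_eq N) (transpositionSum_two hN hρ)

variable {n : ℕ}

lemma ncharHalf_Z₃₂ (hn : 2 ≤ n) (hρ : ρ ∈ labels n 1) :
    ncharHalf (k := 1) (n := n) (Z₃₂ (n + 1)) ρ =
      contentSum ρ - (((n + 1).choose 2 : ℂ) - 2 * (n + 1) + 1) :=
  have := nontrivial_irrepHalf hn hρ
  ncharHalf_eq (irrepHalf_eq_smul_one (schurWeylHalf_Z₃₂_eq n) (transpositionSum_one hn hρ))

lemma irrepHalf_Z₃₂ (hn : 2 ≤ n) (hρ : ρ ∈ labels n 1) :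
    irrepHalf 1 n ρ (Z₃₂ (n + 1)) = ncharHalf (k := 1) (n := n) (Z₃₂ (n + 1)) ρ • 1 := by
  rw [ncharHalf_Z₃₂ hn hρ]
  exact irrepHalf_eq_smul_one (schurWeylHalf_Z₃₂_eq n) (transpositionSum_one hn hρ)

end

lemma contentSum_injOn_one {N : ℕ} (hN : 2 ≤ N) :
    Set.InjOn (fun ρ => (contentSum ρ : ℂ)) (labels N 1) := by
  obtain ⟨m, rfl⟩ := Nat.exists_eq_add_of_le' hN
  have h : (contentSum (rowShape (m + 2)) : ℂ) ≠ contentSum (hookShape m) := by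
    rw [contentSum_threeRows, contentSum_threeRows, ← sub_ne_zero]
    have : ((m + 2 : ℕ) : ℂ) ≠ 0 := Nat.cast_ne_zero.2 (by omega)
    convert this using 1
    push_cast; ring
  intro ρ hρ τ hτ e
  rcases mem_labels_one.1 hρ with rfl | rfl <;> rcases mem_labels_one.1 hτ with rfl | rfl
  · rfl
  · exact absurd e h
  · exact absurd e.symm h
  · rfl

lemma contentSum_injOn_two {N : ℕ} (hN : 4 ≤ N) :
    Set.InjOn (fun ρ => (contentSum ρ : ℂ)) (labels N 2) := by
  obtain ⟨m, rfl⟩ := Nat.exists_eq_add_of_le' hN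
  -- The six differences of content sums are N, 2N - 2, 2N, N - 2, N and 2, all nonzero for N ≥ 4.
  have key : ∀ (k : ℕ) (a b : ℂ), k ≠ 0 → a - b = k → a ≠ b := by
    intro k a b hk h e
    rw [e, sub_self] at h
    exact hk (by exact_mod_cast h.symm)
  have h12 : (contentSum (rowShape (m + 4)) : ℂ) ≠ contentSum (hookShape (m + 2)) :=
    key (m + 4) _ _ (by omega) (by
      rw [contentSum_threeRows, contentSum_threeRows]; push_cast; ring)
  have h13 : (contentSum (rowShape (m + 4)) : ℂ) ≠ contentSum (twoTwoShape m) :=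
    key (m + 4 + (m + 2)) _ _ (by omega) (by
      rw [contentSum_threeRows, contentSum_threeRows]; push_cast; ring)
  have h14 : (contentSum (rowShape (m + 4)) : ℂ) ≠ contentSum (longHookShape (m + 1)) :=
    key (m + 4 + (m + 4)) _ _ (by omega) (by
      rw [contentSum_threeRows, contentSum_threeRows]; push_cast; ring)
  have h23 : (contentSum (hookShape (m + 2)) : ℂ) ≠ contentSum (twoTwoShape m) :=
    key (m + 2) _ _ (by omega) (by
      rw [contentSum_threeRows, contentSum_threeRows]; push_cast; ring)
  have h24 : (contentSum (hookShape (m + 2)) : ℂ) ≠ contentSum (longHookShape (m + 1)) :=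
    key (m + 4) _ _ (by omega) (by
      rw [contentSum_threeRows, contentSum_threeRows]; push_cast; ring)
  have h34 : (contentSum (twoTwoShape m) : ℂ) ≠ contentSum (longHookShape (m + 1)) :=
    key 2 _ _ (by omega) (by
      rw [contentSum_threeRows, contentSum_threeRows]; push_cast; ring)
  intro ρ hρ τ hτ e
  rcases mem_labels_two.1 hρ with rfl | rfl | rfl | rfl <;>
    rcases mem_labels_two.1 hτ with rfl | rfl | rfl | rfl <;>
    first | rfl | exact absurd e ‹_› | exact absurd e.symm ‹_›

lemma nchar_Z₁_injOn {N : ℕ} (hN : 2 ≤ N) : Set.InjOn (nchar (Z₁ N)) (labels N 1) := by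
  intro ρ hρ τ hτ e
  rw [nchar_Z₁ hN hρ, nchar_Z₁ hN hτ, sub_left_inj] at e
  exact contentSum_injOn_one hN hρ hτ e

lemma ncharHalf_Z₃₂_injOn {n : ℕ} (hn : 2 ≤ n) :
    Set.InjOn (ncharHalf (k := 1) (n := n) (Z₃₂ (n + 1))) (labels n 1) := by
  intro ρ hρ τ hτ e
  rw [ncharHalf_Z₃₂ hn hρ, ncharHalf_Z₃₂ hn hτ, sub_left_inj] at e
  exact contentSum_injOn_one hn hρ hτ e

lemma nchar_Z₂_injOn {N : ℕ} (hN : 4 ≤ N) : Set.InjOn (nchar (Z₂ N)) (labels N 2) := by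
  intro ρ hρ τ hτ e
  rw [nchar_Z₂ hN hρ, nchar_Z₂ hN hτ, sub_left_inj] at e
  exact contentSum_injOn_two hN hρ hτ e

/-! ### The projectors -/

lemma ext_irrep_one {N : ℕ} (hN : 2 ≤ N) {x y : PartitionAlgebra 1 N}
    (h : ∀ ρ ∈ labels N 1, irrep 1 N ρ x = irrep 1 N ρ y) : x = y := by
  obtain ⟨m, rfl⟩ := Nat.exists_eq_add_of_le' hN
  rw [← sub_eq_zero]
  apply act_injective (by omega)
  rw [map_zero]
  exact eq_zero_of_irrep_one _ fun ρ hρ => by rw [map_sub, h ρ hρ, sub_self]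

lemma ext_irrepHalf {n : ℕ} (hn : 3 ≤ n) {x y : PartitionAlgebra 2 (n + 1)}
    (hx : x ∈ halfAlgebra 1 (n + 1)) (hy : y ∈ halfAlgebra 1 (n + 1))
    (h : ∀ ρ ∈ labels n 1, irrepHalf 1 n ρ x = irrepHalf 1 n ρ y) : x = y := by
  obtain ⟨m, rfl⟩ := Nat.exists_eq_add_of_le' (Nat.le_of_succ_le hn)
  rw [← sub_eq_zero]
  apply schurWeylHalf_injOn hn (sub_mem hx hy)
  exact eq_zero_of_irrepHalf _ fun ρ hρ => by rw [map_sub, h ρ hρ, sub_self]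

/-- Joint faithfulness of the multiplicity spaces: it makes the projectors unique and, later, the
block matrix representation injective. -/
lemma ext_irrep_two {N : ℕ} (hN : 4 ≤ N) {x y : PartitionAlgebra 2 N}
    (h : ∀ ρ ∈ labels N 2, irrep 2 N ρ x = irrep 2 N ρ y) : x = y := by
  obtain ⟨m, rfl⟩ := Nat.exists_eq_add_of_le' hN
  rw [← sub_eq_zero]
  apply act_injective (by omega)
  rw [map_zero]
  exact eq_zero_of_irrep_two _ fun ρ hρ => by rw [map_sub, h ρ hρ, sub_self]

lemma isProj_one {N : ℕ} (hN : 2 ≤ N) {μ : YoungDiagram} (hμ : μ ∈ labels N 1) :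
    IsProj 1 N μ (lagrangeProd (labels N 1) (nchar (Z₁ N)) μ (Z₁ N)) := by
  intro ρ hρ
  exact map_lagrangeProd_eq (irrepHom 1 N ρ) (nchar_Z₁_injOn hN) hμ hρ (irrep_Z₁ hN hρ)

lemma isProj_two {N : ℕ} (hN : 4 ≤ N) {μ : YoungDiagram} (hμ : μ ∈ labels N 2) :
    IsProj 2 N μ (lagrangeProd (labels N 2) (nchar (Z₂ N)) μ (Z₂ N)) := by
  intro ρ hρ
  exact map_lagrangeProd_eq (irrepHom 2 N ρ) (nchar_Z₂_injOn hN) hμ hρ (irrep_Z₂ hN hρ)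

lemma isProjHalf {n : ℕ} (hn : 2 ≤ n) {μ : YoungDiagram} (hμ : μ ∈ labels n 1) :
    IsProjHalf 1 n μ (lagrangeProd (labels n 1) (ncharHalf (k := 1) (n := n) (Z₃₂ (n + 1))) μ
      (Z₃₂ (n + 1))) := by
  -- The polynomial is evaluated inside the half-integer subalgebra: this gives membership, and it
  -- is there that `irrepHalf` is multiplicative.
  rw [← coe_lagrangeProd (halfAlgebra 1 (n + 1)) _ _ _ ⟨_, Z₃₂_mem (n + 1)⟩]
  refine ⟨Subtype.property _, fun ρ hρ => ?_⟩
  exact map_lagrangeProd_eq (irrepHalfHom n ρ) (ncharHalf_Z₃₂_injOn hn) hμ hρ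
    (irrepHalf_Z₃₂ hn hρ)

lemma existsUnique_isProj_one {N : ℕ} (hN : 2 ≤ N) {μ : YoungDiagram} (hμ : μ ∈ labels N 1) :
    ∃! p, IsProj 1 N μ p :=
  ⟨_, isProj_one hN hμ, fun p hp => ext_irrep_one hN fun ρ hρ => by
    rw [hp ρ hρ, isProj_one hN hμ ρ hρ]⟩

lemma existsUnique_isProj_two {N : ℕ} (hN : 4 ≤ N) {μ : YoungDiagram} (hμ : μ ∈ labels N 2) :
    ∃! p, IsProj 2 N μ p :=
  ⟨_, isProj_two hN hμ, fun p hp => ext_irrep_two hN fun ρ hρ => by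
    rw [hp ρ hρ, isProj_two hN hμ ρ hρ]⟩

lemma existsUnique_isProjHalf {n : ℕ} (hn : 3 ≤ n) {μ : YoungDiagram} (hμ : μ ∈ labels n 1) :
    ∃! p, IsProjHalf 1 n μ p :=
  have h := isProjHalf (Nat.le_of_succ_le hn) hμ
  ⟨_, h, fun p hp => ext_irrepHalf hn hp.1 h.1 fun ρ hρ => by rw [hp.2 ρ hρ, h.2 ρ hρ]⟩

lemma proj_one_eq {N : ℕ} (hN : 2 ≤ N) {μ : YoungDiagram} (hμ : μ ∈ labels N 1) :
    proj 1 N μ = lagrangeProd (labels N 1) (nchar (Z₁ N)) μ (Z₁ N) :=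
  (existsUnique_isProj_one hN hμ).unique (Classical.epsilon_spec ⟨_, isProj_one hN hμ⟩)
    (isProj_one hN hμ)

lemma proj_two_eq {N : ℕ} (hN : 4 ≤ N) {μ : YoungDiagram} (hμ : μ ∈ labels N 2) :
    proj 2 N μ = lagrangeProd (labels N 2) (nchar (Z₂ N)) μ (Z₂ N) :=
  (existsUnique_isProj_two hN hμ).unique (Classical.epsilon_spec ⟨_, isProj_two hN hμ⟩)
    (isProj_two hN hμ)

lemma projHalf_eq {n : ℕ} (hn : 3 ≤ n) {μ : YoungDiagram} (hμ : μ ∈ labels n 1) :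
    projHalf 1 n μ = lagrangeProd (labels n 1) (ncharHalf (k := 1) (n := n) (Z₃₂ (n + 1))) μ
      (Z₃₂ (n + 1)) :=
  have h := isProjHalf (Nat.le_of_succ_le hn) hμ
  (existsUnique_isProjHalf hn hμ).unique (Classical.epsilon_spec ⟨_, h⟩) h

lemma VacTab.proj_eq {n : ℕ} (hn : 3 ≤ n) (v : VacTab n 2) : v.proj =
    lagrangeProd (labels (n + 1) 1) (nchar (Z₁ (n + 1))) (v.whole 1)
        (addStrand 1 (n + 1) (Z₁ (n + 1))) *
      lagrangeProd (labels n 1) (ncharHalf (k := 1) (n := n) (Z₃₂ (n + 1))) (v.half 1)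
        (Z₃₂ (n + 1)) *
      lagrangeProd (labels (n + 1) 2) (nchar (Z₂ (n + 1))) (v.whole 2) (Z₂ (n + 1)) := by
  rw [VacTab.proj, proj_one_eq (by omega) (v.whole_mem 1), projHalf_eq hn (v.half_mem 1),
    proj_two_eq (by omega) (v.whole_mem 2)]
  congr 2
  -- Adding a strand is an algebra homomorphism, so it carries the polynomial in `Z₁` to the same
  -- polynomial in its image.
  exact map_lagrangeProd (addStrandHom (by omega)) _ _ _ _

/-! ### Matrix units -/

/-- An injective multiplicative map into block diagonal matrices is onto them once the dimension of
A is large enough. The matrix units of the blocks then pull back to A, and compressing between `p v`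
and `p w` extracts a single matrix entry. -/
lemma exists_matrixUnits {A ι S : Type*} [Ring A] [Algebra ℂ A] [Module.Finite ℂ A] [Fintype ι]
    [DecidableEq ι] (sh : ι → S) (p : ι → A) (M : A →ₗ[ℂ] Matrix ι ι ℂ)
    (hinj : Function.Injective M) (hmul : ∀ x y, M (x * y) = M x * M y)
    (hblock : ∀ x v w, sh v ≠ sh w → M x v w = 0) (hp : ∀ v, M (p v) = Matrix.single v v 1)
    (hdim : Nat.card {x : ι × ι // sh x.1 = sh x.2} ≤ Module.finrank ℂ A) :
    ∃ Q : ι → ι → A,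
      (∀ v w, sh v = sh w →
        Module.finrank ℂ (LinearMap.range (sandwich (p v) (p w))) = 1 ∧
        LinearMap.range (sandwich (p v) (p w)) = Submodule.span ℂ {Q v w}) ∧
      (∀ v w v' w', sh v = sh w → sh v' = sh w' →
        (w = v' → Q v w * Q v' w' = Q v w') ∧ (w ≠ v' → Q v w * Q v' w' = 0)) ∧
      LinearIndependent ℂ (fun x : {x : ι × ι // sh x.1 = sh x.2} => Q x.1.1 x.1.2) ∧
      Submodule.span ℂ (Set.range
        (fun x : {x : ι × ι // sh x.1 = sh x.2} => Q x.1.1 x.1.2)) = ⊤ := by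
  classical
  let L : A →ₗ[ℂ] ({x : ι × ι // sh x.1 = sh x.2} → ℂ) :=
    LinearMap.pi fun x => Matrix.entryLinearMap ℂ ℂ x.1.1 x.1.2 ∘ₗ M
  have hL : ∀ y x, L y x = M y x.1.1 x.1.2 := fun _ _ => rfl
  have hLinj : Function.Injective L := by
    intro x y e
    refine hinj (Matrix.ext fun v w => ?_)
    by_cases h : sh v = sh w
    · exact congrFun e ⟨(v, w), h⟩
    · rw [hblock x v w h, hblock y v w h]
  have hcard : Module.finrank ℂ ({x : ι × ι // sh x.1 = sh x.2} → ℂ) =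
      Nat.card {x : ι × ι // sh x.1 = sh x.2} := by
    rw [Module.finrank_fintype_fun_eq_card, Nat.card_eq_fintype_card]
  -- Only a lower bound on the dimension of A is required, since injectivity supplies the upper one.
  let E := LinearEquiv.ofInjectiveOfFinrankEq L hLinj
    (le_antisymm (LinearMap.finrank_le_finrank_of_injective hLinj) (hcard.trans_le hdim))
  have hE : ∀ y, E y = L y := fun y => rfl
  have hsingle : ∀ v w, sh v = sh w → ∃ y, M y = Matrix.single v w 1 := by
    intro v w h
    refine ⟨E.symm (Pi.single ⟨(v, w), h⟩ 1), Matrix.ext fun i j => ?_⟩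
    by_cases hij : sh i = sh j
    · have := congrFun (E.apply_symm_apply (Pi.single ⟨(v, w), h⟩ 1)) ⟨(i, j), hij⟩
      rw [hE, hL] at this
      rw [this, Pi.single_apply, Matrix.single_apply]
      simp [Subtype.ext_iff, Prod.ext_iff, eq_comm]
    · rw [hblock _ _ _ hij, Matrix.single_apply_of_ne]
      rintro ⟨rfl, rfl⟩
      exact hij h
  have hQ : ∃ Q : ι → ι → A, ∀ v w, sh v = sh w → M (Q v w) = Matrix.single v w 1 := by
    choose Q hQ using hsingle
    -- Pairs from different blocks get the default value 0; no claim concerns them.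
    exact ⟨fun v w => if h : sh v = sh w then Q v w h else 0, fun v w h => by
      simp only [dif_pos h, hQ]⟩
  obtain ⟨Q, hQ⟩ := hQ
  -- This is E_vv M E_ww = M_vw E_vw, transported back through the injection.
  have hsand : ∀ v w, sh v = sh w → ∀ d, sandwich (p v) (p w) d = M d v w • Q v w := by
    intro v w h d
    apply hinj
    change M (p v * (d * p w)) = _
    rw [hmul, hmul, hp, hp, map_smul, hQ v w h, ← mul_assoc, Matrix.single_mul_mul_single]
    simp [Matrix.smul_single]
  have hne : ∀ v w, sh v = sh w → Q v w ≠ 0 := by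
    intro v w h e
    have := hQ v w h
    rw [e, map_zero] at this
    have := congrFun (congrFun this v) w
    simp at this
  have hrange : ∀ v w, sh v = sh w →
      LinearMap.range (sandwich (p v) (p w)) = Submodule.span ℂ {Q v w} := by
    intro v w h
    apply le_antisymm
    · rintro _ ⟨d, rfl⟩
      rw [hsand v w h]
      exact Submodule.smul_mem _ _ (Submodule.mem_span_singleton_self _)
    · rw [Submodule.span_singleton_le_iff_mem]
      refine ⟨Q v w, ?_⟩
      rw [hsand v w h, hQ v w h]
      simp
  have hbasis : (fun x : {x : ι × ι // sh x.1 = sh x.2} => Q x.1.1 x.1.2) =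
      (Module.Basis.ofEquivFun E) := by
    funext x
    apply E.injective
    funext y
    rw [Module.Basis.coe_ofEquivFun, E.apply_symm_apply, hE, hL, hQ _ _ x.2, Pi.single_apply,
      Matrix.single_apply]
    simp [Subtype.ext_iff, Prod.ext_iff, eq_comm]
  refine ⟨Q, fun v w h => ⟨?_, hrange v w h⟩, fun v w v' w' h h' => ⟨?_, ?_⟩, ?_, ?_⟩
  · rw [hrange v w h, finrank_span_singleton (hne v w h)]
  · rintro rfl
    apply hinj
    rw [hmul, hQ _ _ h, hQ _ _ h', hQ _ _ (h.trans h'), Matrix.single_mul_single_same, mul_one]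
  · intro hw
    apply hinj
    rw [hmul, hQ _ _ h, hQ _ _ h', Matrix.single_mul_single_of_ne _ _ _ _ hw, map_zero]
  · rw [hbasis]; exact (Module.Basis.ofEquivFun E).linearIndependent
  · rw [hbasis]; exact (Module.Basis.ofEquivFun E).span_eq

/-! ### The number of diagrams -/

lemma finrank_partitionAlgebra (k N : ℕ) :
    Module.finrank ℂ (PartitionAlgebra k N) = Fintype.card (Diagram k) :=
  Module.finrank_finsupp_self ℂ

instance (k N : ℕ) : Module.Finite ℂ (PartitionAlgebra k N) :=
  inferInstanceAs (Module.Finite ℂ (Diagram k →₀ ℂ))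

lemma card_diagram_two : 15 ≤ Fintype.card (Diagram 2) := by
  -- The labellings are the restricted growth strings 0000, 0001, ..., 0123 in lexicographic order,
  -- one for each set partition of four points.
  let l : Fin 15 → Fin 2 ⊕ Fin 2 → Fin 4 := fun i => Sum.elim
    (![![0, 0], ![0, 0], ![0, 0], ![0, 0], ![0, 0], ![0, 1], ![0, 1], ![0, 1], ![0, 1], ![0, 1],
      ![0, 1], ![0, 1], ![0, 1], ![0, 1], ![0, 1]] i)
    (![![0, 0], ![0, 1], ![1, 0], ![1, 1], ![1, 2], ![0, 0], ![0, 1], ![0, 2], ![1, 0], ![1, 1],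
      ![1, 2], ![2, 0], ![2, 1], ![2, 2], ![2, 3]] i)
  have h : Function.Injective fun i => (Setoid.ker (l i) : Diagram 2) := by
    have key : ∀ i j, (∀ x y, l i x = l i y ↔ l j x = l j y) → i = j := by decide
    exact fun i j e => key i j fun x y => by
      rw [← Setoid.ker_def (f := l i), ← Setoid.ker_def (f := l j)]
      exact iff_of_eq (congrArg (fun s : Diagram 2 => s x y) e)
  simpa using Fintype.card_le_of_injective _ h

/-! ### The vacillating tableaux of length two -/

/-- The partitions `λ^(1)` of the seven vacillating tableaux of length two. -/
noncomputable def tabOne (m : ℕ) : Fin 7 → YoungDiagram :=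
  ![rowShape (m + 4), hookShape (m + 2), rowShape (m + 4), hookShape (m + 2), hookShape (m + 2),
    hookShape (m + 2), hookShape (m + 2)]

/-- The partitions `λ^(3/2)` of the seven vacillating tableaux of length two. -/
noncomputable def tabHalf (m : ℕ) : Fin 7 → YoungDiagram :=
  ![rowShape (m + 3), rowShape (m + 3), rowShape (m + 3), rowShape (m + 3), hookShape (m + 1),
    hookShape (m + 1), hookShape (m + 1)]

/-- The four shapes of vacillating tableaux of length two. -/
noncomputable def shapes (m : ℕ) : Fin 4 → YoungDiagram :=
  ![rowShape (m + 4), hookShape (m + 2), twoTwoShape m, longHookShape (m + 1)]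

/-- The indices of the shapes of the seven vacillating tableaux of length two. -/
def shapeIdx : Fin 7 → Fin 4 := ![0, 0, 1, 1, 1, 2, 3]

lemma shapes_injective (m : ℕ) : Function.Injective (shapes m) := by
  intro i j h
  fin_cases i <;> fin_cases j <;> first | rfl | (simp [shapes, threeRows_inj] at h)

lemma shapes_mem (m : ℕ) (i : Fin 4) : shapes m i ∈ labels (m + 4) 2 := by
  rw [mem_labels_two]
  fin_cases i <;> simp [shapes]

lemma exists_shapes_eq {m : ℕ} {μ : YoungDiagram} (h : μ ∈ labels (m + 4) 2) :
    ∃ i, μ = shapes m i := by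
  rcases mem_labels_two.1 h with rfl | rfl | rfl | rfl
  exacts [⟨0, rfl⟩, ⟨1, rfl⟩, ⟨2, rfl⟩, ⟨3, rfl⟩]

lemma tabOne_mem (m : ℕ) (i : Fin 7) : tabOne m i ∈ labels (m + 4) 1 := by
  rw [mem_labels_one]
  fin_cases i <;> simp [tabOne]

lemma tabHalf_mem (m : ℕ) (i : Fin 7) : tabHalf m i ∈ labels (m + 3) 1 := by
  rw [mem_labels_one]
  fin_cases i <;> simp [tabHalf]

lemma rowShape_le_rowShape (m : ℕ) : rowShape (m + 3) ≤ rowShape (m + 4) := by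
  rw [threeRows_le_iff]; omega

lemma rowShape_le_hookShape (m : ℕ) : rowShape (m + 3) ≤ hookShape (m + 2) := by
  rw [threeRows_le_iff]; omega

lemma hookShape_le_hookShape (m : ℕ) : hookShape (m + 1) ≤ hookShape (m + 2) := by
  rw [threeRows_le_iff]; omega

lemma hookShape_le_twoTwoShape (m : ℕ) : hookShape (m + 1) ≤ twoTwoShape m := by
  rw [threeRows_le_iff]; omega

lemma hookShape_le_longHookShape (m : ℕ) : hookShape (m + 1) ≤ longHookShape (m + 1) := by
  rw [threeRows_le_iff]; omega

lemma rowShape_le_tabOne (m : ℕ) (i : Fin 7) : rowShape (m + 3) ≤ tabOne m i := by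
  have h1 := rowShape_le_rowShape m
  have h2 := rowShape_le_hookShape m
  fin_cases i
  exacts [h1, h2, h1, h2, h2, h2, h2]

lemma tabHalf_le_tabOne (m : ℕ) (i : Fin 7) : tabHalf m i ≤ tabOne m i := by
  have h1 := rowShape_le_rowShape m
  have h2 := rowShape_le_hookShape m
  have h3 := hookShape_le_hookShape m
  fin_cases i
  exacts [h1, h2, h1, h2, h3, h3, h3]

lemma tabHalf_le_shapes (m : ℕ) (i : Fin 7) : tabHalf m i ≤ shapes m (shapeIdx i) := by
  have h1 := rowShape_le_rowShape m
  have h2 := rowShape_le_hookShape m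
  fin_cases i
  exacts [h1, h1, h2, h2, hookShape_le_hookShape m, hookShape_le_twoTwoShape m,
    hookShape_le_longHookShape m]

/-- The seven vacillating tableaux of length two. -/
noncomputable def tab (m : ℕ) (i : Fin 7) : VacTab (m + 3) 2 where
  whole := ![rowShape (m + 4), tabOne m i, shapes m (shapeIdx i)]
  half := ![rowShape (m + 3), tabHalf m i]
  whole_mem j := by
    fin_cases j
    exacts [mem_labels_zero.2 rfl, tabOne_mem m i, shapes_mem m _]
  half_mem j := by
    fin_cases j
    exacts [mem_labels_zero.2 rfl, tabHalf_mem m i]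
  remove_box j := by
    fin_cases j
    exacts [rowShape_le_rowShape m, tabHalf_le_tabOne m i]
  add_box j := by
    fin_cases j
    exacts [rowShape_le_tabOne m i, tabHalf_le_shapes m i]

lemma tab_eq_of_eq {m : ℕ} {i j : Fin 7} (h1 : tabOne m i = tabOne m j)
    (h2 : tabHalf m i = tabHalf m j) (h3 : shapeIdx i = shapeIdx j) : i = j := by
  fin_cases i <;> fin_cases j <;>
    first
      | rfl
      | exact absurd h3 (by decide)
      | (simp [tabOne, threeRows_inj] at h1; done)
      | simp [tabHalf, threeRows_inj] at h2

lemma VacTab.ext_two {n : ℕ} {v w : VacTab n 2} (h1 : v.whole 1 = w.whole 1)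
    (h2 : v.half 1 = w.half 1) (h3 : v.shape = w.shape) : v = w := by
  have h0 : ∀ v : VacTab n 2, v.whole 0 = rowShape (n + 1) := fun v =>
    mem_labels_zero.1 (v.whole_mem 0)
  have h0' : ∀ v : VacTab n 2, v.half 0 = rowShape n := fun v => mem_labels_zero.1 (v.half_mem 0)
  refine VacTab.ext (funext fun j => ?_) (funext fun j => ?_)
  · fin_cases j
    exacts [(h0 v).trans (h0 w).symm, h1, h3]
  · fin_cases j
    exacts [(h0' v).trans (h0' w).symm, h2]

lemma tab_bijective (m : ℕ) : Function.Bijective (tab m) := by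
  constructor
  · intro i j h
    exact tab_eq_of_eq (congrArg (fun v : VacTab (m + 3) 2 => v.whole 1) h)
      (congrArg (fun v : VacTab (m + 3) 2 => v.half 1) h)
      (shapes_injective m (congrArg VacTab.shape h))
  · intro v
    have hb := v.remove_box 1
    have hc := v.add_box 1
    have key : ∃ i, tabOne m i = v.whole 1 ∧ tabHalf m i = v.half 1 ∧
        shapes m (shapeIdx i) = v.shape := by
      change v.half 1 ≤ v.whole 1 at hb
      change v.half 1 ≤ v.shape at hc
      have h3 : v.shape ∈ labels (m + 4) 2 := v.whole_mem 2
      -- Of the 2 · 2 · 4 combinations of labels, the inclusions leave exactly seven.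
      rcases mem_labels_one.1 (v.whole_mem 1) with h1 | h1 <;>
        rcases mem_labels_one.1 (v.half_mem 1) with h2 | h2 <;>
        rcases mem_labels_two.1 h3 with h3 | h3 | h3 | h3 <;>
        rw [h1, h2, threeRows_le_iff] at hb <;> rw [h2, h3, threeRows_le_iff] at hc <;>
        first
          | omega
          | (rw [h1, h2, h3]
             first
              | exact ⟨0, rfl, rfl, rfl⟩
              | exact ⟨1, rfl, rfl, rfl⟩
              | exact ⟨2, rfl, rfl, rfl⟩
              | exact ⟨3, rfl, rfl, rfl⟩
              | exact ⟨4, rfl, rfl, rfl⟩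
              | exact ⟨5, rfl, rfl, rfl⟩
              | exact ⟨6, rfl, rfl, rfl⟩)
    obtain ⟨i, h1, h2, h3⟩ := key
    exact ⟨i, VacTab.ext_two h1 h2 h3⟩

/-- The enumeration of the vacillating tableaux of length two. -/
noncomputable def tabEquiv (m : ℕ) : Fin 7 ≃ VacTab (m + 3) 2 :=
  Equiv.ofBijective (tab m) (tab_bijective m)

/-- The shapes carry 2, 3, 1, 1 tableaux, and 4 + 9 + 1 + 1 = 15 agrees with the number of diagrams.
-/
lemma card_pairs (m : ℕ) :
    Nat.card {x : VacTab (m + 3) 2 × VacTab (m + 3) 2 // x.1.shape = x.2.shape} = 15 := by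
  have e : {x : Fin 7 × Fin 7 // shapeIdx x.1 = shapeIdx x.2} ≃
      {x : VacTab (m + 3) 2 × VacTab (m + 3) 2 // x.1.shape = x.2.shape} :=
    Equiv.subtypeEquiv ((tabEquiv m).prodCongr (tabEquiv m)) fun x =>
      (shapes_injective m).eq_iff.symm
  rw [← Nat.card_congr e, Nat.card_eq_fintype_card]
  decide

/-! ### The multiplicity spaces of `V_N^{⊗2}` -/

section

variable {N : ℕ} {w : Fin N → Fin N → ℂ}

lemma eq_zero_of_swap {a b : Fin N}
    (h : ∀ p q, w (Equiv.swap a b p) (Equiv.swap a b q) = -w p q) {p q : Fin N} (hpa : p ≠ a)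
    (hpb : p ≠ b) (hqa : q ≠ a) (hqb : q ≠ b) : w p q = 0 := by
  have := h p q
  rw [Equiv.swap_apply_of_ne_of_ne hpa hpb, Equiv.swap_apply_of_ne_of_ne hqa hqb] at this
  exact self_eq_neg.1 this

/-- The hypotheses are the symmetries of (X a - X b)(X c - X d). The two sign changes kill every
entry whose indices both avoid {a, b} or both avoid {c, d}; the remaining eight are ± `w a c`. -/
lemma eq_mul_of_twoTwo_symm {a b c d : Fin N} (h : ![a, b, c, d].Injective)
    (h1 : ∀ p q, w (Equiv.swap a b p) (Equiv.swap a b q) = -w p q)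
    (h2 : ∀ p q, w (Equiv.swap c d p) (Equiv.swap c d q) = -w p q)
    (h3 : ∀ p q, w (Equiv.swap a c (Equiv.swap b d p)) (Equiv.swap a c (Equiv.swap b d q)) =
      w p q) (p q : Fin N) : w p q = w a c *
      ((if (p = a ∧ q = c) ∨ (p = c ∧ q = a) then 1 else 0)
      - (if (p = a ∧ q = d) ∨ (p = d ∧ q = a) then 1 else 0)
      - (if (p = b ∧ q = c) ∨ (p = c ∧ q = b) then 1 else 0)
      + (if (p = b ∧ q = d) ∨ (p = d ∧ q = b) then 1 else 0)) := by
  have hab : a ≠ b := fun e => absurd (@h 0 1 e) (by decide)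
  have hac : a ≠ c := fun e => absurd (@h 0 2 e) (by decide)
  have had : a ≠ d := fun e => absurd (@h 0 3 e) (by decide)
  have hbc : b ≠ c := fun e => absurd (@h 1 2 e) (by decide)
  have hbd : b ≠ d := fun e => absurd (@h 1 3 e) (by decide)
  have hcd : c ≠ d := fun e => absurd (@h 2 3 e) (by decide)
  have e1 : w a d = -w a c := by
    simpa [Equiv.swap_apply_of_ne_of_ne hac had] using h2 a c
  have e2 : w b c = -w a c := by
    simpa [Equiv.swap_apply_of_ne_of_ne hac.symm hbc.symm] using h1 a c
  have e3 : w b d = w a c := by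
    have := h2 b c
    simpa [Equiv.swap_apply_of_ne_of_ne hbc hbd, e2] using this
  have e4 : w c a = w a c := by
    simpa [Equiv.swap_apply_of_ne_of_ne hab had, Equiv.swap_apply_of_ne_of_ne hbc.symm hcd]
      using h3 a c
  have e5 : w d a = -w a c := by
    simpa [Equiv.swap_apply_of_ne_of_ne had.symm hcd.symm,
      Equiv.swap_apply_of_ne_of_ne hbc.symm hcd, e2] using h3 b c
  have e6 : w c b = -w a c := by
    simpa [Equiv.swap_apply_of_ne_of_ne hab had, Equiv.swap_apply_of_ne_of_ne hab.symm hbc, e1]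
      using h3 a d
  have e7 : w d b = w a c := by
    simpa [Equiv.swap_apply_of_ne_of_ne had.symm hcd.symm,
      Equiv.swap_apply_of_ne_of_ne hab.symm hbc, e3] using h3 b d
  have z1 := @eq_zero_of_swap _ _ _ _ h1 p q
  have z2 := @eq_zero_of_swap _ _ _ _ h2 p q
  clear h h1 h2 h3
  grind

/-- Antisymmetry under the three transpositions kills every entry whose indices both avoid one of
the pairs from {a, b, c}, hence all but the six off-diagonal entries on these points; those are ± `w
a b`. -/
lemma eq_mul_of_vandermonde_symm {a b c : Fin N} (h : ![a, b, c].Injective)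
    (h1 : ∀ p q, w (Equiv.swap a b p) (Equiv.swap a b q) = -w p q)
    (h2 : ∀ p q, w (Equiv.swap b c p) (Equiv.swap b c q) = -w p q)
    (h3 : ∀ p q, w (Equiv.swap a c p) (Equiv.swap a c q) = -w p q) (p q : Fin N) :
    w p q = w a b *
      ((if p = a ∧ q = b then 1 else 0) - (if p = b ∧ q = a then 1 else 0)
      + ((if p = b ∧ q = c then 1 else 0) - (if p = c ∧ q = b then 1 else 0))
      + ((if p = c ∧ q = a then 1 else 0) - (if p = a ∧ q = c then 1 else 0))) := by
  have hab : a ≠ b := fun e => absurd (@h 0 1 e) (by decide)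
  have hac : a ≠ c := fun e => absurd (@h 0 2 e) (by decide)
  have hbc : b ≠ c := fun e => absurd (@h 1 2 e) (by decide)
  have e1 : w b a = -w a b := by simpa using h1 a b
  have e2 : w a c = -w a b := by
    simpa [Equiv.swap_apply_of_ne_of_ne hab hac] using h2 a b
  have e3 : w c b = -w a b := by
    simpa [Equiv.swap_apply_of_ne_of_ne hab.symm hbc] using h3 a b
  have e4 : w c a = w a b := by
    simpa [e2] using h3 a c
  have e5 : w b c = w a b := by
    simpa [e3] using h2 c b
  have z1 := @eq_zero_of_swap _ _ _ _ h1 p q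
  have z2 := @eq_zero_of_swap _ _ _ _ h2 p q
  have z3 := @eq_zero_of_swap _ _ _ _ h3 p q
  clear h h1 h2 h3
  grind

/-- S_N acts doubly transitively, so an invariant tensor is constant on and off the diagonal. -/
lemma exists_row_coeffs (hN : 2 ≤ N) (h : ∀ (σ : Equiv.Perm (Fin N)) p q, w (σ p) (σ q) = w p q) :
    ∃ α β, ∀ p q, w p q = if p = q then α else β := by
  refine ⟨w ⟨0, by omega⟩ ⟨0, by omega⟩, w ⟨0, by omega⟩ ⟨1, by omega⟩, fun p q => ?_⟩
  split_ifs with hpq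
  · subst hpq
    rw [← h (Equiv.swap ⟨0, by omega⟩ p)]
    simp
  · obtain ⟨σ, hσ⟩ := Equiv.Perm.exists_extending_pair
      ![(⟨0, by omega⟩ : Fin N), ⟨1, by omega⟩] ![p, q]
      (by simp) (by simpa using hpq)
    have h0 : σ ⟨0, by omega⟩ = p := hσ 0
    have h1 : σ ⟨1, by omega⟩ = q := hσ 1
    rw [← h0, ← h1, h]

/-- `W a b` stands for the image of `X a - X b`. By equivariance an entry depends only on the
pattern of coincidences among `a`, `b`, `p`, `q`, and antisymmetry relates the patterns. The
coefficients are the values at (a, a), (a, c) and (c, a) for a third point c. -/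
lemma exists_hook_coeffs (hN : 3 ≤ N) (W : Fin N → Fin N → Fin N → Fin N → ℂ)
    (hanti : ∀ a b p q, W b a p q = -W a b p q)
    (hadd : ∀ a b c p q, W a b p q = W a c p q + W c b p q)
    (hinv : ∀ (σ : Equiv.Perm (Fin N)) a b p q, W (σ a) (σ b) (σ p) (σ q) = W a b p q) :
    ∃ α β γ, ∀ a b, a ≠ b → ∀ p q, W a b p q =
      if p = q then α * ((if q = a then 1 else 0) - (if q = b then 1 else 0))
      else β * ((if p = a then 1 else 0) - (if p = b then 1 else 0))
        + γ * ((if q = a then 1 else 0) - (if q = b then 1 else 0)) := by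
  let f : Fin 3 → Fin N := Fin.castLE hN
  have hf : f.Injective := Fin.castLE_injective hN
  have key : ∀ i j k l : Fin 3, ∀ s : Fin 3 → Fin N, s.Injective →
      W (s i) (s j) (s k) (s l) = W (f i) (f j) (f k) (f l) := by
    intro i j k l s hs
    obtain ⟨σ, hσ⟩ := Equiv.Perm.exists_extending_pair f s hf hs
    simp only [← hσ, hinv]
  have key2 : ∀ i j k l : Fin 2, ∀ s : Fin 2 → Fin N, s.Injective →
      W (s i) (s j) (s k) (s l) =
        W (f i.castSucc) (f j.castSucc) (f k.castSucc) (f l.castSucc) := by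
    intro i j k l s hs
    obtain ⟨σ, hσ⟩ := Equiv.Perm.exists_extending_pair (f ∘ Fin.castSucc) s
      (hf.comp (Fin.castSucc_injective 2)) hs
    simp only [← hσ, hinv, Function.comp_apply]
  refine ⟨W (f 0) (f 1) (f 0) (f 0), W (f 0) (f 1) (f 0) (f 2), W (f 0) (f 1) (f 2) (f 0),
    fun a b hab p q => ?_⟩
  have tri : ∀ a b c : Fin N, a ≠ b → a ≠ c → b ≠ c → (![a, b, c]).Injective := by
    intro a b c h1 h2 h3 i j e
    fin_cases i <;> fin_cases j <;>
      first | rfl | exact absurd e ‹_› | exact absurd e.symm ‹_›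
  have v1 : ∀ a b, a ≠ b → W a b a a = W (f 0) (f 1) (f 0) (f 0) := fun a b h =>
    key2 0 1 0 0 ![a, b] (by simpa using h)
  have v2 : ∀ a b c, a ≠ b → a ≠ c → b ≠ c → W a b a c = W (f 0) (f 1) (f 0) (f 2) :=
    fun a b c h1 h2 h3 => key 0 1 0 2 ![a, b, c] (tri _ _ _ h1 h2 h3)
  have v3 : ∀ a b c, a ≠ b → a ≠ c → b ≠ c → W a b c a = W (f 0) (f 1) (f 2) (f 0) :=
    fun a b c h1 h2 h3 => key 0 1 2 0 ![a, b, c] (tri _ _ _ h1 h2 h3)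
  have v4 : W a b b b = -W (f 0) (f 1) (f 0) (f 0) := by rw [hanti, v1 b a hab.symm]
  have v5 : ∀ a b c, a ≠ b → a ≠ c → b ≠ c → W a b b c = -W (f 0) (f 1) (f 0) (f 2) :=
    fun a b c h1 h2 h3 => by rw [hanti, v2 b a c h1.symm h3 h2]
  have v6 : ∀ a b c, a ≠ b → a ≠ c → b ≠ c → W a b c b = -W (f 0) (f 1) (f 2) (f 0) :=
    fun a b c h1 h2 h3 => by rw [hanti, v3 b a c h1.symm h3 h2]
  have v0 := fun h1 h2 h3 h4 => eq_zero_of_swap (w := W a b) (a := a) (b := b) (p := p) (q := q)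
    (fun p q => by
      have := hinv (Equiv.swap a b) a b p q
      rw [Equiv.swap_apply_left, Equiv.swap_apply_right] at this
      rw [← this, hanti a b, neg_neg]) h1 h2 h3 h4
  have hthird : ∃ c, c ≠ a ∧ c ≠ b := by
    obtain ⟨c, hc⟩ := Finset.exists_mem_notMem_of_card_lt_card (s := {a, b})
      (t := (Finset.univ : Finset (Fin N)))
      (Finset.card_le_two.trans_lt (by rwa [Finset.card_univ, Fintype.card_fin]))
    exact ⟨c, by simpa using hc⟩
  obtain ⟨c, hca, hcb⟩ := hthird
  -- The entries at (a, b) and (b, a) are not free: writing X a - X b as (X a - X c) + (X c - X b)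
  -- reduces them to the patterns already known.
  have v7 : W a b a b = W (f 0) (f 1) (f 0) (f 2) - W (f 0) (f 1) (f 2) (f 0) := by
    rw [hadd a b c, v2 a c b hca.symm hab hcb, v6 c b a hcb hca hab.symm, sub_eq_add_neg]
  have v8 : W a b b a = -(W (f 0) (f 1) (f 0) (f 2) - W (f 0) (f 1) (f 2) (f 0)) := by
    rw [hadd a b c, v3 a c b hca.symm hab hcb, v5 c b a hcb hca hab.symm]
    ring
  have v2 := v2 a b
  have v3 := v3 a b
  have v5 := v5 a b
  have v6 := v6 a b
  have v1 := v1 a b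
  clear tri key key2 hanti hadd hinv
  generalize W (f 0) (f 1) (f 0) (f 0) = α at *
  generalize W (f 0) (f 1) (f 0) (f 2) = β at *
  generalize W (f 0) (f 1) (f 2) (f 0) = γ at *
  generalize W a b = w at *
  grind

end

lemma intertwiner_ext {n : ℕ} {μ : YoungDiagram} {W : Type*} [AddCommGroup W] [Module ℂ W]
    {τ : Representation ℂ (Equiv.Perm (Fin n)) W} {s : Set (MvPolynomial (Fin n) ℂ)}
    (hs : specht n μ = Submodule.span ℂ s)
    {φ ψ : Representation.IntertwiningMap (spechtRep n μ) τ}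
    (h : ∀ f (hf : f ∈ specht n μ), f ∈ s → φ ⟨f, hf⟩ = ψ ⟨f, hf⟩) : φ = ψ := by
  have key : ∀ f (hf : f ∈ specht n μ), φ ⟨f, hf⟩ = ψ ⟨f, hf⟩ := by
    intro f hf
    have hf' : f ∈ Submodule.span ℂ s := hs ▸ hf
    induction hf' using Submodule.span_induction with
    | mem f hf' => exact h f hf hf'
    | zero => exact (map_zero φ).trans (map_zero ψ).symm
    | add f g hf' hg' ihf ihg =>
      have h1 : f ∈ specht n μ := hs ▸ hf'
      have h2 : g ∈ specht n μ := hs ▸ hg'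
      exact (map_add φ ⟨f, h1⟩ ⟨g, h2⟩).trans
        ((congrArg₂ (· + ·) (ihf h1) (ihg h2)).trans (map_add ψ ⟨f, h1⟩ ⟨g, h2⟩).symm)
    | smul c f hf' ih =>
      have h1 : f ∈ specht n μ := hs ▸ hf'
      exact (map_smul φ c ⟨f, h1⟩).trans
        ((congrArg (c • ·) (ih h1)).trans (map_smul ψ c ⟨f, h1⟩).symm)
  exact DFunLike.ext _ _ fun v => key v.1 v.2

lemma irrep_equivariant {N : ℕ} {μ : YoungDiagram} (φ : Irrep 2 N μ) (σ : Equiv.Perm (Fin N))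
    {f g : MvPolynomial (Fin N) ℂ} (hf : f ∈ specht N μ) (hg : g ∈ specht N μ)
    (h : rename σ f = g) (p q : Fin N) : φ ⟨g, hg⟩ ![σ p, σ q] = φ ⟨f, hf⟩ ![p, q] := by
  subst h
  have : φ ⟨rename σ f, hg⟩ = tensorRep N 2 σ (φ ⟨f, hf⟩) :=
    φ.isIntertwining _ _ σ ⟨f, hf⟩
  rw [this, tensorRep_two]
  simp

lemma irrep_neg {N : ℕ} {μ : YoungDiagram} (φ : Irrep 2 N μ)
    {f g : MvPolynomial (Fin N) ℂ} (hf : f ∈ specht N μ) (hg : g ∈ specht N μ)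
    (h : g = -f) (p q : Fin N) : φ ⟨g, hg⟩ ![p, q] = -φ ⟨f, hf⟩ ![p, q] := by
  subst h
  exact congrFun (map_neg φ ⟨f, hf⟩) _

lemma irrep_add {N : ℕ} {μ : YoungDiagram} (φ : Irrep 2 N μ)
    {f g h : MvPolynomial (Fin N) ℂ} (hf : f ∈ specht N μ) (hg : g ∈ specht N μ)
    (hh : h ∈ specht N μ) (e : h = f + g) (p q : Fin N) :
    φ ⟨h, hh⟩ ![p, q] = φ ⟨f, hf⟩ ![p, q] + φ ⟨g, hg⟩ ![p, q] := by
  subst e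
  exact congrFun (map_add φ ⟨f, hf⟩ ⟨g, hg⟩) _

lemma irrep_equivariant_neg {N : ℕ} {μ : YoungDiagram} (φ : Irrep 2 N μ) (σ : Equiv.Perm (Fin N))
    {f : MvPolynomial (Fin N) ℂ} (hf : f ∈ specht N μ) (h : rename σ f = -f) (p q : Fin N) :
    φ ⟨f, hf⟩ ![σ p, σ q] = -φ ⟨f, hf⟩ ![p, q] := by
  rw [← irrep_equivariant φ σ hf (neg_mem hf) h p q, irrep_neg φ hf (neg_mem hf) rfl (σ p), neg_neg]

lemma exists_eq_rowIntertwiner {N : ℕ} (hN : 2 ≤ N) (φ : Irrep 2 N (rowShape N)) :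
    ∃ α β, φ = rowIntertwiner N α β _ := by
  obtain ⟨α, β, h⟩ := exists_row_coeffs hN
    (w := fun p q => φ ⟨1, one_mem_specht N⟩ ![p, q])
    fun σ => irrep_equivariant φ σ _ _ (map_one (rename (R := ℂ) σ))
  refine ⟨α, β, intertwiner_ext (specht_rowShape N) fun f hf hs => ?_⟩
  obtain rfl : f = 1 := hs
  refine tensor_ext_two fun p q => (h p q).trans ?_
  rw [rowIntertwiner_apply, coeff_zero_one, one_smul, constTensor_apply]

lemma X_sub_X_mem_specht' {m : ℕ} (a b : Fin (m + 2)) :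
    (X a - X b : MvPolynomial (Fin (m + 2)) ℂ) ∈ specht (m + 2) (hookShape m) := by
  by_cases h : a = b
  · rw [h, sub_self]; exact Submodule.zero_mem _
  · exact X_sub_X_mem_specht h

lemma exists_eq_hookIntertwiner {m : ℕ} (hm : m ≠ 0) (φ : Irrep 2 (m + 2) (hookShape m)) :
    ∃ α β γ, φ = hookIntertwiner (m + 2) α β γ _ := by
  obtain ⟨α, β, γ, h⟩ := exists_hook_coeffs (by omega)
    (fun a b p q => φ ⟨_, X_sub_X_mem_specht' a b⟩ ![p, q])
    (fun a b p q => irrep_neg φ _ _ (neg_sub _ _).symm p q)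
    (fun a b c p q => irrep_add φ _ _ _ (sub_add_sub_cancel _ _ _).symm p q)
    (fun σ a b => irrep_equivariant φ σ _ _ (by simp))
  refine ⟨α, β, γ, intertwiner_ext (specht_hookShape m) fun f hf hs => ?_⟩
  obtain ⟨a, b, hab, rfl⟩ := hs
  refine tensor_ext_two fun p q => (h a b hab p q).trans ?_
  rw [hookIntertwiner_apply, linearCoeffs_X_sub_X, linearTensor_apply]
  simp only [Pi.sub_apply, Pi.single_apply]

lemma exists_eq_smul_quadIntertwiner_twoTwo {m : ℕ} (φ : Irrep 2 (m + 4) (twoTwoShape m)) :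
    ∃ c : ℂ, φ = c • quadIntertwiner (m + 4) 1 _ := by
  have hf : (Fin.castLE (Nat.le_add_left 4 m)).Injective := Fin.castLE_injective _
  generalize Fin.castLE (Nat.le_add_left 4 m) = f at hf
  have hinj : ![f 0, f 1, f 2, f 3].Injective := by
    convert hf using 1
    funext i; fin_cases i <;> rfl
  refine ⟨φ ⟨_, twoTwo_mem_specht hinj⟩ ![f 0, f 2],
    intertwiner_ext (specht_twoTwoShape m) fun g hg hs => ?_⟩
  obtain ⟨a, b, c, d, h, rfl⟩ := hs
  have hab : a ≠ b := fun e => absurd (@h 0 1 e) (by decide)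
  have hac : a ≠ c := fun e => absurd (@h 0 2 e) (by decide)
  have had : a ≠ d := fun e => absurd (@h 0 3 e) (by decide)
  have hbc : b ≠ c := fun e => absurd (@h 1 2 e) (by decide)
  have hbd : b ≠ d := fun e => absurd (@h 1 3 e) (by decide)
  have hcd : c ≠ d := fun e => absurd (@h 2 3 e) (by decide)
  -- A permutation carrying the reference tuple to (a, b, c, d) shows that the multiplier is the
  -- same for all generators.
  have hbase : φ ⟨_, hg⟩ ![a, c] = φ ⟨_, twoTwo_mem_specht hinj⟩ ![f 0, f 2] := by
    obtain ⟨σ, hσ⟩ := Equiv.Perm.exists_extending_pair ![f 0, f 1, f 2, f 3] ![a, b, c, d] hinj h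
    have h0 : σ (f 0) = a := hσ 0
    have h1 : σ (f 1) = b := hσ 1
    have h2 : σ (f 2) = c := hσ 2
    have h3 : σ (f 3) = d := hσ 3
    have := irrep_equivariant φ σ (twoTwo_mem_specht hinj) hg (by simp [h0, h1, h2, h3])
      (f 0) (f 2)
    rwa [h0, h2] at this
  refine tensor_ext_two fun p q => (eq_mul_of_twoTwo_symm
    (w := fun p q => φ ⟨_, hg⟩ ![p, q]) h ?_ ?_ ?_ p q).trans ?_
  · intro p q
    exact irrep_equivariant_neg φ (Equiv.swap a b) hg (by
      simp [Equiv.swap_apply_of_ne_of_ne hac.symm hbc.symm,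
        Equiv.swap_apply_of_ne_of_ne had.symm hbd.symm]; ring) p q
  · intro p q
    exact irrep_equivariant_neg φ (Equiv.swap c d) hg (by
      simp [Equiv.swap_apply_of_ne_of_ne hac had,
        Equiv.swap_apply_of_ne_of_ne hbc hbd]; ring) p q
  · intro p q
    exact irrep_equivariant φ (Equiv.swap a c * Equiv.swap b d) hg hg (by
      simp [Equiv.swap_apply_of_ne_of_ne hab had, Equiv.swap_apply_of_ne_of_ne hbc.symm hcd,
        Equiv.swap_apply_of_ne_of_ne hab.symm hbc,
        Equiv.swap_apply_of_ne_of_ne had.symm hcd.symm]; ring) p q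
  · rw [hbase, ← quadCoeffs_twoTwo]
    rfl

lemma exists_eq_smul_quadIntertwiner_longHook {m : ℕ} (φ : Irrep 2 (m + 3) (longHookShape m)) :
    ∃ c : ℂ, φ = c • quadIntertwiner (m + 3) 2 _ := by
  have hf : (Fin.castLE (Nat.le_add_left 3 m)).Injective := Fin.castLE_injective _
  generalize Fin.castLE (Nat.le_add_left 3 m) = f at hf
  have hinj : ![f 0, f 1, f 2].Injective := by
    convert hf using 1
    funext i; fin_cases i <;> rfl
  refine ⟨φ ⟨_, vandermonde_mem_specht hinj⟩ ![f 0, f 1],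
    intertwiner_ext (specht_longHookShape m) fun g hg hs => ?_⟩
  obtain ⟨a, b, c, h, rfl⟩ := hs
  have hab : a ≠ b := fun e => absurd (@h 0 1 e) (by decide)
  have hac : a ≠ c := fun e => absurd (@h 0 2 e) (by decide)
  have hbc : b ≠ c := fun e => absurd (@h 1 2 e) (by decide)
  have hbase : φ ⟨_, hg⟩ ![a, b] = φ ⟨_, vandermonde_mem_specht hinj⟩ ![f 0, f 1] := by
    obtain ⟨σ, hσ⟩ := Equiv.Perm.exists_extending_pair ![f 0, f 1, f 2] ![a, b, c] hinj h
    have h0 : σ (f 0) = a := hσ 0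
    have h1 : σ (f 1) = b := hσ 1
    have h2 : σ (f 2) = c := hσ 2
    have := irrep_equivariant φ σ (vandermonde_mem_specht hinj) hg (by simp [h0, h1, h2])
      (f 0) (f 1)
    rwa [h0, h1] at this
  refine tensor_ext_two fun p q => (eq_mul_of_vandermonde_symm
    (w := fun p q => φ ⟨_, hg⟩ ![p, q]) h ?_ ?_ ?_ p q).trans ?_
  · intro p q
    exact irrep_equivariant_neg φ (Equiv.swap a b) hg (by
      simp [Equiv.swap_apply_of_ne_of_ne hac.symm hbc.symm]; ring) p q
  · intro p q
    exact irrep_equivariant_neg φ (Equiv.swap b c) hg (by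
      simp [Equiv.swap_apply_of_ne_of_ne hab hac]; ring) p q
  · intro p q
    exact irrep_equivariant_neg φ (Equiv.swap a c) hg (by
      simp [Equiv.swap_apply_of_ne_of_ne hab.symm hbc]; ring) p q
  · rw [hbase, ← quadCoeffs_vandermonde]
    rfl

/-! ### Bases of the multiplicity spaces of `V_N^{⊗2}` -/

/-- The vectors in the multiplicity spaces that correspond to the vacillating tableaux. -/
noncomputable def tabVec (m : ℕ) (μ : YoungDiagram) : Fin 7 → Irrep 2 (m + 4) μ :=
  -- The parameters solve eigenvector equations. On invariant tensors Z₁ sends (α, β) to (s, s) with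
  -- s = α + (N-1)β, and Z_{3/2} is multiplication by N. On images of the standard representation Z₁
  -- sends (α, β, γ) to (s, 0, s) with s = α - β + (N-1)γ, and Z_{3/2} sends it to (Nα, β, Nγ - β).
  -- Here N = m + 4.
  ![rowIntertwiner (m + 4) 1 1 μ, rowIntertwiner (m + 4) (m + 3) (-1) μ,
    hookIntertwiner (m + 4) 1 0 1 μ, hookIntertwiner (m + 4) (m + 3) 0 (-1) μ,
    hookIntertwiner (m + 4) 0 (m + 3) 1 μ, quadIntertwiner (m + 4) 1 μ,
    quadIntertwiner (m + 4) 2 μ]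

lemma nchar_Z₁_rowShape (m : ℕ) : nchar (Z₁ (m + 4)) (rowShape (m + 4)) = m + 4 := by
  refine (nchar_Z₁ (by omega) (mem_labels_one.2 (.inl rfl))).trans ?_
  rw [contentSum_threeRows, cast_choose_two']
  push_cast; ring

lemma nchar_Z₁_hookShape (m : ℕ) : nchar (Z₁ (m + 4)) (hookShape (m + 2)) = 0 := by
  refine (nchar_Z₁ (by omega) (mem_labels_one.2 (.inr rfl))).trans ?_
  rw [contentSum_threeRows, cast_choose_two']
  push_cast; ring

lemma ncharHalf_Z₃₂_rowShape (m : ℕ) :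
    ncharHalf (k := 1) (n := m + 3) (Z₃₂ (m + 4)) (rowShape (m + 3)) = m + 4 := by
  refine (ncharHalf_Z₃₂ (by omega) (mem_labels_one.2 (.inl rfl))).trans ?_
  rw [contentSum_threeRows, cast_choose_two']
  push_cast; ring

lemma ncharHalf_Z₃₂_hookShape (m : ℕ) :
    ncharHalf (k := 1) (n := m + 3) (Z₃₂ (m + 4)) (hookShape (m + 1)) = 1 := by
  refine (ncharHalf_Z₃₂ (by omega) (mem_labels_one.2 (.inr rfl))).trans ?_
  rw [contentSum_threeRows, cast_choose_two']
  push_cast; ring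

section

variable {m : ℕ}

lemma irrep_eq_smul_of_act {N : ℕ} {μ : YoungDiagram} {s : Set (MvPolynomial (Fin N) ℂ)}
    (hs : specht N μ = Submodule.span ℂ s) {x : PartitionAlgebra 2 N} {φ : Irrep 2 N μ} {c : ℂ}
    (h : ∀ f (hf : f ∈ specht N μ), f ∈ s → ∀ p q,
      act 2 N x (φ ⟨f, hf⟩) ![p, q] = c * φ ⟨f, hf⟩ ![p, q]) :
    irrep 2 N μ x φ = c • φ :=
  intertwiner_ext hs fun f hf hfs => tensor_ext_two fun p q => h f hf hfs p q

lemma sum_constTensor (α β : ℂ) (q : Fin (m + 4)) :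
    ∑ a, constTensor (m + 4) α β ![a, q] = α + (m + 3) * β := by
  simp only [constTensor_apply]
  rw [← Finset.sum_erase_add _ _ (Finset.mem_univ q), if_pos rfl,
    Finset.sum_congr rfl fun a ha => if_neg (Finset.ne_of_mem_erase ha)]
  simp
  ring

lemma sum_linearTensor (α β γ : ℂ) {x : Fin (m + 4) → ℂ} (hx : ∑ a, x a = 0)
    (q : Fin (m + 4)) :
    ∑ a, linearTensor (m + 4) α β γ x ![a, q] = (α - β + (m + 3) * γ) * x q := by
  simp only [linearTensor_apply]
  rw [← Finset.sum_erase_add _ _ (Finset.mem_univ q), if_pos rfl,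
    Finset.sum_congr rfl fun a ha => if_neg (Finset.ne_of_mem_erase ha), Finset.sum_add_distrib,
    ← Finset.mul_sum, Finset.sum_erase_eq_sub (Finset.mem_univ q), hx]
  simp
  ring

lemma sum_linearCoeffs (a b : Fin (m + 4)) : ∑ i, linearCoeffs (m + 4) (X a - X b) i = 0 := by
  rw [linearCoeffs_X_sub_X]
  simp [Finset.sum_sub_distrib]

/-- Zero diagonal and zero column sums are what make these tensors eigenvectors of Z₁ with
eigenvalue 0 and of Z_{3/2} with eigenvalue 1. -/
lemma sum_quadCoeffs_twoTwo {a b c d : Fin (m + 4)} (h : ![a, b, c, d].Injective)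
    (q : Fin (m + 4)) :
    quadCoeffs (m + 4) 1 ((X a - X b) * (X c - X d)) ![q, q] = 0 ∧
      ∑ p, quadCoeffs (m + 4) 1 ((X a - X b) * (X c - X d)) ![p, q] = 0 := by
  have hac : a ≠ c := fun e => absurd (@h 0 2 e) (by decide)
  have had : a ≠ d := fun e => absurd (@h 0 3 e) (by decide)
  have hbc : b ≠ c := fun e => absurd (@h 1 2 e) (by decide)
  have hbd : b ≠ d := fun e => absurd (@h 1 3 e) (by decide)
  have key : ∀ a c : Fin (m + 4), a ≠ c →
      ∑ p, (if (p = a ∧ q = c) ∨ (p = c ∧ q = a) then (1 : ℂ) else 0) =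
        (if q = c then 1 else 0) + (if q = a then 1 else 0) := by
    intro a c h
    have : ∀ p, (if (p = a ∧ q = c) ∨ (p = c ∧ q = a) then (1 : ℂ) else 0) =
        (if p = a then (if q = c then 1 else 0) else 0) +
          (if p = c then (if q = a then 1 else 0) else 0) := by
      intro p; grind
    simp only [this, Finset.sum_add_distrib, Finset.sum_ite_eq', Finset.mem_univ, if_true]
  simp only [quadCoeffs_twoTwo]
  constructor
  · grind
  · simp only [Finset.sum_add_distrib, Finset.sum_sub_distrib, key _ _ hac, key _ _ had,
      key _ _ hbc, key _ _ hbd]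
    ring

lemma sum_quadCoeffs_vandermonde {a b c : Fin (m + 4)} (h : ![a, b, c].Injective)
    (q : Fin (m + 4)) :
    quadCoeffs (m + 4) 2 ((X a - X b) * (X a - X c) * (X b - X c)) ![q, q] = 0 ∧
      ∑ p, quadCoeffs (m + 4) 2 ((X a - X b) * (X a - X c) * (X b - X c)) ![p, q] = 0 := by
  have hab : a ≠ b := fun e => absurd (@h 0 1 e) (by decide)
  have hac : a ≠ c := fun e => absurd (@h 0 2 e) (by decide)
  have hbc : b ≠ c := fun e => absurd (@h 1 2 e) (by decide)
  simp only [quadCoeffs_vandermonde]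
  constructor
  · grind
  · simp only [Finset.sum_add_distrib, Finset.sum_sub_distrib, ite_and, Finset.sum_ite_eq',
      Finset.mem_univ, if_true]
    ring

lemma tabVec_Z₁ (i : Fin 7) :
    irrep 2 (m + 4) (shapes m (shapeIdx i)) (addStrand 1 (m + 4) (Z₁ (m + 4)))
      (tabVec m (shapes m (shapeIdx i)) i) =
        nchar (Z₁ (m + 4)) (tabOne m i) • tabVec m (shapes m (shapeIdx i)) i := by
  have hrow : ∀ α β c : ℂ, α + (m + 3) * β = c * α → α + (m + 3) * β = c * β →
      irrep 2 (m + 4) (rowShape (m + 4)) (addStrand 1 (m + 4) (Z₁ (m + 4)))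
        (rowIntertwiner (m + 4) α β _) = c • rowIntertwiner (m + 4) α β _ := by
    intro α β c h1 h2
    refine irrep_eq_smul_of_act (specht_rowShape _) fun f hf hs p q => ?_
    obtain rfl : f = 1 := hs
    rw [rowIntertwiner_apply, coeff_zero_one, one_smul, act_addStrand_Z₁, sum_constTensor,
      constTensor_apply]
    split_ifs
    exacts [h1, h2]
  have hhook : ∀ α β γ c : ℂ, α - β + (m + 3) * γ = c * α → c * β = 0 →
      α - β + (m + 3) * γ = c * γ →
      irrep 2 (m + 4) (hookShape (m + 2)) (addStrand 1 (m + 4) (Z₁ (m + 4)))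
        (hookIntertwiner (m + 4) α β γ _) = c • hookIntertwiner (m + 4) α β γ _ := by
    intro α β γ c h1 h2 h3
    refine irrep_eq_smul_of_act (specht_hookShape _) fun f hf hs p q => ?_
    obtain ⟨a, b, hab, rfl⟩ := hs
    rw [hookIntertwiner_apply, act_addStrand_Z₁, sum_linearTensor _ _ _ (sum_linearCoeffs a b),
      linearTensor_apply]
    generalize linearCoeffs (m + 4) (X a - X b) = x
    split_ifs
    · linear_combination x q * h1
    · linear_combination x q * h3 - x p * h2
  fin_cases i
  · refine (hrow 1 1 _ ?_ ?_).trans (congrArg (· • _) (nchar_Z₁_rowShape m).symm) <;> ring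
  · refine (hrow (m + 3) (-1) _ ?_ ?_).trans (congrArg (· • _) (nchar_Z₁_hookShape m).symm) <;> ring
  · refine (hhook 1 0 1 _ ?_ ?_ ?_).trans (congrArg (· • _) (nchar_Z₁_rowShape m).symm) <;> ring
  · refine (hhook (m + 3) 0 (-1) _ ?_ ?_ ?_).trans
      (congrArg (· • _) (nchar_Z₁_hookShape m).symm) <;> ring
  · refine (hhook 0 (m + 3) 1 _ ?_ ?_ ?_).trans
      (congrArg (· • _) (nchar_Z₁_hookShape m).symm) <;> ring
  · refine Eq.trans (irrep_eq_smul_of_act (specht_twoTwoShape _) fun f hf hs p q => ?_)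
      (congrArg (· • _) (nchar_Z₁_hookShape m).symm)
    obtain ⟨a, b, c, d, h, rfl⟩ := hs
    rw [act_addStrand_Z₁, zero_mul]
    exact (sum_quadCoeffs_twoTwo h q).2
  · refine Eq.trans (irrep_eq_smul_of_act (specht_longHookShape _) fun f hf hs p q => ?_)
      (congrArg (· • _) (nchar_Z₁_hookShape m).symm)
    obtain ⟨a, b, c, h, rfl⟩ := hs
    rw [act_addStrand_Z₁, zero_mul]
    exact (sum_quadCoeffs_vandermonde h q).2

lemma act_Z₃₂_eq_self {N : ℕ} {w : Tensor N 2} (h : ∀ q, w ![q, q] = 0 ∧ ∑ a, w ![a, q] = 0)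
    (p q : Fin N) : act 2 N (Z₃₂ N) w ![p, q] = 1 * w ![p, q] := by
  rw [act_Z₃₂, (h q).1, (h q).2]
  split_ifs with hpq
  · rw [hpq, (h q).1]; ring
  · ring

lemma tabVec_Z₃₂ (i : Fin 7) :
    irrep 2 (m + 4) (shapes m (shapeIdx i)) (Z₃₂ (m + 4)) (tabVec m (shapes m (shapeIdx i)) i) =
      ncharHalf (k := 1) (n := m + 3) (Z₃₂ (m + 4)) (tabHalf m i) •
        tabVec m (shapes m (shapeIdx i)) i := by
  have hrow : ∀ α β : ℂ,
      irrep 2 (m + 4) (rowShape (m + 4)) (Z₃₂ (m + 4))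
        (rowIntertwiner (m + 4) α β _) = (m + 4 : ℂ) • rowIntertwiner (m + 4) α β _ := by
    intro α β
    refine irrep_eq_smul_of_act (specht_rowShape _) fun f hf hs p q => ?_
    obtain rfl : f = 1 := hs
    rw [rowIntertwiner_apply, coeff_zero_one, one_smul, act_Z₃₂, sum_constTensor,
      constTensor_apply, constTensor_apply, if_pos rfl]
    split_ifs <;> push_cast <;> ring
  have hhook : ∀ α β γ c : ℂ, (m + 4) * α = c * α → β = c * β →
      γ - β + (m + 3) * γ = c * γ →
      irrep 2 (m + 4) (hookShape (m + 2)) (Z₃₂ (m + 4))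
        (hookIntertwiner (m + 4) α β γ _) = c • hookIntertwiner (m + 4) α β γ _ := by
    intro α β γ c h1 h2 h3
    refine irrep_eq_smul_of_act (specht_hookShape _) fun f hf hs p q => ?_
    obtain ⟨a, b, hab, rfl⟩ := hs
    rw [hookIntertwiner_apply, act_Z₃₂, sum_linearTensor _ _ _ (sum_linearCoeffs a b),
      linearTensor_apply, linearTensor_apply, if_pos rfl]
    generalize linearCoeffs (m + 4) (X a - X b) = x
    split_ifs
    · push_cast
      linear_combination x q * h1
    · linear_combination x q * h3 + x p * h2
  fin_cases i
  · exact (hrow 1 1).trans (congrArg (· • _) (ncharHalf_Z₃₂_rowShape m).symm)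
  · exact (hrow (m + 3) (-1)).trans (congrArg (· • _) (ncharHalf_Z₃₂_rowShape m).symm)
  · refine (hhook 1 0 1 _ ?_ ?_ ?_).trans (congrArg (· • _) (ncharHalf_Z₃₂_rowShape m).symm) <;>
      ring
  · refine (hhook (m + 3) 0 (-1) _ ?_ ?_ ?_).trans
      (congrArg (· • _) (ncharHalf_Z₃₂_rowShape m).symm) <;> ring
  · refine (hhook 0 (m + 3) 1 _ ?_ ?_ ?_).trans
      (congrArg (· • _) (ncharHalf_Z₃₂_hookShape m).symm) <;> ring
  · refine Eq.trans (irrep_eq_smul_of_act (specht_twoTwoShape _) fun f hf hs p q => ?_)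
      (congrArg (· • _) (ncharHalf_Z₃₂_hookShape m).symm)
    obtain ⟨a, b, c, d, h, rfl⟩ := hs
    exact act_Z₃₂_eq_self (sum_quadCoeffs_twoTwo h) p q
  · refine Eq.trans (irrep_eq_smul_of_act (specht_longHookShape _) fun f hf hs p q => ?_)
      (congrArg (· • _) (ncharHalf_Z₃₂_hookShape m).symm)
    obtain ⟨a, b, c, h, rfl⟩ := hs
    exact act_Z₃₂_eq_self (sum_quadCoeffs_vandermonde h) p q

end

/-! ### The tableau vectors span the multiplicity spaces and are separated by the projectors. -/

section

variable {m : ℕ}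

lemma tabVec_ne_zero (i : Fin 7) : tabVec m (shapes m (shapeIdx i)) i ≠ 0 := by
  obtain ⟨c, hc⟩ : ∃ c : Fin 4 → Fin (m + 4), Function.Injective c :=
    ⟨_, Fin.castLE_injective (Nat.le_add_left 4 m)⟩
  have hm : (m + 3 : ℂ) ≠ 0 := by exact_mod_cast Nat.succ_ne_zero (m + 2)
  have hrow : ∀ α β : ℂ, α ≠ 0 → rowIntertwiner (m + 4) α β (rowShape (m + 4)) ≠ 0 := by
    intro α β hα h
    have := congrFun (DFunLike.congr_fun h ⟨1, one_mem_specht _⟩) ![c 0, c 0]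
    rw [rowIntertwiner_apply, coeff_zero_one, one_smul, constTensor_apply, if_pos rfl] at this
    exact hα this
  have hhook : ∀ α β γ : ℂ, α ≠ 0 ∨ β ≠ 0 →
      hookIntertwiner (m + 4) α β γ (hookShape (m + 2)) ≠ 0 := by
    intro α β γ hαβ h
    have h01 : c 0 ≠ c 1 := fun e => absurd (hc e) (by decide)
    have h02 : c 0 ≠ c 2 := fun e => absurd (hc e) (by decide)
    have h12 : c 1 ≠ c 2 := fun e => absurd (hc e) (by decide)
    have h1 := DFunLike.congr_fun h ⟨_, X_sub_X_mem_specht h01⟩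
    rw [hookIntertwiner_apply, linearCoeffs_X_sub_X] at h1
    have h2 := congrFun h1 ![c 0, c 0]
    have h3 := congrFun h1 ![c 0, c 2]
    rw [linearTensor_apply, if_pos rfl, Pi.sub_apply, Pi.single_eq_same,
      Pi.single_eq_of_ne h01, sub_zero, mul_one] at h2
    rw [linearTensor_apply, if_neg h02, Pi.sub_apply, Pi.sub_apply, Pi.single_eq_same,
      Pi.single_eq_of_ne h01, Pi.single_eq_of_ne h02.symm, Pi.single_eq_of_ne h12.symm, sub_zero,
      sub_zero, mul_one, mul_zero, add_zero] at h3
    exact hαβ.elim (· h2) (· h3)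
  fin_cases i
  · exact hrow _ _ one_ne_zero
  · exact hrow _ _ hm
  · exact hhook _ _ _ (.inl one_ne_zero)
  · exact hhook _ _ _ (.inl hm)
  · exact hhook _ _ _ (.inr hm)
  · change quadIntertwiner (m + 4) 1 (twoTwoShape m) ≠ 0
    intro h
    have hinj : ![c 0, c 1, c 2, c 3].Injective := by
      convert hc using 1; funext i; fin_cases i <;> rfl
    have := congrFun (DFunLike.congr_fun h ⟨_, twoTwo_mem_specht hinj⟩) ![c 0, c 2]
    rw [quadIntertwiner_apply, quadCoeffs_twoTwo] at this
    simp [hc.eq_iff] at this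
  · change quadIntertwiner (m + 4) 2 (longHookShape (m + 1)) ≠ 0
    intro h
    have hinj : ![c 0, c 1, c 2].Injective := by
      convert hc.comp (Fin.castSucc_injective 3) using 1; funext i; fin_cases i <;> rfl
    have := congrFun (DFunLike.congr_fun h ⟨_, vandermonde_mem_specht (m := m + 1) hinj⟩)
      ![c 0, c 1]
    rw [quadIntertwiner_apply, quadCoeffs_vandermonde] at this
    simp [hc.eq_iff] at this

lemma rowIntertwiner_eq (N : ℕ) (α β a b α₁ β₁ α₂ β₂ : ℂ) (μ : YoungDiagram)
    (h1 : α = a * α₁ + b * α₂) (h2 : β = a * β₁ + b * β₂) :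
    rowIntertwiner N α β μ = a • rowIntertwiner N α₁ β₁ μ + b • rowIntertwiner N α₂ β₂ μ := by
  refine DFunLike.ext _ _ fun v => tensor_ext_two fun p q => ?_
  change coeff 0 v.1 * constTensor N α β ![p, q] =
    a * (coeff 0 v.1 * constTensor N α₁ β₁ ![p, q]) +
      b * (coeff 0 v.1 * constTensor N α₂ β₂ ![p, q])
  simp only [constTensor_apply]
  split_ifs
  · linear_combination coeff 0 v.1 * h1
  · linear_combination coeff 0 v.1 * h2

lemma hookIntertwiner_eq (N : ℕ) (α β γ a b c α₁ β₁ γ₁ α₂ β₂ γ₂ α₃ β₃ γ₃ : ℂ) (μ : YoungDiagram)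
    (h1 : α = a * α₁ + b * α₂ + c * α₃) (h2 : β = a * β₁ + b * β₂ + c * β₃)
    (h3 : γ = a * γ₁ + b * γ₂ + c * γ₃) :
    hookIntertwiner N α β γ μ = a • hookIntertwiner N α₁ β₁ γ₁ μ
      + b • hookIntertwiner N α₂ β₂ γ₂ μ + c • hookIntertwiner N α₃ β₃ γ₃ μ := by
  refine DFunLike.ext _ _ fun v => tensor_ext_two fun p q => ?_
  change linearTensor N α β γ (linearCoeffs N v) ![p, q] =
    a * linearTensor N α₁ β₁ γ₁ (linearCoeffs N v) ![p, q]
      + b * linearTensor N α₂ β₂ γ₂ (linearCoeffs N v) ![p, q]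
      + c * linearTensor N α₃ β₃ γ₃ (linearCoeffs N v) ![p, q]
  simp only [linearTensor_apply]
  generalize linearCoeffs N v = x
  split_ifs
  · linear_combination x q * h1
  · linear_combination x p * h2 + x q * h3

lemma span_tabVec (i : Fin 4) : Submodule.span ℂ
    {ψ | ∃ j, shapeIdx j = i ∧ ψ = tabVec m (shapes m i) j} = ⊤ := by
  rw [eq_top_iff]
  intro φ _
  have hm3 : (m + 3 : ℂ) ≠ 0 := by exact_mod_cast Nat.succ_ne_zero (m + 2)
  have hm4 : (m + 4 : ℂ) ≠ 0 := by exact_mod_cast Nat.succ_ne_zero (m + 3)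
  have hmem : ∀ j, shapeIdx j = i → ∀ c : ℂ, c • tabVec m (shapes m i) j ∈
      Submodule.span ℂ {ψ | ∃ j, shapeIdx j = i ∧ ψ = tabVec m (shapes m i) j} :=
    fun j hj c => Submodule.smul_mem _ _ (Submodule.subset_span ⟨j, hj, rfl⟩)
  fin_cases i
  · obtain ⟨α, β, h⟩ := exists_eq_rowIntertwiner (by omega) φ
    -- The coefficients solve the two linear equations expressing (α, β) in the basis (1, 1), (N-1,
    -- -1).
    refine (h.trans (rowIntertwiner_eq _ _ _ ((α + (m + 3) * β) / (m + 4)) ((α - β) / (m + 4))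
      1 1 (m + 3) (-1) _ (by field_simp; ring) (by field_simp; ring))) ▸
        Submodule.add_mem _ (hmem 0 rfl _) (hmem 1 rfl _)
  · obtain ⟨α, β, γ, h⟩ := exists_eq_hookIntertwiner (by omega) φ
    -- Only the third vector has a β component, which fixes its coefficient as β/(N-1); a two-by-two
    -- system for α and γ - β/(N-1) remains.
    refine (h.trans (hookIntertwiner_eq _ _ _ _ ((α + (m + 3) * (γ - β / (m + 3))) / (m + 4))
      ((α - γ + β / (m + 3)) / (m + 4)) (β / (m + 3)) 1 0 1 (m + 3) 0 (-1) 0 (m + 3) 1 _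
      (by field_simp; ring) (by field_simp; ring) (by field_simp; ring))) ▸
        Submodule.add_mem _ (Submodule.add_mem _ (hmem 2 rfl _) (hmem 3 rfl _)) (hmem 4 rfl _)
  · obtain ⟨c, h⟩ := exists_eq_smul_quadIntertwiner_twoTwo φ
    exact h ▸ hmem 5 rfl c
  · obtain ⟨c, h⟩ := exists_eq_smul_quadIntertwiner_longHook φ
    exact h ▸ hmem 6 rfl c

/-- Each of the three Lagrange factors tests whether one label of tableau `i` agrees with that of
tableau `j`, and the labels determine the tableau. The half-integer projector was defined on other
multiplicity spaces; its polynomial expression in `Z₃₂` is what allows it to be evaluated here. -/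
lemma irrep_proj_tabVec (i j : Fin 7) :
    irrep 2 (m + 4) (shapes m (shapeIdx j)) (tab m i).proj (tabVec m (shapes m (shapeIdx j)) j) =
      if i = j then tabVec m (shapes m (shapeIdx j)) j else 0 := by
  set z := tabVec m (shapes m (shapeIdx j)) j
  have h1 := map_lagrangeProd_apply (irrepHom 2 (m + 4) (shapes m (shapeIdx j)))
    (nchar_Z₁_injOn (by omega)) (tabOne_mem m i) (tabOne_mem m j) (tabVec_Z₁ j)
  have h2 := map_lagrangeProd_apply (irrepHom 2 (m + 4) (shapes m (shapeIdx j)))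
    (ncharHalf_Z₃₂_injOn (by omega)) (tabHalf_mem m i) (tabHalf_mem m j) (tabVec_Z₃₂ j)
  have h3 := map_lagrangeProd_apply (irrepHom 2 (m + 4) (shapes m (shapeIdx j)))
    (nchar_Z₂_injOn (by omega)) (shapes_mem m (shapeIdx i)) (shapes_mem m (shapeIdx j)) (v := z)
    (by
      have := irrep_Z₂ (by omega) (shapes_mem m (shapeIdx j))
      exact LinearMap.congr_fun this z)
  rw [VacTab.proj_eq (by omega), irrep_mul, irrep_mul, Module.End.mul_apply, Module.End.mul_apply]
  refine (congrArg _ (congrArg _ h3)).trans ?_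
  split_ifs with e3 e e
  · refine (congrArg _ h2).trans ?_
    rw [if_pos (by rw [e]), ]
    exact h1.trans (if_pos (by rw [e]))
  · refine (congrArg _ h2).trans ?_
    split_ifs with e2
    · refine h1.trans (if_neg fun e1 => e ?_)
      exact (tab_eq_of_eq e1 e2 (shapes_injective m e3)).symm
    · exact map_zero _
  · exact absurd (by rw [e]) e3
  · rw [map_zero, map_zero]

end

/-! ### Matrices of P_2(N) in the bases indexed by tableaux. -/

/-- The vector in a multiplicity space that corresponds to a vacillating tableau. -/
noncomputable def VacTab.vec {m : ℕ} (v : VacTab (m + 3) 2) (μ : YoungDiagram) :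
    Irrep 2 (m + 4) μ := tabVec m μ ((tabEquiv m).symm v)

section

variable {m : ℕ}

lemma VacTab.shape_mem (v : VacTab (m + 3) 2) : v.shape ∈ labels (m + 4) 2 := v.whole_mem 2

lemma VacTab.vec_ne_zero (v : VacTab (m + 3) 2) : v.vec v.shape ≠ 0 := by
  obtain ⟨i, rfl⟩ := (tabEquiv m).surjective v
  rw [VacTab.vec, Equiv.symm_apply_apply]
  exact tabVec_ne_zero i

open Classical in
lemma VacTab.irrep_proj_vec (v w : VacTab (m + 3) 2) :
    irrep 2 (m + 4) w.shape v.proj (w.vec w.shape) = if v = w then w.vec w.shape else 0 := by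
  obtain ⟨i, rfl⟩ := (tabEquiv m).surjective v
  obtain ⟨j, rfl⟩ := (tabEquiv m).surjective w
  simp only [VacTab.vec, Equiv.symm_apply_apply, EmbeddingLike.apply_eq_iff_eq]
  refine (irrep_proj_tabVec i j).trans ?_
  split_ifs <;> rfl

lemma VacTab.span_vec {μ : YoungDiagram} (hμ : μ ∈ labels (m + 4) 2) :
    ⊤ ≤ Submodule.span ℂ
      (Set.range fun v : {v : VacTab (m + 3) 2 // v.shape = μ} => v.1.vec μ) := by
  obtain ⟨i, rfl⟩ := exists_shapes_eq hμ
  rw [← span_tabVec i]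
  refine Submodule.span_mono ?_
  rintro _ ⟨j, hj, rfl⟩
  refine ⟨⟨tabEquiv m j, congrArg (shapes m) hj⟩, ?_⟩
  simp only [VacTab.vec, Equiv.symm_apply_apply]

lemma VacTab.finrank_range_proj (v : VacTab (m + 3) 2) :
    Module.finrank ℂ (LinearMap.range (irrep 2 (m + 4) v.shape v.proj)) = 1 := by
  classical
  have h : LinearMap.range (irrep 2 (m + 4) v.shape v.proj) =
      Submodule.span ℂ {v.vec v.shape} := by
    apply le_antisymm
    · rw [LinearMap.range_eq_map, ← top_le_iff.1 (VacTab.span_vec v.shape_mem),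
        Submodule.map_span, Submodule.span_le]
      rintro _ ⟨_, ⟨⟨w, hw⟩, rfl⟩, rfl⟩
      change irrep 2 (m + 4) v.shape v.proj (w.vec v.shape) ∈ _
      rw [← hw, VacTab.irrep_proj_vec v w]
      split_ifs with e
      · rw [e]; exact Submodule.mem_span_singleton_self _
      · exact Submodule.zero_mem _
    · rw [Submodule.span_singleton_le_iff_mem]
      exact ⟨v.vec v.shape, by rw [VacTab.irrep_proj_vec, if_pos rfl]⟩
  rw [h, finrank_span_singleton v.vec_ne_zero]

/-- Applying p_v to a linear relation leaves only the term of v. -/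
lemma VacTab.linearIndependent_vec (μ : YoungDiagram) :
    LinearIndependent ℂ fun v : {v : VacTab (m + 3) 2 // v.shape = μ} => v.1.vec μ := by
  classical
  rw [linearIndependent_iff']
  rintro s c hc ⟨v, hv⟩ hvs
  subst hv
  have h := congrArg (irrep 2 (m + 4) v.shape v.proj) hc
  rw [map_sum, map_zero, Finset.sum_eq_single_of_mem _ hvs] at h
  · rw [map_smul, VacTab.irrep_proj_vec, if_pos rfl] at h
    exact (smul_eq_zero.1 h).resolve_right v.vec_ne_zero
  · rintro ⟨w, hw⟩ _ hne
    have : irrep 2 (m + 4) v.shape v.proj (w.vec v.shape) = 0 := by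
      rw [← hw, VacTab.irrep_proj_vec, if_neg]
      rintro rfl
      exact hne rfl
    rw [map_smul, this, smul_zero]

/-- The basis of a multiplicity space that is indexed by vacillating tableaux. -/
noncomputable def vecBasis {μ : YoungDiagram} (hμ : μ ∈ labels (m + 4) 2) :
    Module.Basis {v : VacTab (m + 3) 2 // v.shape = μ} ℂ (Irrep 2 (m + 4) μ) :=
  Module.Basis.mk (VacTab.linearIndependent_vec μ) (VacTab.span_vec hμ)

lemma vecBasis_apply {μ : YoungDiagram} (hμ : μ ∈ labels (m + 4) 2)
    (v : {v : VacTab (m + 3) 2 // v.shape = μ}) : vecBasis hμ v = v.1.vec μ :=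
  Module.Basis.mk_apply _ _ _

noncomputable instance : Fintype (VacTab (m + 3) 2) := Fintype.ofEquiv _ (tabEquiv m)

open Classical in
/-- The matrix of an element of `P_2(N)` in a multiplicity space. -/
noncomputable def irrepMatrix {μ : YoungDiagram} (hμ : μ ∈ labels (m + 4) 2) :
    PartitionAlgebra 2 (m + 4) →ₗ[ℂ] Matrix {v : VacTab (m + 3) 2 // v.shape = μ}
      {v : VacTab (m + 3) 2 // v.shape = μ} ℂ :=
  (LinearMap.toMatrix (vecBasis hμ) (vecBasis hμ)).toLinearMap ∘ₗ irrep 2 (m + 4) μ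

open Classical in
lemma irrepMatrix_mul {μ : YoungDiagram} (hμ : μ ∈ labels (m + 4) 2)
    (x y : PartitionAlgebra 2 (m + 4)) :
    irrepMatrix hμ (x * y) = irrepMatrix hμ x * irrepMatrix hμ y := by
  classical
  simp only [irrepMatrix, LinearMap.comp_apply, irrep_mul, LinearEquiv.coe_coe]
  exact LinearMap.toMatrix_mul _ _ _

lemma irrepMatrix_apply {μ : YoungDiagram} (hμ : μ ∈ labels (m + 4) 2)
    (x : PartitionAlgebra 2 (m + 4)) (v w : {v : VacTab (m + 3) 2 // v.shape = μ}) :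
    irrepMatrix hμ x v w = (vecBasis hμ).repr (irrep 2 (m + 4) μ x (w.1.vec μ)) v := by
  classical
  rw [← vecBasis_apply hμ]
  exact LinearMap.toMatrix_apply _ _ _ _ _

open Classical in
/-- The block diagonal matrix of an element of `P_2(N)` in the sum of the multiplicity spaces. -/
noncomputable def blockMatrix (m : ℕ) : PartitionAlgebra 2 (m + 4) →ₗ[ℂ]
    Matrix (VacTab (m + 3) 2) (VacTab (m + 3) 2) ℂ :=
  (Matrix.ofLinearEquiv ℂ).toLinearMap ∘ₗ LinearMap.pi fun v => LinearMap.pi fun w =>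
    if h : v.shape = w.shape then
      Matrix.entryLinearMap ℂ ℂ ⟨v, h⟩ ⟨w, rfl⟩ ∘ₗ irrepMatrix w.shape_mem
    else 0

lemma blockMatrix_of_ne (x : PartitionAlgebra 2 (m + 4)) {v w : VacTab (m + 3) 2}
    (h : v.shape ≠ w.shape) : blockMatrix m x v w = 0 :=
  LinearMap.congr_fun (dif_neg h) x

lemma blockMatrix_apply {μ : YoungDiagram} (hμ : μ ∈ labels (m + 4) 2)
    (x : PartitionAlgebra 2 (m + 4)) {v w : VacTab (m + 3) 2} (hv : v.shape = μ)
    (hw : w.shape = μ) : blockMatrix m x v w = irrepMatrix hμ x ⟨v, hv⟩ ⟨w, hw⟩ := by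
  subst hw
  exact LinearMap.congr_fun (dif_pos hv) x

lemma blockMatrix_mul (x y : PartitionAlgebra 2 (m + 4)) :
    blockMatrix m (x * y) = blockMatrix m x * blockMatrix m y := by
  classical
  ext v w
  rw [Matrix.mul_apply]
  by_cases h : v.shape = w.shape
  · rw [blockMatrix_apply w.shape_mem _ h rfl, irrepMatrix_mul, Matrix.mul_apply]
    -- Only tableaux in the common block contribute to the full matrix product.
    refine (Finset.sum_congr_set {u : VacTab (m + 3) 2 | u.shape = w.shape} _ _
      (fun u hu => ?_) fun u hu => ?_).symm
    · rw [blockMatrix_apply w.shape_mem x h hu, blockMatrix_apply w.shape_mem y hu rfl]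
    · rw [blockMatrix_of_ne y hu, mul_zero]
  · rw [blockMatrix_of_ne _ h, Finset.sum_eq_zero]
    intro u _
    by_cases hu : v.shape = u.shape
    · rw [blockMatrix_of_ne y (hu ▸ h), mul_zero]
    · rw [blockMatrix_of_ne x hu, zero_mul]

lemma blockMatrix_injective (m : ℕ) : Function.Injective (blockMatrix m) := by
  classical
  intro x y e
  refine ext_irrep_two (by omega) fun μ hμ => ?_
  refine (LinearMap.toMatrix (vecBasis hμ) (vecBasis hμ)).injective ?_
  change irrepMatrix hμ x = irrepMatrix hμ y
  ext v w
  rw [← blockMatrix_apply hμ x v.2 w.2, e, blockMatrix_apply hμ y v.2 w.2]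

open Classical in
lemma blockMatrix_proj (v : VacTab (m + 3) 2) :
    blockMatrix m v.proj = Matrix.single v v 1 := by
  ext u w
  by_cases h : u.shape = w.shape
  · rw [blockMatrix_apply w.shape_mem _ h rfl, irrepMatrix_apply, VacTab.irrep_proj_vec,
      Matrix.single_apply]
    split_ifs with h1 h2 h2
    · obtain ⟨rfl, -⟩ := h2
      subst h1
      rw [← vecBasis_apply v.shape_mem ⟨v, rfl⟩]
      simp
    · subst h1
      rw [← vecBasis_apply v.shape_mem ⟨v, rfl⟩]
      simp only [Module.Basis.repr_self]
      rw [Finsupp.single_eq_of_ne]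
      rintro e
      exact h2 ⟨(Subtype.ext_iff.1 e).symm, rfl⟩
    · exact absurd h2.2 h1
    · simp
  · rw [blockMatrix_of_ne _ h, Matrix.single_apply_of_ne]
    rintro ⟨rfl, rfl⟩
    exact h rfl

end

end PartAlg

theorem mainTheorem8 (n : ℕ) (hn : 3 ≤ n) :
    -- duality with sums of transpositions (with `N = n + 1`)
    ((schurWeyl 1 (n + 1) (Z₁ (n + 1))).toLinearMap =
        transpositionSum (tensorRep (n + 1) 1) - (((n + 1).choose 2 : ℂ) - (n + 1)) • 1 ∧
      Z₃₂ (n + 1) ∈ halfAlgebra 1 (n + 1) ∧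
      (schurWeylHalf 1 n (Z₃₂ (n + 1))).toLinearMap =
        transpositionSum (tensorRepHalf n 1)
          - (((n + 1).choose 2 : ℂ) - 2 * (n + 1) + 1) • 1 ∧
      (schurWeyl 2 (n + 1) (Z₂ (n + 1))).toLinearMap =
        transpositionSum (tensorRep (n + 1) 2) - (((n + 1).choose 2 : ℂ) - 2 * (n + 1)) • 1) ∧
    -- action by normalized characters, their values, and their distinctness
    ((∀ ρ ∈ labels (n + 1) 1,
        irrep 1 (n + 1) ρ (Z₁ (n + 1)) = nchar (Z₁ (n + 1)) ρ • 1 ∧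
        nchar (Z₁ (n + 1)) ρ = contentSum ρ - (((n + 1).choose 2 : ℂ) - (n + 1))) ∧
      (∀ ρ ∈ labels n 1,
        irrepHalf 1 n ρ (Z₃₂ (n + 1)) = ncharHalf (Z₃₂ (n + 1)) ρ • 1 ∧
        ncharHalf (Z₃₂ (n + 1)) ρ =
          contentSum ρ - (((n + 1).choose 2 : ℂ) - 2 * (n + 1) + 1)) ∧
      (∀ ρ ∈ labels (n + 1) 2,
        irrep 2 (n + 1) ρ (Z₂ (n + 1)) = nchar (Z₂ (n + 1)) ρ • 1 ∧
        nchar (Z₂ (n + 1)) ρ = contentSum ρ - (((n + 1).choose 2 : ℂ) - 2 * (n + 1))) ∧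
      Set.InjOn (nchar (Z₁ (n + 1))) (labels (n + 1) 1) ∧
      Set.InjOn (ncharHalf (k := 1) (n := n) (Z₃₂ (n + 1))) (labels n 1) ∧
      Set.InjOn (nchar (Z₂ (n + 1))) (labels (n + 1) 2)) ∧
    -- existence and uniqueness of the projectors to the irreducible representations
    ((∀ μ ∈ labels (n + 1) 1, ∃! p, IsProj 1 (n + 1) μ p) ∧
      (∀ μ ∈ labels n 1, ∃! p, IsProjHalf 1 n μ p) ∧
      (∀ μ ∈ labels (n + 1) 2, ∃! p, IsProj 2 (n + 1) μ p)) ∧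
    -- the interpolation formula for the projector of a vacillating tableau
    (∀ v : VacTab n 2, v.proj =
      lagrangeProd (labels (n + 1) 1) (nchar (Z₁ (n + 1))) (v.whole 1)
          (addStrand 1 (n + 1) (Z₁ (n + 1))) *
        lagrangeProd (labels n 1) (ncharHalf (k := 1) (n := n) (Z₃₂ (n + 1))) (v.half 1)
          (Z₃₂ (n + 1)) *
        lagrangeProd (labels (n + 1) 2) (nchar (Z₂ (n + 1))) (v.whole 2) (Z₂ (n + 1))) ∧
    -- the image of the projector in the irreducible representation is one-dimensional
    (∀ v : VacTab n 2,
      Module.finrank ℂ (LinearMap.range (irrep 2 (n + 1) v.shape v.proj)) = 1) ∧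
    -- the images of `d ↦ p_v d p_w` are one-dimensional, spanned by matrix units
    ∃ Q : VacTab n 2 → VacTab n 2 → PartitionAlgebra 2 (n + 1),
      (∀ v w, v.shape = w.shape →
        Module.finrank ℂ (LinearMap.range (sandwich v.proj w.proj)) = 1 ∧
        LinearMap.range (sandwich v.proj w.proj) = Submodule.span ℂ {Q v w}) ∧
      (∀ v w v' w', v.shape = w.shape → v'.shape = w'.shape →
        (w = v' → Q v w * Q v' w' = Q v w') ∧ (w ≠ v' → Q v w * Q v' w' = 0)) ∧
      LinearIndependent ℂ
        (fun x : {x : VacTab n 2 × VacTab n 2 // x.1.shape = x.2.shape} => Q x.1.1 x.1.2) ∧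
      Submodule.span ℂ (Set.range
        (fun x : {x : VacTab n 2 × VacTab n 2 // x.1.shape = x.2.shape} => Q x.1.1 x.1.2)) = ⊤ := by
  obtain ⟨m, rfl⟩ := Nat.exists_eq_add_of_le' hn
  have h2 : 2 ≤ m + 3 + 1 := by omega
  have h3 : 2 ≤ m + 3 := by omega
  have h4 : 4 ≤ m + 3 + 1 := by omega
  -- The constants in the goal are written with the cast of `n` plus 1, whereas the lemmas for Z₁
  -- and Z₂ use the cast of `N` itself.
  have hcast : ((m + 3 + 1 : ℕ) : ℂ) = ((m + 3 : ℕ) : ℂ) + 1 := Nat.cast_succ _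
  refine ⟨⟨?_, Z₃₂_mem _, schurWeylHalf_Z₃₂_eq _, ?_⟩,
    ⟨fun ρ hρ => ⟨irrep_Z₁ h2 hρ, ?_⟩,
      fun ρ hρ => ⟨irrepHalf_Z₃₂ h3 hρ, ncharHalf_Z₃₂ h3 hρ⟩,
      fun ρ hρ => ⟨irrep_Z₂ h4 hρ, ?_⟩,
      nchar_Z₁_injOn h2, ncharHalf_Z₃₂_injOn h3, nchar_Z₂_injOn h4⟩,
    ⟨fun μ hμ => existsUnique_isProj_one h2 hμ, fun μ hμ => existsUnique_isProjHalf hn hμ,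
      fun μ hμ => existsUnique_isProj_two h4 hμ⟩,
    VacTab.proj_eq hn, VacTab.finrank_range_proj, ?_⟩
  · rw [← hcast]; exact act_Z₁_eq _
  · rw [← hcast]; exact act_Z₂_eq _
  · rw [← hcast]; exact nchar_Z₁ h2 hρ
  · rw [← hcast]; exact nchar_Z₂ h4 hρ
  · classical
    exact exists_matrixUnits VacTab.shape VacTab.proj (blockMatrix m) (blockMatrix_injective m)
      blockMatrix_mul (fun x v w => blockMatrix_of_ne x) blockMatrix_proj (by
        rw [card_pairs, finrank_partitionAlgebra]
        exact card_diagram_two)
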